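/- **Theorem 1.2.** Let $\mathbb T^3=\mathbb R^3/\mathbb Z^3$, $0<T<\infty$, let $u_0\in L^2(\mathbb T^3;\mathbb R^3)$ satisfy $\operatorname{div}u_0=0$ in the sense of distributions, and let $u=(u_1,u_2,u_3)$ be a weak solution on $(0,T)\times\mathbb T^3$ of the incompressible Euler equations $$\partial_t u+u\cdot\nabla u+\nabla\Pi=0,\qquad \operatorname{div}u=0,\qquad u|_{t=0}=u_0,$$ that is, $u\in L^2((0,T)\times\mathbb T^3;\mathbb R^3)$, $\operatorname{div}u(t)=0$ in the sense of distributions for a.e. $t\in(0,T)$, and $$\int_0^T\!\!\int_{\mathbb T^3}\Big(u\cdot\partial_t\psi+\sum_{i,j=1}^3u_iu_j\,\partial_i\psi_j\Big)\,dx\,dt+\int_{\mathbb T^3}u_0\cdot\psi(0)\,dx=0$$ for all $\psi\in C_c^\infty([0,T)\times\mathbb T^3;\mathbb R^3)$ with $\operatorname{div}\psi=0$. (In particular every weak solution of finite energy, $u\in L^\infty(0,T;L^2(\mathbb T^3))$ or $u\in C_w([0,T];L^2(\mathbb T^3))$, is admitted.) Let $\frac13\le\alpha<1$ and $\beta\ge\frac{1-\alpha}2$,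 and assume that the horizontal part $u_h=(u_1,u_2)$ lies in the Besov-VMO space $L^3(0,T;\underline B^{\alpha}_{3,VMO}(\mathbb T^3))$ and that $u_3\in L^3(0,T;B^{\beta}_{3,\infty}(\mathbb T^3))$. This means the following. * For $f=u_1$ and for $f=u_2$: $f\in L^3(0,T;L^3(\mathbb T^3))$ and $$\lim_{\varepsilon\to0^+}\frac1{\varepsilon^{\alpha}}\left(\int_0^T\int_{\mathbb T^3}\frac{1}{|B_\varepsilon(0)|}\int_{B_\varepsilon(0)}|f(t,x)-f(t,x-y)|^3\,dy\,dx\,dt\right)^{1/3}=0.$$ * $\displaystyle\int_0^T\|u_3(t)\|_{B^\beta_{3,\infty}(\mathbb T^3)}^3\,dt<\infty$, where $$\|f\|_{B^\beta_{3,\infty}(\mathbb T^3)}=\|f\|_{L^3(\mathbb T^3)}+\sup_{h\in\mathbb R^3\setminus\{0\}}|h|^{-\beta}\,\|\Delta_h^{m}f\|_{L^3(\mathbb T^3)},\qquad \Delta_hf(x)=f(x+h)-f(x),\quad m=\lfloor\beta\rfloor+1$$ (so only the first difference $\Delta_hf$ occurs if $\beta<1$). Then the kinetic energy is conserved: $$\frac12\int_{\mathbb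 T^3}|u(t,x)|^2\,dx=\frac12\int_{\mathbb T^3}|u_0(x)|^2\,dx\qquad\text{for a.e. }t\in(0,T),$$ and for every $t\in[0,T]$ if $u\in C_w([0,T];L^2(\mathbb T^3))$, that is, if $u(t)\in L^2(\mathbb T^3)$ for every $t\in[0,T]$ and $t\mapsto\int_{\mathbb T^3}u(t)\cdot w\,dx$ is continuous on $[0,T]$ for every $w\in L^2(\mathbb T^3;\mathbb R^3)$. -/

import Mathlib

open MeasureTheory Set Filter Topology
open scoped NNReal ENNReal ContDiff

noncomputable section

namespace TorusEuler

/-- The Euclidean space `ℝ³`. -/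
abbrev E3 := EuclideanSpace ℝ (Fin 3)

/-- Functions on the torus `𝕋³ = ℝ³ / ℤ³` are functions on `ℝ³` that have period one in each
coordinate direction. -/
def IsPeriodic {F : Type*} (f : E3 → F) : Prop :=
  ∀ i : Fin 3, Function.Periodic f (EuclideanSpace.single i (1 : ℝ))

/-- The fundamental cell `[0,1)³` of the torus. -/
def cell : Set E3 := {x | ∀ i, x i ∈ Ico (0 : ℝ) 1}

/-- The (normalized) Lebesgue measure of the torus. -/
def torusMeasure : Measure E3 := volume.restrict cell

/-- The Lebesgue measure of `(0,T) × 𝕋³`. -/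
def spaceTimeMeasure (T : ℝ) : Measure (ℝ × E3) :=
  (volume.restrict (Ioo 0 T)).prod torusMeasure

/-- The divergence of a differentiable vector field. -/
def divergence (v : E3 → E3) (x : E3) : ℝ :=
  ∑ i : Fin 3, (fderiv ℝ v x (EuclideanSpace.single i (1 : ℝ))) i

/-- The vector field `v` on the torus is divergence free in the sense of distributions:
`∫ v · ∇φ dx = 0` for all smooth functions `φ` on the torus. -/
def IsWeaklyDivFree (v : E3 → E3) : Prop :=
  ∀ φ : E3 → ℝ, ContDiff ℝ ∞ φ → IsPeriodic φ →
    ∫ x, fderiv ℝ φ x (v x) ∂torusMeasure = 0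

/-- Divergence free test vector fields, smooth up to time `0`, with compact support in
`[0,T) × 𝕋³`. Values at negative times play no role. -/
structure IsTestField (T : ℝ) (ψ : ℝ → E3 → E3) : Prop where
  smooth : ContDiff ℝ ∞ (Function.uncurry ψ)
  periodic : ∀ t, IsPeriodic (ψ t)
  div_free : ∀ t x, divergence (ψ t) x = 0
  support : ∃ T' < T, ∀ t, T' ≤ t → ∀ x, ψ t x = 0

/-- `u` is a weak solution on `(0,T) × 𝕋³` of the incompressible Euler equations
`∂ₜ u + u · ∇u + ∇Π = 0`, `div u = 0`, with initial velocity `u₀`. The pressure is eliminated by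
testing with divergence free fields; `⟪u, (∇ψ) u⟫` is `∑ i j, u i * u j * ∂ i (ψ j)`. -/
structure IsWeakSolution (T : ℝ) (u : ℝ → E3 → E3) (u₀ : E3 → E3) : Prop where
  periodic : ∀ t ∈ Icc 0 T, IsPeriodic (u t)
  memLp : MemLp (Function.uncurry u) 2 (spaceTimeMeasure T)
  div_free : ∀ᵐ t ∂(volume.restrict (Ioo 0 T)), IsWeaklyDivFree (u t)
  init_periodic : IsPeriodic u₀
  init_memLp : MemLp u₀ 2 torusMeasure
  init_div_free : IsWeaklyDivFree u₀
  momentum : ∀ ψ : ℝ → E3 → E3, IsTestField T ψ →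
    (∫ t in Ioo 0 T, ∫ x, (inner ℝ (u t x) (deriv (fun s => ψ s x) t)
        + inner ℝ (u t x) (fderiv ℝ (ψ t) x (u t x))) ∂torusMeasure)
      + ∫ x, inner ℝ (u₀ x) (ψ 0 x) ∂torusMeasure = 0

/-- `u ∈ C_w([0,T]; L²(𝕋³))`: every `u t` is square integrable, and `u` is continuous in time for
the weak topology of `L²`. -/
def WeaklyContinuousL2 (T : ℝ) (u : ℝ → E3 → E3) : Prop :=
  (∀ t ∈ Icc 0 T, MemLp (u t) 2 torusMeasure) ∧
  ∀ w : E3 → E3, MemLp w 2 torusMeasure →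
    ContinuousOn (fun t => ∫ x, inner ℝ (u t x) (w x) ∂torusMeasure) (Icc 0 T)

/-- The kinetic energy `½ ∫ |v|² dx`, as an extended nonnegative number. -/
def kineticEnergy (v : E3 → E3) : ℝ≥0∞ :=
  2⁻¹ * ∫⁻ x, ‖v x‖ₑ ^ 2 ∂torusMeasure

/-- The norm of `B^β_{q,∞}(𝕋³)`, `β > 0`, through finite differences: with `m = ⌊β⌋ + 1`, it is
`‖f‖_{L^q} + sup_{h ≠ 0} |h|^{-β} ‖Δ_h^m f‖_{L^q}`, where `Δ_h f (x) = f (x + h) - f x`.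
For `0 < β < 1` only the first difference occurs. -/
def besovNorm (β : ℝ) (q : ℝ≥0) (f : E3 → ℝ) : ℝ≥0∞ :=
  eLpNorm f q torusMeasure +
    ⨆ (h : E3) (_ : h ≠ 0),
      ENNReal.ofReal (‖h‖ ^ (-β)) * eLpNorm ((fwdDiff h)^[⌊β⌋₊ + 1] f) q torusMeasure

/-- `f ∈ L^p(0,T; B^β_{q,∞}(𝕋³))`. -/
def MemLpBesov (T : ℝ) (p : ℝ≥0) (β : ℝ) (q : ℝ≥0) (f : ℝ → E3 → ℝ) : Prop :=
  AEStronglyMeasurable (Function.uncurry f) (spaceTimeMeasure T) ∧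
  ∫⁻ t in Ioo 0 T, besovNorm β q (f t) ^ (p : ℝ) < ⊤

/-- The averaged oscillation at scale `ε`,
`(∫₀ᵀ [∫_{𝕋³} ⨍_{B_ε(0)} |f(t,x) - f(t,x-y)|^q dy dx]^{p/q} dt)^{1/p}`. -/
def meanOscillation (T : ℝ) (p q : ℝ≥0) (f : ℝ → E3 → ℝ) (ε : ℝ) : ℝ≥0∞ :=
  (∫⁻ t in Ioo 0 T,
    (∫⁻ x, (⨍⁻ y in Metric.ball (0 : E3) ε, ‖f t x - f t (x - y)‖ₑ ^ (q : ℝ) ∂volume)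
      ∂torusMeasure) ^ ((p : ℝ) / q)) ^ (1 / (p : ℝ))

/-- `f` belongs to the Besov-VMO space `L^p(0,T; B^α_{q,VMO}(𝕋³))`: it lies in
`L^p(0,T; L^q(𝕋³))`, and its averaged oscillation at scale `ε` is `o(ε^α)` as `ε → 0+`. -/
def MemLpBesovVMO (T : ℝ) (p : ℝ≥0) (α : ℝ) (q : ℝ≥0) (f : ℝ → E3 → ℝ) : Prop :=
  AEStronglyMeasurable (Function.uncurry f) (spaceTimeMeasure T) ∧
  ∫⁻ t in Ioo 0 T, eLpNorm (f t) q torusMeasure ^ (p : ℝ) < ⊤ ∧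
  Tendsto (fun ε : ℝ => ENNReal.ofReal (ε ^ (-α)) * meanOscillation T p q f ε)
    (𝓝[>] 0) (𝓝 0)

end TorusEuler

end

/-! Mollify the velocity with an even kernel `κ` at scale ε. The energy of `κ ⋆ u` changes only
through the flux, the integral of the commutators κ⋆(u_j u_k) - (κ⋆u_j)(κ⋆u_k) against ∂_j(κ⋆u_k)
(`flux_eq`). By the Constantin–E–Titi identity each commutator is quadratic in the increments u(x-y)
- u(x), |y| < ε (`enorm_conv_mul_sub_le`). Each gradient is ε⁻¹ times an average of increments,
because derivatives of `κ` have mean zero. The flux is therefore at most C/ε times a sum of products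
of three oscillations.

The one product with no horizontal component comes from j = k = 3, and there incompressibility
replaces ∂₃u₃ by -∂₁u₁ - ∂₂u₂. So every product contains a horizontal factor
(`exists_enorm_flux_le`). With γ = (1-α)/2, horizontal oscillations are o(ε^α) and vertical ones
O(ε^γ). The possible total exponents 3α, 2α+γ and α+2γ = 1 are all at least 1, and the horizontal
factor supplies the little o, so the flux tends to zero (`tendsto_mixed_flux`). Since α ≥ 1/3, γ is
at most 1/3 as well as at most β; a Marchaud type argument then extracts first differences of order
γ from the Besov norm, even when that norm is written with higher differences
(`exists_normL3_fwdDiff_le`).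

The energy balance of `κ ⋆ u` needs no regularity in time. Testing with products θ(t)w(x) gives, for
each `w`, an identity integrated in time, valid off a null set that depends on `w`
(`ae_eq_integral_of_weak_deriv`). In the separable Hilbert space of solenoidal fields countably many
`w` suffice: square each basis coefficient, an absolutely continuous function, and sum
(`exists_countable_norm_sq_eq`). The balance then holds for any velocity `v` at any time `t` at
which those countably many identities hold. Almost every time is of this kind; for a weakly
continuous solution every time is, by continuity. Letting ε → 0 gives the theorem
(`exists_countable_energy_eq`). -/

namespace TorusEuler

/-! ### Periodic functions and the measure of the torus -/

/-- The standard basis of `ℝ³`. -/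
noncomputable def stdBasis : Module.Basis (Fin 3) ℝ E3 :=
  (EuclideanSpace.basisFun (Fin 3) ℝ).toBasis

/-- The lattice `ℤ³`. -/
noncomputable abbrev lattice : Submodule ℤ E3 := Submodule.span ℤ (Set.range stdBasis)

theorem stdBasis_apply (i : Fin 3) : stdBasis i = EuclideanSpace.single i (1 : ℝ) := by
  simp [stdBasis]

theorem cell_eq_fundamentalDomain : cell = ZSpan.fundamentalDomain stdBasis := by
  ext x
  simp [cell, ZSpan.mem_fundamentalDomain, stdBasis]

theorem measurableSet_cell : MeasurableSet cell := by
  rw [cell_eq_fundamentalDomain]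
  exact ZSpan.fundamentalDomain_measurableSet _

theorem isAddFundamentalDomain_cell :
    IsAddFundamentalDomain lattice cell (volume : Measure E3) := by
  rw [cell_eq_fundamentalDomain]
  exact ZSpan.isAddFundamentalDomain stdBasis volume

instance : IsFiniteMeasure torusMeasure := by
  refine ⟨?_⟩
  rw [torusMeasure, Measure.restrict_apply_univ, cell_eq_fundamentalDomain]
  exact (ZSpan.fundamentalDomain_isBounded stdBasis).measure_lt_top

namespace IsPeriodic

variable {F G : Type*} {f : E3 → F}

theorem add_mem (hf : IsPeriodic f) {v : E3} (hv : v ∈ lattice) (x : E3) : f (v + x) = f x := by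
  induction hv using Submodule.span_induction generalizing x with
  | mem v hv =>
    obtain ⟨i, rfl⟩ := hv
    rw [stdBasis_apply, add_comm]
    exact hf i x
  | zero => simp
  | add v w _ _ h₁ h₂ => rw [add_assoc, h₁, h₂]
  | smul n v _ h =>
    have h₁ : Function.Periodic f v := fun y => by rw [add_comm]; exact h y
    rw [add_comm]
    exact h₁.zsmul n x

theorem comp_left (hf : IsPeriodic f) (g : F → G) : IsPeriodic fun x => g (f x) :=
  fun i x => congrArg g (hf i x)

theorem comp₂ {H : Type*} {g : E3 → G} (hf : IsPeriodic f) (hg : IsPeriodic g) (op : F → G → H) :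
    IsPeriodic fun x => op (f x) (g x) :=
  fun i x => by simp only [hf i x, hg i x]

theorem shift (hf : IsPeriodic f) (h : E3) : IsPeriodic fun x => f (x + h) := fun i x => by
  simp only [add_right_comm x _ h]
  exact hf i _

theorem shift_sub (hf : IsPeriodic f) (h : E3) : IsPeriodic fun x => f (x - h) := by
  simpa only [sub_eq_add_neg] using hf.shift (-h)

end IsPeriodic

theorem isPeriodic_comp_fract {F : Type*} (f : E3 → F) :
    IsPeriodic fun x => f (ZSpan.fract stdBasis x) := fun i x => by
  have h : EuclideanSpace.single i (1 : ℝ) ∈ lattice := by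
    rw [← stdBasis_apply]
    exact Submodule.subset_span ⟨i, rfl⟩
  simp only [ZSpan.fract_add_ZSpan stdBasis x h]

theorem fract_of_mem_cell {x : E3} (hx : x ∈ cell) : ZSpan.fract stdBasis x = x := by
  rw [ZSpan.fract_eq_self, ← cell_eq_fundamentalDomain]
  exact hx

theorem measurable_fract : Measurable (ZSpan.fract stdBasis) := by
  have h : ZSpan.fract stdBasis = fun x : E3 => WithLp.toLp 2 fun i => Int.fract (x i) := by
    funext x
    ext i
    exact ZSpan.repr_fract_apply stdBasis x i
  rw [h]
  refine (WithLp.measurable_toLp 2 _).comp (measurable_pi_lambda _ fun i => ?_)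
  exact (_root_.measurable_fract (R := ℝ)).comp (by fun_prop : Measurable fun x : E3 => x i)

instance : VAddInvariantMeasure lattice E3 volume :=
  ⟨fun v s _ => measure_preimage_add volume (v : E3) s⟩

/-- A translate of a fundamental domain is a fundamental domain. -/
theorem isAddFundamentalDomain_translate (h : E3) :
    IsAddFundamentalDomain lattice ((fun x => x + h) ⁻¹' cell) (volume : Measure E3) := by
  have := isAddFundamentalDomain_cell.preimage_of_equiv (ν := (volume : Measure E3))
    (f := fun x => x + h) (measurePreserving_add_right volume h).quasiMeasurePreserving
    (e := fun g => g) Function.bijective_id (fun g x => by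
      simp [Submodule.vadd_def, add_assoc])
  exact this

theorem lintegral_preimage_cell {f : E3 → ℝ≥0∞} (hf : IsPeriodic f) (h : E3) :
    ∫⁻ x in (fun x => x + h) ⁻¹' cell, f x = ∫⁻ x, f x ∂torusMeasure :=
  (isAddFundamentalDomain_translate h).setLIntegral_eq isAddFundamentalDomain_cell f
    fun g x => hf.add_mem g.2 x

theorem lintegral_shift {f : E3 → ℝ≥0∞} (hf : IsPeriodic f) (h : E3) :
    ∫⁻ x, f (x + h) ∂torusMeasure = ∫⁻ x, f x ∂torusMeasure := by
  rw [← lintegral_preimage_cell hf (-h), torusMeasure,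
    ← (measurePreserving_add_right (volume : Measure E3) h).setLIntegral_comp_preimage_emb
      (measurableEmbedding_addRight h) f, ← preimage_comp]
  have : (fun x : E3 => x + -h) ∘ (fun x => x + h) = id := by funext x; simp
  rw [this, preimage_id]

theorem integral_shift {F : Type*} [NormedAddCommGroup F] [NormedSpace ℝ F] {f : E3 → F}
    (hf : IsPeriodic f) (h : E3) :
    ∫ x, f (x + h) ∂torusMeasure = ∫ x, f x ∂torusMeasure := by
  have h₁ := (isAddFundamentalDomain_translate (-h)).setIntegral_eq isAddFundamentalDomain_cell
    (f := f) fun g x => hf.add_mem g.2 x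
  rw [torusMeasure, ← h₁,
    ← (measurePreserving_add_right (volume : Measure E3) h).setIntegral_preimage_emb
      (measurableEmbedding_addRight h) f, ← preimage_comp]
  have : (fun x : E3 => x + -h) ∘ (fun x => x + h) = id := by funext x; simp
  rw [this, preimage_id]

/-- A periodic property that holds almost everywhere on the cell holds almost everywhere. -/
theorem ae_volume_of_ae_torus {p : E3 → Prop} (hp : IsPeriodic p)
    (h : ∀ᵐ x ∂torusMeasure, p x) : ∀ᵐ x, p x := by
  rw [ae_iff]
  refine isAddFundamentalDomain_cell.measure_zero_of_invariant _ (fun g => ?_) ?_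
  · ext x
    rw [Set.mem_vadd_set_iff_neg_vadd_mem]
    have := hp.add_mem (-g).2 x
    simp only [mem_ofPred_eq, Submodule.vadd_def, vadd_eq_add, this]
  · have := ae_iff.1 h
    rwa [torusMeasure, Measure.restrict_apply' measurableSet_cell] at this

theorem ae_torus_of_ae_volume {p : E3 → Prop} (h : ∀ᵐ x, p x) : ∀ᵐ x ∂torusMeasure, p x :=
  ae_restrict_of_ae h

theorem eLpNorm_shift {F : Type*} [NormedAddCommGroup F] {f : E3 → F} (hf : IsPeriodic f)
    {p : ℝ≥0∞} (hp : p ≠ 0) (hp' : p ≠ ⊤) (h : E3) :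
    eLpNorm (fun x => f (x + h)) p torusMeasure = eLpNorm f p torusMeasure := by
  rw [eLpNorm_eq_lintegral_rpow_enorm_toReal hp hp', eLpNorm_eq_lintegral_rpow_enorm_toReal hp hp',
    lintegral_shift (f := fun x => ‖f x‖ₑ ^ p.toReal) (hf.comp_left fun y => ‖y‖ₑ ^ p.toReal)]

/-- The integral over a ball of radius `1/2` is controlled by the integral over the torus. -/
theorem lintegral_ball_le {f : E3 → ℝ≥0∞} (hf : IsPeriodic f) (x : E3) {r : ℝ} (hr : r ≤ 1 / 2) :
    ∫⁻ y in Metric.ball x r, f y ≤ ∫⁻ y, f y ∂torusMeasure := by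
  -- This translate of the cell is the unit cube centred at `x`, which contains the ball.
  rw [← lintegral_preimage_cell hf (WithLp.toLp 2 (fun _ => 1 / 2) - x)]
  refine lintegral_mono_set fun y hy i => ?_
  have h₁ : |y i - x i| < 1 / 2 := by
    rw [Metric.mem_ball, dist_eq_norm] at hy
    refine lt_of_le_of_lt ?_ (hy.trans_le hr)
    simpa using PiLp.norm_apply_le (y - x) i
  rw [abs_lt] at h₁
  simp only [PiLp.add_apply, PiLp.sub_apply, mem_Ico]
  constructor <;> linarith [h₁.1, h₁.2]

theorem locallyIntegrable_of_periodic {F : Type*} [NormedAddCommGroup F] {f : E3 → F}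
    (hf : IsPeriodic f) (hm : AEStronglyMeasurable f volume) (hi : Integrable f torusMeasure) :
    LocallyIntegrable f volume := by
  intro x
  refine ⟨Metric.ball x (1 / 2), Metric.ball_mem_nhds x (by norm_num), hm.restrict, ?_⟩
  exact (lintegral_ball_le (hf.comp_left fun y => ‖y‖ₑ) x le_rfl).trans_lt hi.2

/-! ### Integration by parts on the torus -/

/-- The partial derivative `∂ᵢ f`. -/
noncomputable def partialDeriv {F : Type*} [NormedAddCommGroup F] [NormedSpace ℝ F] (i : Fin 3)
    (f : E3 → F) (x : E3) : F :=
  fderiv ℝ f x (EuclideanSpace.single i (1 : ℝ))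

section partialDeriv

variable {F : Type*} [NormedAddCommGroup F] [NormedSpace ℝ F]

theorem contDiff_partialDeriv {f : E3 → F} (hf : ContDiff ℝ ∞ f) (i : Fin 3) :
    ContDiff ℝ ∞ (partialDeriv i f) :=
  (hf.fderiv_right (m := ∞) (by norm_num)).clm_apply contDiff_const

theorem IsPeriodic.fderiv {f : E3 → F} (hf : IsPeriodic f) : IsPeriodic (fderiv ℝ f) := by
  intro i x
  have : f = fun y => f (y + EuclideanSpace.single i (1 : ℝ)) := by
    funext y
    exact (hf i y).symm
  conv_rhs => rw [this]
  rw [fderiv_comp_add_right]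

theorem IsPeriodic.partialDeriv {f : E3 → F} (hf : IsPeriodic f) (i : Fin 3) :
    IsPeriodic (partialDeriv i f) :=
  hf.fderiv.comp_left fun L => L (EuclideanSpace.single i (1 : ℝ))

theorem exists_bound_of_periodic {F : Type*} [NormedAddCommGroup F] {f : E3 → F} (hf : IsPeriodic f) (hc : Continuous f) :
    ∃ C, ∀ x, ‖f x‖ ≤ C := by
  obtain ⟨C, hC⟩ := (isCompact_closedBall (0 : E3)
    (∑ i, ‖stdBasis i‖)).exists_bound_of_continuousOn hc.continuousOn
  refine ⟨C, fun x => ?_⟩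
  have h : f x = f (ZSpan.fract stdBasis x) := by
    rw [ZSpan.fract_apply, sub_eq_neg_add, hf.add_mem (neg_mem (ZSpan.floor stdBasis x).2)]
  rw [h]
  refine hC _ ?_
  rw [mem_closedBall_zero_iff]
  exact ZSpan.norm_fract_le stdBasis x

theorem memLp_of_periodic_continuous {F : Type*} [NormedAddCommGroup F] [SecondCountableTopologyEither E3 F] {f : E3 → F}
    (hf : IsPeriodic f) (hc : Continuous f) (p : ℝ≥0∞) : MemLp f p torusMeasure := by
  obtain ⟨C, hC⟩ := exists_bound_of_periodic hf hc
  exact MemLp.of_bound hc.aestronglyMeasurable C (ae_of_all _ hC)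

theorem integrable_of_periodic_continuous {F : Type*} [NormedAddCommGroup F]
    [SecondCountableTopologyEither E3 F] {f : E3 → F}
    (hf : IsPeriodic f) (hc : Continuous f) : Integrable f torusMeasure :=
  memLp_one_iff_integrable.1 (memLp_of_periodic_continuous hf hc 1)

end partialDeriv

/-- The integral of a derivative over the torus vanishes. -/
theorem integral_partialDeriv_eq_zero {f : E3 → ℝ} (hf : IsPeriodic f) (hs : ContDiff ℝ ∞ f)
    (i : Fin 3) : ∫ x, partialDeriv i f x ∂torusMeasure = 0 := by
  set e : E3 := EuclideanSpace.single i (1 : ℝ)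
  have hD : Continuous (partialDeriv i f) := (contDiff_partialDeriv hs i).continuous
  obtain ⟨C, hC⟩ := exists_bound_of_periodic (hf.partialDeriv i) hD
  -- Over a full period the derivative integrates to zero. Integrating this in `x` and exchanging
  -- the integrals gives the claim, since all translates have the same integral.
  have h₁ : ∀ x : E3, ∫ t in (0 : ℝ)..1, partialDeriv i f (x + t • e) = 0 := by
    intro x
    have hd : ∀ t ∈ uIcc (0 : ℝ) 1,
        HasDerivAt (fun t : ℝ => f (x + t • e)) (partialDeriv i f (x + t • e)) t := by
      intro t _
      have h₂ : HasDerivAt (fun t : ℝ => x + t • e) e t := by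
        simpa using ((hasDerivAt_id t).smul_const e).const_add x
      exact ((hs.differentiable (by norm_num)) _).hasFDerivAt.comp_hasDerivAt t h₂
    rw [intervalIntegral.integral_eq_sub_of_hasDerivAt hd
      ((hD.comp (by fun_prop)).intervalIntegrable _ _)]
    have := hf i x
    simp only [one_smul, zero_smul, add_zero, sub_eq_zero]
    exact this
  have h₂ : ∫ x, (∫ t in (0 : ℝ)..1, partialDeriv i f (x + t • e)) ∂torusMeasure
      = ∫ t in (0 : ℝ)..1, (∫ x, partialDeriv i f (x + t • e) ∂torusMeasure) := by
    simp only [intervalIntegral.integral_of_le zero_le_one]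
    refine integral_integral_swap ?_
    refine Integrable.of_bound (Continuous.aestronglyMeasurable ?_) C (ae_of_all _ fun p => hC _)
    simp only [Function.uncurry_def]
    exact hD.comp (by fun_prop)
  simp only [h₁, integral_zero, integral_shift (hf.partialDeriv i)] at h₂
  simpa using h₂.symm

theorem partialDeriv_mul {f g : E3 → ℝ} (hf : ContDiff ℝ ∞ f) (hg : ContDiff ℝ ∞ g) (i : Fin 3)
    (x : E3) : partialDeriv i (fun x => f x * g x) x
      = f x * partialDeriv i g x + partialDeriv i f x * g x := by
  have h₁ := (hf.differentiable (by norm_num)) x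
  have h₂ := (hg.differentiable (by norm_num)) x
  simp only [partialDeriv, fderiv_fun_mul h₁ h₂]
  simp [mul_comm]

theorem integral_mul_partialDeriv {f g : E3 → ℝ} (hf : IsPeriodic f) (hfs : ContDiff ℝ ∞ f)
    (hg : IsPeriodic g) (hgs : ContDiff ℝ ∞ g) (i : Fin 3) :
    ∫ x, f x * partialDeriv i g x ∂torusMeasure
      = - ∫ x, partialDeriv i f x * g x ∂torusMeasure := by
  have h := integral_partialDeriv_eq_zero (hf.comp₂ hg (· * ·)) (hfs.mul hgs) i
  simp only [partialDeriv_mul hfs hgs] at h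
  rw [integral_add] at h
  · linarith
  · exact integrable_of_periodic_continuous (hf.comp₂ (hg.partialDeriv i) (· * ·))
      (hfs.continuous.mul (contDiff_partialDeriv hgs i).continuous)
  · exact integrable_of_periodic_continuous ((hf.partialDeriv i).comp₂ hg (· * ·))
      ((contDiff_partialDeriv hfs i).continuous.mul hgs.continuous)

theorem contDiff_coord {v : E3 → E3} (hv : ContDiff ℝ ∞ v) (i : Fin 3) :
    ContDiff ℝ ∞ fun x => v x i :=
  (EuclideanSpace.proj i : E3 →L[ℝ] ℝ).contDiff.comp hv

theorem partialDeriv_coord {v : E3 → E3} (hv : ContDiff ℝ ∞ v) (i k : Fin 3) (x : E3) :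
    partialDeriv i (fun x => v x k) x = (partialDeriv i v x) k := by
  have h := (EuclideanSpace.proj k : E3 →L[ℝ] ℝ).hasFDerivAt.comp x
    ((hv.differentiable (by norm_num)) x).hasFDerivAt
  have h' : fderiv ℝ (fun x => v x k) x = _ := h.fderiv
  rw [partialDeriv, h']
  rfl

theorem divergence_eq {v : E3 → E3} (hv : ContDiff ℝ ∞ v) (x : E3) :
    divergence v x = ∑ i, partialDeriv i (fun x => v x i) x := by
  simp only [partialDeriv_coord hv]
  rfl

theorem fderiv_apply_eq_sum {F : Type*} [NormedAddCommGroup F] [NormedSpace ℝ F] (f : E3 → F)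
    (x v : E3) : fderiv ℝ f x v = ∑ i, v i • partialDeriv i f x := by
  have h : v = ∑ i, v i • EuclideanSpace.single i (1 : ℝ) := by
    ext j
    simp [Finset.sum_apply, Pi.single_apply]
  conv_lhs => rw [h]
  simp only [map_sum, map_smul]
  rfl

/-- A smooth weakly divergence free field is divergence free. -/
theorem divergence_eq_zero {v : E3 → E3} (hv : ContDiff ℝ ∞ v) (hp : IsPeriodic v)
    (hd : IsWeaklyDivFree v) (x : E3) : divergence v x = 0 := by
  have hpc : ∀ i, IsPeriodic fun x => v x i := fun i => hp.comp_left fun y => y i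
  set d : E3 → ℝ := fun x => ∑ i, partialDeriv i (fun x => v x i) x with hdd
  have hds : ContDiff ℝ ∞ d :=
    ContDiff.sum fun i _ => contDiff_partialDeriv (contDiff_coord hv i) i
  have hdp : IsPeriodic d := fun j x => by
    simp only [hdd, (hpc _).partialDeriv _ j x]
  -- The divergence itself is the test function; integrating by parts gives ∫ d² = 0, and continuity
  -- then gives d = 0 everywhere.
  have h := hd d hds hdp
  simp only [fderiv_apply_eq_sum, smul_eq_mul] at h
  rw [integral_finsetSum] at h
  · have h₂ : ∫ x, d x * d x ∂torusMeasure = 0 := by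
      have : ∀ x, d x * d x = ∑ i, d x * partialDeriv i (fun x => v x i) x := fun x => by
        rw [← Finset.mul_sum]
      simp only [this]
      rw [integral_finsetSum]
      · rw [← neg_eq_zero, ← Finset.sum_neg_distrib, ← h]
        refine Finset.sum_congr rfl fun i _ => ?_
        rw [integral_mul_partialDeriv hdp hds (hpc i) (contDiff_coord hv i), neg_neg]
        simp only [mul_comm]
      · exact fun i _ => integrable_of_periodic_continuous
          (hdp.comp₂ ((hpc i).partialDeriv i) (· * ·))
          (hds.continuous.mul (contDiff_partialDeriv (contDiff_coord hv i) i).continuous)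
    rw [integral_eq_zero_iff_of_nonneg (fun x => mul_self_nonneg _)
      (integrable_of_periodic_continuous (hdp.comp_left fun y => y * y)
        (hds.continuous.mul hds.continuous))] at h₂
    have h₃ : (fun x => d x * d x) =ᵐ[volume] 0 :=
      ae_volume_of_ae_torus (p := fun x => d x * d x = 0)
        (hdp.comp_left fun y => y * y = 0) h₂
    have h₄ := (hds.continuous.mul hds.continuous).ae_eq_iff_eq volume continuous_zero |>.1 h₃
    rw [divergence_eq hv]
    exact mul_self_eq_zero.1 (congrFun h₄ x)
  · exact fun i _ => integrable_of_periodic_continuous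
      ((hpc i).comp₂ (hdp.partialDeriv i) (· * ·))
      ((contDiff_coord hv i).continuous.mul (contDiff_partialDeriv hds i).continuous)

/-! ### Convolution with a compactly supported kernel -/

/-- Measurable periodic functions of class `L^p` on the torus. -/
structure TorusMem {F : Type*} [NormedAddCommGroup F] [MeasurableSpace F] (p : ℝ≥0∞)
    (f : E3 → F) : Prop where
  measurable : Measurable f
  periodic : IsPeriodic f
  memLp : MemLp f p torusMeasure

/-- A smooth kernel with support in the ball of radius `1/2`. -/
structure IsKernel (κ : E3 → ℝ) : Prop where
  smooth : ContDiff ℝ ∞ κ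
  supp : tsupport κ ⊆ Metric.ball 0 (1 / 2)

/-- The convolution of a kernel with a function. -/
noncomputable def conv {F : Type*} [NormedAddCommGroup F] [NormedSpace ℝ F] (κ : E3 → ℝ)
    (f : E3 → F) (x : E3) : F :=
  ∫ y, κ y • f (x - y)

namespace TorusMem

variable {F : Type*} [NormedAddCommGroup F] [MeasurableSpace F] {f : E3 → F} {p q : ℝ≥0∞}

theorem mono (hf : TorusMem p f) (h : q ≤ p) : TorusMem q f :=
  ⟨hf.measurable, hf.periodic, hf.memLp.mono_exponent h⟩

theorem integrable (hf : TorusMem 1 f) : Integrable f torusMeasure :=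
  memLp_one_iff_integrable.1 hf.memLp

variable [BorelSpace F]

theorem of_continuous [SecondCountableTopologyEither E3 F] (hf : IsPeriodic f)
    (hc : Continuous f) : TorusMem p f :=
  ⟨hc.measurable, hf, memLp_of_periodic_continuous hf hc p⟩

theorem locallyIntegrable [SecondCountableTopology F] (hf : TorusMem 1 f) :
    LocallyIntegrable f volume :=
  locallyIntegrable_of_periodic hf.periodic hf.measurable.aestronglyMeasurable hf.integrable

theorem coord {f : E3 → E3} (hf : TorusMem p f) (i : Fin 3) : TorusMem p fun x => f x i :=
  ⟨(by fun_prop : Measurable fun y : E3 => y i).comp hf.measurable,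
    hf.periodic.comp_left fun y => y i,
    (EuclideanSpace.proj i : E3 →L[ℝ] ℝ).comp_memLp' hf.memLp⟩

end TorusMem

namespace IsKernel

variable {κ : E3 → ℝ}

theorem hasCompactSupport (hκ : IsKernel κ) : HasCompactSupport κ :=
  (isCompact_closedBall (0 : E3) (1 / 2)).of_isClosed_subset (isClosed_tsupport κ)
    (hκ.supp.trans Metric.ball_subset_closedBall)

theorem partialDeriv (hκ : IsKernel κ) (i : Fin 3) : IsKernel (partialDeriv i κ) := by
  refine ⟨contDiff_partialDeriv hκ.smooth i, fun x hx => hκ.supp ?_⟩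
  refine tsupport_fderiv_subset ℝ (closure_mono (fun y hy => ?_) hx)
  intro h
  exact hy (by simp [TorusEuler.partialDeriv, h])

theorem exists_bound (hκ : IsKernel κ) : ∃ C, 0 ≤ C ∧ ∀ x, |κ x| ≤ C := by
  obtain ⟨C, hC⟩ := hκ.hasCompactSupport.exists_bound_of_continuous hκ.smooth.continuous
  exact ⟨C, (norm_nonneg _).trans (hC 0), hC⟩

theorem integrable (hκ : IsKernel κ) : Integrable κ :=
  hκ.smooth.continuous.integrable_of_hasCompactSupport hκ.hasCompactSupport

theorem eq_zero (hκ : IsKernel κ) {x : E3} (hx : x ∉ Metric.ball (0 : E3) (1 / 2)) : κ x = 0 := by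
  by_contra h
  exact hx (hκ.supp (subset_tsupport κ h))

end IsKernel

section conv

variable {F : Type*} [NormedAddCommGroup F] [NormedSpace ℝ F] {κ : E3 → ℝ} {f : E3 → F}

theorem conv_eq_convolution (κ : E3 → ℝ) (f : E3 → F) :
    conv κ f = convolution κ f (ContinuousLinearMap.lsmul ℝ ℝ) volume := rfl

theorem IsPeriodic.conv (hf : IsPeriodic f) (κ : E3 → ℝ) : IsPeriodic (conv κ f) := by
  intro i x
  simp only [TorusEuler.conv, add_sub_right_comm, hf i _]

variable [MeasurableSpace F]

/-- The support of the kernel lies in a ball of radius 1/2, which fits into a single period cell, so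
no multiplicity of periods enters. -/
theorem lintegral_enorm_smul_le (hf : TorusMem 1 f) {C : ℝ} (hC : ∀ x, |κ x| ≤ C)
    (hκ : IsKernel κ) (x : E3) :
    ∫⁻ y, ‖κ y • f (x - y)‖ₑ ≤ ENNReal.ofReal C * ∫⁻ y, ‖f y‖ₑ ∂torusMeasure := by
  have hball : ∫⁻ y in Metric.ball (0 : E3) (1 / 2), ‖f (x - y)‖ₑ ≤
      ∫⁻ y, ‖f y‖ₑ ∂torusMeasure := by
    have h₁ := (Measure.measurePreserving_sub_left (volume : Measure E3)
      x).setLIntegral_comp_preimage_emb (MeasurableEquiv.subLeft x).measurableEmbedding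
      (fun y => ‖f y‖ₑ) (Metric.ball x (1 / 2))
    have h₂ : (fun y => x - y) ⁻¹' Metric.ball x (1 / 2) = Metric.ball (0 : E3) (1 / 2) := by
      ext y
      simp [dist_eq_norm]
    rw [h₂] at h₁
    rw [h₁]
    exact lintegral_ball_le (hf.periodic.comp_left fun y => ‖y‖ₑ) x le_rfl
  calc ∫⁻ y, ‖κ y • f (x - y)‖ₑ
      ≤ ∫⁻ y, (Metric.ball (0 : E3) (1 / 2)).indicator
          (fun y => ENNReal.ofReal C * ‖f (x - y)‖ₑ) y := by
        refine lintegral_mono fun y => ?_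
        by_cases hy : y ∈ Metric.ball (0 : E3) (1 / 2)
        · rw [indicator_of_mem hy, enorm_smul]
          gcongr
          rw [Real.enorm_eq_ofReal_abs]
          exact ENNReal.ofReal_le_ofReal (hC y)
        · simp [hκ.eq_zero hy]
    _ = ENNReal.ofReal C * ∫⁻ y in Metric.ball (0 : E3) (1 / 2), ‖f (x - y)‖ₑ := by
        rw [lintegral_indicator Metric.isOpen_ball.measurableSet,
          lintegral_const_mul' _ _ ENNReal.ofReal_ne_top]
    _ ≤ _ := by gcongr

theorem norm_conv_le (hf : TorusMem 1 f) {C : ℝ} (hC : ∀ x, |κ x| ≤ C) (hκ : IsKernel κ)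
    (x : E3) : ‖conv κ f x‖ ≤ C * ∫ y, ‖f y‖ ∂torusMeasure := by
  have hC0 : 0 ≤ C := (abs_nonneg _).trans (hC 0)
  have h₁ : ‖conv κ f x‖ₑ ≤ ENNReal.ofReal (C * ∫ y, ‖f y‖ ∂torusMeasure) := by
    rw [ENNReal.ofReal_mul hC0, ofReal_integral_norm_eq_lintegral_enorm hf.integrable]
    exact (enorm_integral_le_lintegral_enorm _).trans (lintegral_enorm_smul_le hf hC hκ x)
  rw [← ofReal_norm] at h₁
  exact (ENNReal.ofReal_le_ofReal_iff (by positivity)).1 h₁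

variable [BorelSpace F] [SecondCountableTopology F]

theorem contDiff_conv (hκ : IsKernel κ) (hf : TorusMem 1 f) : ContDiff ℝ ∞ (conv κ f) := by
  rw [conv_eq_convolution]
  exact hκ.hasCompactSupport.contDiff_convolution_left (n := ⊤) _ hκ.smooth hf.locallyIntegrable

theorem convolutionExists (hκ : IsKernel κ) (hf : TorusMem 1 f) (x : E3) :
    Integrable (fun y => κ y • f (x - y)) :=
  hκ.hasCompactSupport.convolutionExists_left (ContinuousLinearMap.lsmul ℝ ℝ)
    hκ.smooth.continuous hf.locallyIntegrable x

theorem torusMem_conv (hκ : IsKernel κ) (hf : TorusMem 1 f) (p : ℝ≥0∞) : TorusMem p (conv κ f) :=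
  .of_continuous (hf.periodic.conv κ) (contDiff_conv hκ hf).continuous

theorem partialDeriv_conv [CompleteSpace F] (hκ : IsKernel κ) (hf : TorusMem 1 f) (i : Fin 3)
    (x : E3) : partialDeriv i (conv κ f) x = conv (partialDeriv i κ) f x := by
  have h := hκ.hasCompactSupport.hasFDerivAt_convolution_left (ContinuousLinearMap.lsmul ℝ ℝ)
    (hκ.smooth.of_le (by norm_num)) hf.locallyIntegrable x
  have h' := (hκ.hasCompactSupport.fderiv ℝ).convolutionExists_left
    (ContinuousLinearMap.precompL E3 (ContinuousLinearMap.lsmul ℝ ℝ : ℝ →L[ℝ] F →L[ℝ] F))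
    ((hκ.smooth.fderiv_right (m := ∞) (by norm_num)).continuous) hf.locallyIntegrable x
  rw [conv_eq_convolution, partialDeriv, h.fderiv, convolution_def,
    ContinuousLinearMap.integral_apply h']
  rfl

theorem conv_coord {f : E3 → E3} (hκ : IsKernel κ) (hf : TorusMem 1 f) (i : Fin 3) (x : E3) :
    conv κ f x i = conv κ (fun x => f x i) x :=
  ((EuclideanSpace.proj i : E3 →L[ℝ] ℝ).integral_comp_comm (convolutionExists hκ hf x)).symm

/-- Integrating in `y` first gives a bound uniform in `x`, so integrability of `f` and `g`
separately is enough for Fubini. -/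
theorem integrable_conv_prod {f g : E3 → ℝ} (hκ : IsKernel κ) (hf : TorusMem 1 f)
    (hg : TorusMem 1 g) :
    Integrable (fun p : E3 × E3 => κ p.2 * f (p.1 - p.2) * g p.1)
      (torusMeasure.prod volume) := by
  obtain ⟨C, hC0, hC⟩ := hκ.exists_bound
  have hm : Measurable fun p : E3 × E3 => κ p.2 * f (p.1 - p.2) * g p.1 := by
    have := hκ.smooth.continuous.measurable
    have := hf.measurable
    have := hg.measurable
    fun_prop
  refine ⟨hm.aestronglyMeasurable, ?_⟩
  rw [hasFiniteIntegral_iff_enorm, lintegral_prod _ hm.enorm.aemeasurable]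
  simp only [enorm_mul _ (g _)]
  calc ∫⁻ x, (∫⁻ y, ‖κ y * f (x - y)‖ₑ * ‖g x‖ₑ) ∂torusMeasure
      ≤ ∫⁻ x, (ENNReal.ofReal C * ∫⁻ y, ‖f y‖ₑ ∂torusMeasure) * ‖g x‖ₑ ∂torusMeasure := by
        refine lintegral_mono fun x => ?_
        rw [lintegral_mul_const' _ _ enorm_ne_top]
        gcongr
        exact lintegral_enorm_smul_le hf hC hκ x
    _ = (ENNReal.ofReal C * ∫⁻ y, ‖f y‖ₑ ∂torusMeasure) * ∫⁻ x, ‖g x‖ₑ ∂torusMeasure :=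
        lintegral_const_mul _ hg.measurable.enorm
    _ < ⊤ := ENNReal.mul_lt_top (ENNReal.mul_lt_top ENNReal.ofReal_lt_top hf.integrable.2)
        hg.integrable.2

theorem IsKernel.comp_neg (hκ : IsKernel κ) : IsKernel fun y => κ (-y) := by
  refine ⟨hκ.smooth.comp contDiff_neg, fun x hx => ?_⟩
  have h := tsupport_comp_subset_preimage κ (f := fun y : E3 => -y) continuous_neg hx
  simpa using hκ.supp h

/-- Fubini and translation invariance of the torus: the adjoint of convolution is convolution with
the reflected kernel. -/
theorem integral_conv_mul {f g : E3 → ℝ} (hκ : IsKernel κ) (hf : TorusMem 1 f)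
    (hg : TorusMem 1 g) :
    ∫ x, conv κ f x * g x ∂torusMeasure
      = ∫ x, f x * conv (fun y => κ (-y)) g x ∂torusMeasure := by
  calc ∫ x, conv κ f x * g x ∂torusMeasure
      = ∫ x, (∫ y, κ y * f (x - y) * g x) ∂torusMeasure := by
        simp only [conv, smul_eq_mul, integral_mul_const]
    _ = ∫ y, ∫ x, κ y * f (x - y) * g x ∂torusMeasure :=
        integral_integral_swap (integrable_conv_prod hκ hf hg)
    _ = ∫ y, κ y * ∫ x, f x * g (x + y) ∂torusMeasure := by
        congr 1
        funext y
        rw [← integral_const_mul,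
          ← integral_shift ((hf.periodic.shift_sub y).comp₂ hg.periodic (κ y * · * ·)) y]
        simp only [add_sub_cancel_right, mul_assoc]
    _ = ∫ y, κ (-y) * ∫ x, f x * g (x - y) ∂torusMeasure := by
        rw [← integral_neg_eq_self]
        simp only [sub_eq_add_neg]
    _ = ∫ y, ∫ x, κ (-y) * g (x - y) * f x ∂torusMeasure := by
        congr 1
        funext y
        rw [← integral_const_mul]
        congr 1
        funext x
        ring
    _ = ∫ x, (∫ y, κ (-y) * g (x - y) * f x) ∂torusMeasure :=
        (integral_integral_swap (integrable_conv_prod hκ.comp_neg hg hf)).symm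
    _ = ∫ x, f x * conv (fun y => κ (-y)) g x ∂torusMeasure := by
        simp only [conv, smul_eq_mul, integral_mul_const]
        simp only [mul_comm]

end conv

/-! ### The energy identity for weak primitives in a Hilbert space -/

/-- Integration by parts of the primitive against itself. As `z` is only integrable, the primitive
is only absolutely continuous and its derivative is `z` almost everywhere. -/
theorem sq_primitive {z : ℝ → ℝ} {t g₀ : ℝ} (hz : IntervalIntegrable z volume 0 t) :
    (g₀ + ∫ s in (0 : ℝ)..t, z s) ^ 2
      = g₀ ^ 2 + 2 * ∫ r in (0 : ℝ)..t, (g₀ + ∫ s in (0 : ℝ)..r, z s) * z r := by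
  set F : ℝ → ℝ := fun r => ∫ s in (0 : ℝ)..r, z s with hF
  have hac : AbsolutelyContinuousOnInterval F 0 t :=
    hz.absolutelyContinuousOnInterval_intervalIntegral left_mem_uIcc
  have h := hac.integral_mul_deriv_eq_deriv_mul hac
  have hd : ∀ᵐ x ∂volume.restrict (uIoc 0 t), deriv F x = z x := by
    rw [ae_restrict_iff' measurableSet_uIoc]
    filter_upwards [hz.ae_hasDerivAt_integral] with x hx hx'
    exact (hx (uIoc_subset_uIcc hx') 0 left_mem_uIcc).deriv
  have h₁ : ∫ x in (0 : ℝ)..t, F x * deriv F x = ∫ x in (0 : ℝ)..t, F x * z x :=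
    intervalIntegral.integral_congr_ae_restrict (hd.mono fun x hx => by simp only [hx])
  have h₂ : ∫ x in (0 : ℝ)..t, deriv F x * F x = ∫ x in (0 : ℝ)..t, F x * z x :=
    intervalIntegral.integral_congr_ae_restrict
      (hd.mono fun x hx => by simp only [hx, mul_comm])
  have h₀ : F 0 = 0 := intervalIntegral.integral_same
  rw [h₁, h₂, h₀] at h
  have h₃ : ∫ r in (0 : ℝ)..t, (g₀ + F r) * z r = g₀ * F t + ∫ r in (0 : ℝ)..t, F r * z r := by
    simp only [add_mul]
    rw [intervalIntegral.integral_add (hz.const_mul g₀) (hz.continuousOn_mul hac.continuousOn),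
      intervalIntegral.integral_const_mul]
  change (g₀ + F t) ^ 2 = g₀ ^ 2 + 2 * ∫ r in (0 : ℝ)..t, (g₀ + F r) * z r
  rw [h₃]
  linarith

theorem restrict_Ioc_le_restrict_Ioo {t T : ℝ} (ht : t ≤ T) :
    (volume : Measure ℝ).restrict (Ioc 0 t) ≤ volume.restrict (Ioo 0 T) := by
  rw [restrict_Ioo_eq_restrict_Ioc]
  exact Measure.restrict_mono (Ioc_subset_Ioc_right ht) le_rfl

/-- Distinct members are at distance √2, so the balls of radius 1/2 around them are disjoint. -/
theorem _root_.Orthonormal.countable {H ι : Type*} [NormedAddCommGroup H] [InnerProductSpace ℝ H]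
    [TopologicalSpace.SeparableSpace H] {b : ι → H} (hb : Orthonormal ℝ b) : Countable ι := by
  refine Pairwise.countable_of_isOpen_disjoint (s := fun i => Metric.ball (b i) (1 / 2))
    (fun i j hij => ?_) (fun i => Metric.isOpen_ball)
    (fun i => ⟨b i, Metric.mem_ball_self (by norm_num)⟩)
  refine Metric.ball_disjoint_ball ?_
  have h : ‖b i - b j‖ ^ 2 = 2 := by
    rw [norm_sub_sq_real, hb.1 i, hb.1 j, hb.2 hij]
    norm_num
  rw [dist_eq_norm]
  nlinarith [norm_nonneg (b i - b j)]

/-- Cauchy–Schwarz and Bessel. The bound does not depend on `s`, so it dominates the partial sums of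
a basis expansion. -/
theorem abs_sum_inner_mul_inner_le {H ι : Type*} [NormedAddCommGroup H] [InnerProductSpace ℝ H]
    {b : ι → H} (hb : Orthonormal ℝ b) (x y : H) (s : Finset ι) :
    |∑ i ∈ s, inner ℝ x (b i) * inner ℝ y (b i)| ≤ ‖x‖ * ‖y‖ := by
  have h₁ := Finset.sum_mul_sq_le_sq_mul_sq s (fun i => inner ℝ x (b i)) (fun i => inner ℝ y (b i))
  have h₂ : ∀ x : H, ∑ i ∈ s, (inner ℝ x (b i)) ^ 2 ≤ ‖x‖ ^ 2 := fun x => by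
    have := hb.sum_inner_products_le x (s := s)
    simpa only [Real.norm_eq_abs, sq_abs, real_inner_comm] using this
  refine abs_le_of_sq_le_sq (h₁.trans ?_) (by positivity)
  rw [mul_pow]
  exact mul_le_mul (h₂ x) (h₂ y) (Finset.sum_nonneg fun i _ => sq_nonneg _) (sq_nonneg _)

/-- If `V` is a weak primitive of `Z`, then `‖V t‖² = ‖V₀‖² + 2 ∫₀ᵗ ⟪V, Z⟫`. The identity holds
at every time at which countably many scalar identities hold. -/
theorem exists_countable_norm_sq_eq {H : Type*} [NormedAddCommGroup H] [InnerProductSpace ℝ H]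
    [CompleteSpace H] [TopologicalSpace.SeparableSpace H] {T : ℝ} {V Z : ℝ → H} {V₀ : H}
    {m m' : ℝ → ℝ} (hZm : ∀ b : H,
      AEStronglyMeasurable (fun r => inner ℝ (Z r) b) (volume.restrict (Ioo 0 T)))
    (hm : Integrable m (volume.restrict (Ioo 0 T)))
    (hZ : ∀ᵐ r ∂volume.restrict (Ioo 0 T), ‖Z r‖ ≤ m r)
    (hm' : Integrable m' (volume.restrict (Ioo 0 T)))
    (hVZ : ∀ᵐ r ∂volume.restrict (Ioo 0 T), ‖V r‖ * ‖Z r‖ ≤ m' r)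
    (hV : ∀ b : H, ∀ᵐ t ∂volume.restrict (Ioo 0 T),
      inner ℝ (V t) b = inner ℝ V₀ b + ∫ r in (0 : ℝ)..t, inner ℝ (Z r) b) :
    ∃ B : Set H, B.Countable ∧ ∀ t ∈ Icc 0 T, ∀ v : H,
      (∀ b ∈ B, inner ℝ v b = inner ℝ V₀ b + ∫ r in (0 : ℝ)..t, inner ℝ (Z r) b) →
      ‖v‖ ^ 2 = ‖V₀‖ ^ 2 + 2 * ∫ r in (0 : ℝ)..t, inner ℝ (V r) (Z r) := by
  obtain ⟨w, b, -⟩ := exists_hilbertBasis ℝ H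
  -- Countability also makes the filter of finite index sets countably generated, as dominated
  -- convergence along it requires.
  have hw : Countable w := b.orthonormal.countable
  refine ⟨range b, countable_range b, fun t ht v hv => ?_⟩
  have hle := restrict_Ioc_le_restrict_Ioo ht.2
  have hzi : ∀ i, IntervalIntegrable (fun r => inner ℝ (Z r) (b i)) volume 0 t := fun i => by
    rw [intervalIntegrable_iff_integrableOn_Ioc_of_le ht.1]
    refine Integrable.mono_measure (hm.mono' (hZm _) (hZ.mono fun r hr => ?_)) hle
    refine (norm_inner_le_norm _ _).trans ?_
    rw [b.orthonormal.1 i, mul_one]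
    exact hr
  have hsq : ∀ i, inner ℝ v (b i) * inner ℝ (b i) v = inner ℝ V₀ (b i) * inner ℝ (b i) V₀
      + 2 * ∫ r in (0 : ℝ)..t, inner ℝ (V r) (b i) * inner ℝ (Z r) (b i) := fun i => by
    have h := sq_primitive (g₀ := inner ℝ V₀ (b i)) (hzi i)
    rw [← hv _ (mem_range_self i)] at h
    rw [real_inner_comm v (b i), real_inner_comm V₀ (b i), ← sq, ← sq, h]
    congr 2
    -- Under the integral the coefficient identity for `V` is needed only at almost every time; only
    -- the endpoint `t` needs the hypothesis on `v`.
    refine intervalIntegral.integral_congr_ae_restrict ?_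
    rw [uIoc_of_le ht.1]
    filter_upwards [ae_mono hle (hV (b i))] with r hr
    rw [hr]
  have h₁ := b.hasSum_inner_mul_inner v v
  have h₂ := b.hasSum_inner_mul_inner V₀ V₀
  have h₃ : HasSum (fun i => ∫ r in (0 : ℝ)..t, inner ℝ (V r) (b i) * inner ℝ (Z r) (b i))
      (∫ r in (0 : ℝ)..t, inner ℝ (V r) (Z r)) := by
    have hmeas : ∀ i, AEStronglyMeasurable (fun r => inner ℝ (V r) (b i) * inner ℝ (Z r) (b i))
        (volume.restrict (Ioc 0 t)) := fun i => by
      -- `V` is not assumed measurable: its coefficients are, because almost everywhere they equal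
      -- continuous primitives.
      refine AEStronglyMeasurable.mul ?_ ((hZm _).mono_measure hle)
      have hc : ContinuousOn (fun t => inner ℝ V₀ (b i) + ∫ r in (0 : ℝ)..t,
          inner ℝ (Z r) (b i)) (Ioc 0 t) := by
        refine ((continuousOn_const.add (intervalIntegral.continuousOn_primitive_interval
          ((intervalIntegrable_iff' (by simp)).1 (hzi i)))).mono ?_)
        rw [uIcc_of_le ht.1]
        exact Ioc_subset_Icc_self
      refine (hc.aestronglyMeasurable measurableSet_Ioc).congr ?_
      filter_upwards [ae_mono hle (hV (b i))] with r hr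
      rw [hr]
    have hint : ∀ i, Integrable (fun r => inner ℝ (V r) (b i) * inner ℝ (Z r) (b i))
        (volume.restrict (Ioc 0 t)) := fun i => by
      refine (Integrable.mono_measure hm' hle).mono' (hmeas i) ?_
      filter_upwards [ae_mono hle hVZ] with r hr
      have := abs_sum_inner_mul_inner_le b.orthonormal (V r) (Z r) {i}
      rw [Finset.sum_singleton] at this
      exact this.trans hr
    simp only [intervalIntegral.integral_of_le ht.1, HasSum, SummationFilter.unconditional_filter]
    simp only [← integral_finsetSum _ fun i _ => hint i]
    refine tendsto_integral_filter_of_dominated_convergence m'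
      (Eventually.of_forall fun s => Finset.aestronglyMeasurable_fun_sum s fun i _ => hmeas i)
      (Eventually.of_forall fun s => ?_) (Integrable.mono_measure hm' hle)
      (ae_of_all _ fun r => ?_)
    · filter_upwards [ae_mono hle hVZ] with r hr
      exact (abs_sum_inner_mul_inner_le b.orthonormal (V r) (Z r) s).trans hr
    · have := b.hasSum_inner_mul_inner (V r) (Z r)
      simp only [real_inner_comm _ (Z r)]
      simpa only [HasSum, SummationFilter.unconditional_filter, real_inner_comm _ (Z r)] using this
  simp only [hsq] at h₁
  have := h₁.unique (h₂.add (h₃.mul_left 2))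
  simpa only [real_inner_self_eq_norm_sq] using this

/-! ### Mollifiers -/

/-- The bump function of radius `ε` at the origin. -/
noncomputable def bump {ε : ℝ} (hε : 0 < ε) : ContDiffBump (0 : E3) :=
  ⟨ε / 2, ε, half_pos hε, half_lt_self hε⟩

/-- The mollifier of radius `ε`. -/
noncomputable def mollifier {ε : ℝ} (hε : 0 < ε) : E3 → ℝ :=
  (bump hε).normed volume

/-- `κ` vanishes outside the ball of radius `ε` and is bounded by `A / |B_ε|`. -/
structure BallBound (κ : E3 → ℝ) (ε A : ℝ) : Prop where
  bound : ∀ y, |κ y| ≤ A / volume.real (Metric.ball (0 : E3) ε)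
  zero : ∀ y ∉ Metric.ball (0 : E3) ε, κ y = 0

section mollifier

variable {ε : ℝ} (hε : 0 < ε)

theorem isKernel_mollifier (hε' : ε < 1 / 2) : IsKernel (mollifier hε) := by
  refine ⟨(bump hε).contDiff_normed (n := ⊤), ?_⟩
  rw [mollifier, ContDiffBump.tsupport_normed_eq]
  exact Metric.closedBall_subset_ball hε'

theorem mollifier_nonneg (x : E3) : 0 ≤ mollifier hε x := (bump hε).nonneg_normed x

theorem mollifier_neg (x : E3) : mollifier hε (-x) = mollifier hε x := (bump hε).normed_neg x

theorem mollifier_comp_neg : (fun x => mollifier hε (-x)) = mollifier hε :=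
  funext (mollifier_neg hε)

theorem integral_mollifier : ∫ x, mollifier hε x = 1 := (bump hε).integral_normed

theorem volume_real_ball_pos {ε : ℝ} (hε : 0 < ε) : 0 < volume.real (Metric.ball (0 : E3) ε) :=
  ENNReal.toReal_pos (Metric.measure_ball_pos volume _ hε).ne' measure_ball_lt_top.ne

/-- The bump equals one on the ball of half the radius, so its integral is at least |B_ε| / 2³. -/
theorem ballBound_mollifier : BallBound (mollifier hε) ε 8 := by
  constructor
  · intro y
    rw [abs_of_nonneg (mollifier_nonneg hε y)]
    have h := (bump hε).normed_le_div_measure_closedBall_rOut volume 2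
      (by simp [bump]; linarith) y
    rw [measureReal_def, Measure.addHaar_closedBall_eq_addHaar_ball, ← measureReal_def] at h
    have h3 : Module.finrank ℝ E3 = 3 := by simp
    rw [h3] at h
    norm_num at h
    exact h
  · intro y hy
    have := (bump hε).support_normed_eq (μ := (volume : Measure E3))
    exact Function.notMem_support.1 (this ▸ hy)

/-- All bumps are dilates of a single one, so the derivative scales like 1/ε. The factor 16 is 8
from the normalisation times 2 from the dilation by 2/ε. -/
theorem exists_ballBound_partialDeriv_mollifier : ∃ C, 0 ≤ C ∧ ∀ (ε : ℝ) (hε : 0 < ε) (i : Fin 3),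
    BallBound (partialDeriv i (mollifier hε)) ε (C / ε) := by
  set g : ContDiffBump (0 : E3) := bump (ε := 2) two_pos
  have hgs : ContDiff ℝ ∞ g := g.contDiff (n := ⊤)
  obtain ⟨C, hC⟩ := (g.hasCompactSupport.fderiv ℝ).exists_bound_of_continuous
    (hgs.fderiv_right (m := ∞) (by norm_num)).continuous
  have hC0 : 0 ≤ C := (norm_nonneg _).trans (hC 0)
  refine ⟨16 * C, by positivity, fun ε hε i => ⟨fun y => ?_, fun y hy => ?_⟩⟩
  · have hV := volume_real_ball_pos hε
    set V := volume.real (Metric.ball (0 : E3) ε)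
    have hI : V / 8 ≤ ∫ x, bump hε x := by
      have h := (bump hε).measure_closedBall_le_integral volume
      have h₁ : volume.real (Metric.closedBall (0 : E3) (bump hε).rIn) = V / 8 := by
        have h₂ : V = volume.real (Metric.closedBall (0 : E3) ε) := by
          rw [measureReal_def, Measure.addHaar_closedBall_eq_addHaar_ball, ← measureReal_def]
        have h3 : Module.finrank ℝ E3 = 3 := by simp
        rw [h₂, Measure.addHaar_real_closedBall _ _ (bump hε).rIn_pos.le,
          Measure.addHaar_real_closedBall _ _ hε.le, h3]
        simp only [bump]
        ring
      rwa [h₁] at h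
    have hf : mollifier hε = fun x => (∫ x, bump hε x)⁻¹ * g ((ε / 2)⁻¹ • x) := by
      funext x
      rw [mollifier, ContDiffBump.normed_def, div_eq_inv_mul]
      congr 1
      rw [ContDiffBump.apply, ContDiffBump.apply]
      have h₁ : (bump hε).rOut / (bump hε).rIn = g.rOut / g.rIn := by
        simp only [bump, g]
        field_simp
      rw [h₁]
      simp [bump, g]
    have hd : fderiv ℝ (mollifier hε) y
        = (∫ x, bump hε x)⁻¹ • ((ε / 2)⁻¹ • fderiv ℝ g ((ε / 2)⁻¹ • y)) := by
      rw [hf, fderiv_const_mul]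
      · congr 1
        exact fderiv_comp_smul _
      · exact (hgs.differentiable (by norm_num)).comp (by fun_prop) y
    have hn : |partialDeriv i (mollifier hε) y| ≤ ‖fderiv ℝ (mollifier hε) y‖ := by
      have := (fderiv ℝ (mollifier hε) y).le_opNorm (EuclideanSpace.single i (1 : ℝ))
      simpa [partialDeriv] using this
    refine hn.trans ?_
    rw [hd, norm_smul, norm_smul, norm_inv, norm_inv, Real.norm_eq_abs, Real.norm_eq_abs,
      abs_of_pos (half_pos hε), abs_of_pos (lt_of_lt_of_le (by positivity) hI)]
    calc (∫ x, bump hε x)⁻¹ * ((ε / 2)⁻¹ * ‖fderiv ℝ g ((ε / 2)⁻¹ • y)‖)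
        ≤ (V / 8)⁻¹ * ((ε / 2)⁻¹ * C) := by
          gcongr
          exact hC _
      _ = 16 * C / ε / V := by
          field_simp
          ring
  · have h₀ := (ballBound_mollifier hε).zero y hy
    -- Where the nonnegative mollifier vanishes it has a minimum, so its derivative vanishes too;
    -- this includes the boundary sphere.
    have hmin : IsLocalMin (mollifier hε) y :=
      Eventually.of_forall fun x => by rw [h₀]; exact mollifier_nonneg hε x
    simp [partialDeriv, hmin.fderiv_eq_zero]

end mollifier

/-- A weighted integral over a ball is controlled by the average. -/
theorem BallBound.lintegral_le {κ : E3 → ℝ} {ε A : ℝ} (h : BallBound κ ε A) (hε : 0 < ε)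
    (G : E3 → ℝ≥0∞) :
    ∫⁻ y, ‖κ y‖ₑ * G y ≤ ENNReal.ofReal A * ⨍⁻ y in Metric.ball (0 : E3) ε, G y ∂volume := by
  have hV := volume_real_ball_pos hε
  rw [setLAverage_eq, ← mul_div_assoc, ENNReal.mul_div_right_comm,
    ← lintegral_const_mul' _ _
      (ENNReal.div_ne_top ENNReal.ofReal_ne_top (Metric.measure_ball_pos volume _ hε).ne'),
    ← lintegral_indicator Metric.isOpen_ball.measurableSet]
  refine lintegral_mono fun y => ?_
  by_cases hy : y ∈ Metric.ball (0 : E3) ε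
  · rw [indicator_of_mem hy]
    gcongr
    rw [Real.enorm_eq_ofReal_abs]
    refine (ENNReal.ofReal_le_ofReal (h.bound y)).trans ?_
    rw [ENNReal.ofReal_div_of_pos hV, ofReal_measureReal measure_ball_lt_top.ne]
  · simp [h.zero y hy]

/-- Jensen's inequality. -/
theorem lintegral_rpow_le {X : Type*} [MeasurableSpace X] (μ : Measure X) [IsProbabilityMeasure μ]
    {G : X → ℝ≥0∞} (hG : AEMeasurable G μ) {p : ℝ} (hp : 1 ≤ p) :
    (∫⁻ y, G y ∂μ) ^ p ≤ ∫⁻ y, G y ^ p ∂μ := by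
  have h := eLpNorm'_le_eLpNorm'_of_exponent_le zero_lt_one hp μ hG.aestronglyMeasurable
  simp only [eLpNorm', enorm_eq_self, ENNReal.rpow_one, div_one] at h
  have hp0 : 0 < p := zero_lt_one.trans_le hp
  calc _ ≤ ((∫⁻ y, G y ^ p ∂μ) ^ (1 / p)) ^ p := by gcongr
    _ = _ := by rw [← ENNReal.rpow_mul, one_div_mul_cancel hp0.ne', ENNReal.rpow_one]

theorem lintegral_mollifier {ε : ℝ} (hε : 0 < ε) (hε' : ε < 1 / 2) :
    ∫⁻ y, ‖mollifier hε y‖ₑ = 1 := by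
  have h := ofReal_integral_norm_eq_lintegral_enorm (isKernel_mollifier hε hε').integrable
  simp only [Real.norm_of_nonneg (mollifier_nonneg hε _), integral_mollifier] at h
  rw [← h, ENNReal.ofReal_one]

/-- Mollification does not increase the `L²` norm. -/
theorem lintegral_conv_sq_le {f : E3 → E3} (hf : TorusMem 1 f) {ε : ℝ} (hε : 0 < ε)
    (hε' : ε < 1 / 2) :
    ∫⁻ x, ‖conv (mollifier hε) f x‖ₑ ^ 2 ∂torusMeasure ≤ ∫⁻ x, ‖f x‖ₑ ^ 2 ∂torusMeasure := by
  have hk := isKernel_mollifier hε hε'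
  have hkm : Measurable fun y => ‖mollifier hε y‖ₑ := hk.smooth.continuous.measurable.enorm
  -- The mollifier is the density of a probability measure, so Jensen applies to the average it
  -- defines.
  set ν : Measure E3 := volume.withDensity fun y => ‖mollifier hε y‖ₑ with hν
  have hprob : IsProbabilityMeasure ν := ⟨by
    rw [hν, withDensity_apply _ MeasurableSet.univ, setLIntegral_univ,
      lintegral_mollifier hε hε']⟩
  have hfm := hf.measurable
  have h₁ : ∀ x, ‖conv (mollifier hε) f x‖ₑ ^ 2 ≤ ∫⁻ y, ‖f (x - y)‖ₑ ^ 2 ∂ν := fun x => by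
    have hm : Measurable fun y => ‖f (x - y)‖ₑ := by fun_prop
    calc ‖conv (mollifier hε) f x‖ₑ ^ 2 ≤ (∫⁻ y, ‖f (x - y)‖ₑ ∂ν) ^ 2 := by
          gcongr
          refine (enorm_integral_le_lintegral_enorm _).trans_eq ?_
          rw [hν, lintegral_withDensity_eq_lintegral_mul _ hkm hm]
          simp only [enorm_smul, Pi.mul_apply]
      _ ≤ _ := by
          have := lintegral_rpow_le ν hm.aemeasurable (p := 2) (by norm_num)
          simpa only [ENNReal.rpow_two] using this
  calc ∫⁻ x, ‖conv (mollifier hε) f x‖ₑ ^ 2 ∂torusMeasure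
      ≤ ∫⁻ x, (∫⁻ y, ‖f (x - y)‖ₑ ^ 2 ∂ν) ∂torusMeasure := lintegral_mono h₁
    _ = ∫⁻ y, (∫⁻ x, ‖f (x - y)‖ₑ ^ 2 ∂torusMeasure) ∂ν :=
        lintegral_lintegral_swap (by fun_prop)
    _ = ∫⁻ y, (∫⁻ x, ‖f x‖ₑ ^ 2 ∂torusMeasure) ∂ν := by
        congr 1
        funext y
        simpa only [sub_eq_add_neg] using
          lintegral_shift (hf.periodic.comp_left fun v => ‖v‖ₑ ^ 2) (-y)
    _ = _ := by rw [lintegral_const, measure_univ, mul_one]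

/-- The `L²` norms of the mollifications converge. -/
theorem tendsto_lintegral_conv_sq {f : E3 → E3} (hf : TorusMem 1 f) {ε : ℕ → ℝ}
    (hε : ∀ n, 0 < ε n) (hε' : ∀ n, ε n < 1 / 2) (hlim : Tendsto ε atTop (𝓝 0)) :
    Tendsto (fun n => ∫⁻ x, ‖conv (mollifier (hε n)) f x‖ₑ ^ 2 ∂torusMeasure) atTop
      (𝓝 (∫⁻ x, ‖f x‖ₑ ^ 2 ∂torusMeasure)) := by
  -- Almost everywhere convergence and Fatou bound the lower limit; contractivity of mollification
  -- bounds the upper one.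
  refine tendsto_of_le_liminf_of_limsup_le ?_ ?_
  · have h := ContDiffBump.ae_convolution_tendsto_right_of_locallyIntegrable
      (φ := fun n => bump (hε n)) (K := 2) hlim
      (Eventually.of_forall fun n => by simp [bump]; linarith) hf.locallyIntegrable
    refine le_trans (le_of_eq ?_) (lintegral_liminf_le fun n => ?_)
    · refine lintegral_congr_ae ?_
      filter_upwards [ae_torus_of_ae_volume h] with x hx
      have : Tendsto (fun n => ‖conv (mollifier (hε n)) f x‖ₑ ^ 2) atTop (𝓝 (‖f x‖ₑ ^ 2)) :=
        ((ENNReal.continuous_pow 2).tendsto _).comp ((continuous_enorm.tendsto _).comp hx)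
      exact this.liminf_eq.symm
    · exact (contDiff_conv (isKernel_mollifier (hε n) (hε' n)) hf).continuous.measurable.enorm.pow_const 2
  · exact limsup_le_of_le (h := Eventually.of_forall fun n => lintegral_conv_sq_le hf (hε n) (hε' n))

/-- The derivative of a convolution with a smooth function falls on either factor. -/
theorem conv_partialDeriv {κ φ : E3 → ℝ} (hκ : IsKernel κ) (hφ : ContDiff ℝ ∞ φ) (i : Fin 3)
    (x : E3) : conv κ (partialDeriv i φ) x = conv (partialDeriv i κ) φ x := by
  have hg : ContDiff ℝ ∞ fun y => φ (x - y) := hφ.comp (contDiff_const.sub contDiff_id)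
  have hd : ∀ y, fderiv ℝ (fun y => φ (x - y)) y (EuclideanSpace.single i (1 : ℝ))
      = - partialDeriv i φ (x - y) := fun y => by
    have h₂ := ((hφ.differentiable (by norm_num)) (x - y)).hasFDerivAt.comp y
      ((hasFDerivAt_id y).const_sub x)
    have h₃ : fderiv ℝ (fun y => φ (x - y)) y = _ := h₂.fderiv
    rw [h₃]
    simp [partialDeriv]
  have hs := hκ.hasCompactSupport
  have h := integral_mul_fderiv_eq_neg_fderiv_mul_of_integrable (μ := (volume : Measure E3))
    (f := κ) (g := fun y => φ (x - y)) (v := EuclideanSpace.single i (1 : ℝ))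
    (((contDiff_partialDeriv hκ.smooth i).continuous.mul
      hg.continuous).integrable_of_hasCompactSupport (hκ.partialDeriv i).hasCompactSupport.mul_right)
    ((hκ.smooth.continuous.mul (contDiff_partialDeriv hg i).continuous).integrable_of_hasCompactSupport
      hs.mul_right)
    ((hκ.smooth.continuous.mul hg.continuous).integrable_of_hasCompactSupport hs.mul_right)
    (fun y _ => (hκ.smooth.differentiable (by norm_num)) y)
    (fun y _ => (hg.differentiable (by norm_num)) y)
  simp only [hd, mul_neg, integral_neg, neg_inj] at h
  exact h

/-- Mollification preserves the divergence condition. -/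
theorem isWeaklyDivFree_conv {v : E3 → E3} (hv : TorusMem 1 v) (hd : IsWeaklyDivFree v)
    {κ : E3 → ℝ} (hκ : IsKernel κ) : IsWeaklyDivFree (conv κ v) := by
  intro φ hφ hφp
  have hκ' := hκ.comp_neg
  have hφm : TorusMem 1 φ := .of_continuous hφp hφ.continuous
  have hc : ∀ i, TorusMem 1 (fun x => v x i) := fun i => hv.coord i
  have hpd : ∀ i, TorusMem 1 (partialDeriv i φ) := fun i =>
    .of_continuous (hφp.partialDeriv i) (contDiff_partialDeriv hφ i).continuous
  -- The convolution is moved onto the test function, where it commutes with the gradient.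
  have h := hd (conv (fun y => κ (-y)) φ) (contDiff_conv hκ' hφm) (hφp.conv _)
  simp only [fderiv_apply_eq_sum, smul_eq_mul, conv_coord hκ hv,
    partialDeriv_conv hκ' hφm] at h ⊢
  rw [integral_finsetSum] at h ⊢
  · rw [← h]
    refine Finset.sum_congr rfl fun i _ => ?_
    rw [integral_conv_mul hκ (hc i) (hpd i)]
    simp only [conv_partialDeriv hκ' hφ]
  · intro i _
    have hb := torusMem_conv hκ (hc i) 2
    exact hb.memLp.integrable_mul (memLp_of_periodic_continuous (hφp.partialDeriv i)
      (contDiff_partialDeriv hφ i).continuous 2)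
  · intro i _
    have hb := torusMem_conv (hκ'.partialDeriv i) hφm 1
    obtain ⟨C, hC⟩ := exists_bound_of_periodic hb.periodic
      (contDiff_conv (hκ'.partialDeriv i) hφm).continuous
    exact (hc i).integrable.mul_bdd hb.measurable.aestronglyMeasurable (ae_of_all _ hC)

/-! ### The energy identity for the mollified field -/

instance : IsProbabilityMeasure torusMeasure := by
  refine ⟨?_⟩
  have h : (stdBasis : Fin 3 → E3) = EuclideanSpace.basisFun (Fin 3) ℝ := by
    funext i
    simp [stdBasis]
  rw [torusMeasure, Measure.restrict_apply_univ, cell_eq_fundamentalDomain,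
    measure_congr (ZSpan.fundamentalDomain_ae_parallelepiped stdBasis volume), h]
  exact OrthonormalBasis.volume_parallelepiped _

/-- The vector field `-div (κ ⋆ (v ⊗ v))`. -/
noncomputable def stressField (κ : E3 → ℝ) (v : E3 → E3) (x : E3) : E3 :=
  - ∑ j, conv (partialDeriv j κ) (fun y => v y j • v y) x

theorem TorusMem.coord_smul {v : E3 → E3} (hv : TorusMem 2 v) (j : Fin 3) :
    TorusMem 1 fun y => v y j • v y :=
  ⟨(hv.coord j).measurable.smul hv.measurable,
    hv.periodic.comp_left fun y => y j • y, hv.memLp.smul (hv.coord j).memLp⟩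

theorem TorusMem.coord_mul {v : E3 → E3} (hv : TorusMem 2 v) (j k : Fin 3) :
    TorusMem 1 fun y => v y j * v y k := (hv.coord_smul j).coord k

theorem inner_eq_sum (x y : E3) : inner ℝ x y = ∑ i, x i * y i := by
  simp [PiLp.inner_apply, mul_comm]

theorem integrable_mul_of_continuous {f g : E3 → ℝ} (hf : TorusMem 1 f) (hg : IsPeriodic g)
    (hgc : Continuous g) : Integrable (fun x => f x * g x) torusMeasure := by
  obtain ⟨C, hC⟩ := exists_bound_of_periodic hg hgc
  exact hf.integrable.mul_bdd hgc.aestronglyMeasurable (ae_of_all _ hC)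

section

variable {κ : E3 → ℝ}

theorem torusMem_stressField (hκ : IsKernel κ) {v : E3 → E3} (hv : TorusMem 2 v) (p : ℝ≥0∞) :
    TorusMem p (stressField κ v) := by
  refine .of_continuous (fun i x => ?_) ?_
  · simp only [stressField, (hv.coord_smul _).periodic.conv _ i x]
  · exact (continuous_finsetSum _ fun j _ =>
      (contDiff_conv (hκ.partialDeriv j) (hv.coord_smul j)).continuous).neg

theorem stressField_coord (hκ : IsKernel κ) {v : E3 → E3} (hv : TorusMem 2 v) (x : E3)
    (k : Fin 3) :
    stressField κ v x k = - ∑ j, conv (partialDeriv j κ) (fun y => v y j * v y k) x := by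
  simp [stressField, conv_coord (hκ.partialDeriv _) (hv.coord_smul _)]

/-- The derivative falls on the kernel, so the field is bounded pointwise by the L¹ norm of v ⊗ v,
with a constant depending on `κ` alone. -/
theorem norm_stressField_le (hκ : IsKernel κ) :
    ∃ C, 0 ≤ C ∧ ∀ v : E3 → E3, TorusMem 2 v → ∀ x,
      ‖stressField κ v x‖ ≤ C * ∫ y, ‖v y‖ ^ 2 ∂torusMeasure := by
  choose C hC0 hC using fun j => (hκ.partialDeriv j).exists_bound
  refine ⟨∑ j, C j, Finset.sum_nonneg fun j _ => hC0 j, fun v hv x => ?_⟩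
  rw [stressField, norm_neg, Finset.sum_mul]
  refine (norm_sum_le _ _).trans (Finset.sum_le_sum fun j _ => ?_)
  refine (norm_conv_le (hv.coord_smul j) (hC j) (hκ.partialDeriv j) x).trans ?_
  refine mul_le_mul_of_nonneg_left ?_ (hC0 j)
  refine integral_mono (hv.coord_smul j).integrable.norm hv.memLp.integrable_norm_pow' fun y => ?_
  simp only [norm_smul, sq]
  gcongr
  exact PiLp.norm_apply_le _ _

theorem integral_inner_conv {v b : E3 → E3} (hκ : IsKernel κ) (hev : (fun y => κ (-y)) = κ)
    (hv : TorusMem 1 v) (hb : TorusMem 1 b) :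
    ∫ x, inner ℝ (conv κ v x) (b x) ∂torusMeasure
      = ∫ x, inner ℝ (v x) (conv κ b x) ∂torusMeasure := by
  simp only [inner_eq_sum, conv_coord hκ hv, conv_coord hκ hb]
  rw [integral_finsetSum, integral_finsetSum]
  · refine Finset.sum_congr rfl fun i _ => ?_
    rw [integral_conv_mul hκ (hv.coord i) (hb.coord i), hev]
  · exact fun i _ => integrable_mul_of_continuous (hv.coord i) ((hb.coord i).periodic.conv κ)
      (contDiff_conv hκ (hb.coord i)).continuous
  · intro i _
    simp only [mul_comm (conv κ _ _)]
    exact integrable_mul_of_continuous (hb.coord i) ((hv.coord i).periodic.conv κ)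
      (contDiff_conv hκ (hv.coord i)).continuous

theorem inner_fderiv_eq_sum {w : E3 → E3} (hw : ContDiff ℝ ∞ w) (v x : E3) :
    inner ℝ v (fderiv ℝ w x v) = ∑ k, ∑ j, (v j * v k) * partialDeriv j (fun x => w x k) x := by
  rw [inner_eq_sum, fderiv_apply_eq_sum]
  refine Finset.sum_congr rfl fun k _ => ?_
  simp only [partialDeriv_coord hw, WithLp.ofLp_sum, WithLp.ofLp_smul, Finset.sum_apply,
    Pi.smul_apply, smul_eq_mul, Finset.mul_sum]
  exact Finset.sum_congr rfl fun j _ => by ring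

/-- Testing the stress with `κ ⋆ b`. -/
theorem integral_inner_stressField {v b : E3 → E3} (hκ : IsKernel κ)
    (hev : (fun y => κ (-y)) = κ) (hv : TorusMem 2 v) (hb : TorusMem 1 b) :
    ∫ x, inner ℝ (stressField κ v x) (b x) ∂torusMeasure
      = ∫ x, inner ℝ (v x) (fderiv ℝ (conv κ b) x (v x)) ∂torusMeasure := by
  -- Derivatives of an even kernel are odd; this sign cancels the one in `stressField`.
  have hodd : ∀ j, (fun y => partialDeriv j κ (-y)) = fun y => - partialDeriv j κ y := by
    intro j
    funext y
    have h₂ := ((hκ.smooth.differentiable (by norm_num)) (-y)).hasFDerivAt.comp y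
      (hasFDerivAt_id y).neg
    have h₃ : fderiv ℝ (fun y => κ (-y)) y = _ := h₂.fderiv
    rw [hev] at h₃
    simp [partialDeriv, h₃]
  have hj : ∀ j k, ∫ x, conv (partialDeriv j κ) (fun y => v y j * v y k) x * b x k ∂torusMeasure
      = - ∫ x, (v x j * v x k) * partialDeriv j (fun x => conv κ b x k) x ∂torusMeasure := by
    intro j k
    rw [integral_conv_mul (hκ.partialDeriv j) (hv.coord_mul j k) (hb.coord k), hodd,
      ← integral_neg]
    congr 1
    funext x
    have h₁ : conv (fun y => -partialDeriv j κ y) (fun x => b x k) x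
        = -conv (partialDeriv j κ) (fun x => b x k) x := by
      simp only [conv, neg_smul, integral_neg]
    have h₂ : (fun x => conv κ b x k) = conv κ fun x => b x k := funext fun x => conv_coord hκ hb k x
    rw [h₁, h₂, partialDeriv_conv hκ (hb.coord k), mul_neg]
  simp only [inner_fderiv_eq_sum (contDiff_conv hκ hb), inner_eq_sum, stressField_coord hκ hv,
    neg_mul, Finset.sum_mul]
  have hi : ∀ k j, Integrable (fun x => (v x j * v x k) *
      partialDeriv j (fun x => conv κ b x k) x) torusMeasure := fun k j =>
    integrable_mul_of_continuous (hv.coord_mul j k)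
      (((hb.periodic.conv κ).comp_left fun y => y k).partialDeriv j)
      (contDiff_partialDeriv (contDiff_coord (contDiff_conv hκ hb) k) j).continuous
  have hi' : ∀ k j, Integrable (fun x =>
      conv (partialDeriv j κ) (fun y => v y j * v y k) x * b x k) torusMeasure := fun k j => by
    simp only [mul_comm (conv _ _ _)]
    exact integrable_mul_of_continuous (hb.coord k) ((hv.coord_mul j k).periodic.conv _)
      (contDiff_conv (hκ.partialDeriv j) (hv.coord_mul j k)).continuous
  rw [integral_finsetSum _ fun k _ => integrable_finsetSum _ fun j _ => hi k j,
    integral_finsetSum Finset.univ fun k _ => (integrable_finsetSum Finset.univ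
      fun j _ => hi' k j).fun_neg]
  refine Finset.sum_congr rfl fun k _ => ?_
  rw [integral_neg, integral_finsetSum _ fun j _ => hi k j,
    integral_finsetSum _ fun j _ => hi' k j, ← Finset.sum_neg_distrib]
  exact Finset.sum_congr rfl fun j _ => by rw [hj, neg_neg]

end

/-! ### Weakly divergence free fields as a closed subspace of `L²` -/

/-- The gradient of a scalar function as a vector field. -/
noncomputable def gradField (φ : E3 → ℝ) (x : E3) : E3 :=
  (InnerProductSpace.toDual ℝ E3).symm (fderiv ℝ φ x)

theorem memLp_gradField {φ : E3 → ℝ} (hφ : ContDiff ℝ ∞ φ) (hp : IsPeriodic φ) :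
    MemLp (gradField φ) 2 torusMeasure :=
  memLp_of_periodic_continuous (hp.fderiv.comp_left _)
    ((InnerProductSpace.toDual ℝ E3).symm.continuous.comp
      (hφ.fderiv_right (m := ∞) (by norm_num)).continuous) 2

/-- The weakly divergence free fields in `L²`: the orthogonal complement of the gradients. -/
noncomputable def solenoidal : Submodule ℝ (Lp E3 2 torusMeasure) :=
  (Submodule.span ℝ {g | ∃ φ, ∃ hφ : ContDiff ℝ ∞ φ, ∃ hp : IsPeriodic φ,
    g = (memLp_gradField hφ hp).toLp (gradField φ)})ᗮ

theorem inner_toLp {f g : E3 → E3} (hf : MemLp f 2 torusMeasure) (hg : MemLp g 2 torusMeasure) :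
    inner ℝ (hf.toLp f) (hg.toLp g) = ∫ x, inner ℝ (f x) (g x) ∂torusMeasure := by
  rw [L2.inner_def]
  refine integral_congr_ae ?_
  filter_upwards [hf.coeFn_toLp, hg.coeFn_toLp] with x h₁ h₂
  rw [h₁, h₂]

theorem toLp_mem_solenoidal {v : E3 → E3} (hv : MemLp v 2 torusMeasure) :
    hv.toLp v ∈ solenoidal ↔ IsWeaklyDivFree v := by
  have h : ∀ φ, ∀ hφ : ContDiff ℝ ∞ φ, ∀ hp : IsPeriodic φ,
      inner ℝ ((memLp_gradField hφ hp).toLp (gradField φ)) (hv.toLp v)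
        = ∫ x, fderiv ℝ φ x (v x) ∂torusMeasure := fun φ hφ hp => by
    rw [inner_toLp]
    simp only [gradField, InnerProductSpace.toDual_symm_apply]
  rw [solenoidal, Submodule.mem_orthogonal]
  constructor
  · intro H φ hφ hp
    rw [← h φ hφ hp]
    exact H _ (Submodule.subset_span ⟨φ, hφ, hp, rfl⟩)
  · intro H g hg
    induction hg using Submodule.span_induction with
    | mem g hg =>
      obtain ⟨φ, hφ, hp, rfl⟩ := hg
      rw [h φ hφ hp]
      exact H φ hφ hp
    | zero => simp
    | add g₁ g₂ _ _ h₁ h₂ => rw [inner_add_left, h₁, h₂, add_zero]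
    | smul c g _ h₁ => rw [inner_smul_left, h₁, mul_zero]

/-- Every function on the torus agrees almost everywhere with a measurable periodic one. -/
theorem exists_torusMem_ae_eq {F : Type*} [NormedAddCommGroup F] [MeasurableSpace F]
    [BorelSpace F] {f : E3 → F} {p : ℝ≥0∞} (hf : MemLp f p torusMeasure) :
    ∃ g : E3 → F, TorusMem p g ∧ g =ᵐ[torusMeasure] f := by
  set g := hf.1.mk f
  have hg : (fun x => g (ZSpan.fract stdBasis x)) =ᵐ[torusMeasure] f := by
    filter_upwards [hf.1.ae_eq_mk, ae_restrict_mem measurableSet_cell] with x hx hx'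
    rw [fract_of_mem_cell hx', hx]
  exact ⟨_, ⟨hf.1.stronglyMeasurable_mk.measurable.comp measurable_fract,
    isPeriodic_comp_fract g, (memLp_congr_ae hg).2 hf⟩, hg⟩

/-- Every element of the solenoidal subspace has a measurable periodic representative. -/
theorem exists_rep_solenoidal (b : solenoidal) :
    ∃ g : E3 → E3, ∃ hg : TorusMem 2 g, IsWeaklyDivFree g ∧ hg.memLp.toLp g = b := by
  obtain ⟨g, hg, hgb⟩ := exists_torusMem_ae_eq (Lp.memLp (b : Lp E3 2 torusMeasure))
  have h : hg.memLp.toLp g = (b : Lp E3 2 torusMeasure) := by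
    refine Lp.ext ?_
    exact hg.memLp.coeFn_toLp.trans hgb
  exact ⟨g, hg, (toLp_mem_solenoidal hg.memLp).1 (h ▸ b.2), h⟩

/-- A time dependent field in `L³` in space and time, measurable, periodic and weakly divergence
free at every time. -/
structure RegularField (T : ℝ) (u : ℝ → E3 → E3) : Prop where
  measurable : Measurable (Function.uncurry u)
  torusMem : ∀ t, TorusMem 3 (u t)
  div_free : ∀ t, IsWeaklyDivFree (u t)
  bound : ∫⁻ t in Ioo 0 T, (∫⁻ x, ‖u t x‖ₑ ^ (3 : ℝ) ∂torusMeasure) < ⊤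

/-- The momentum equation, integrated up to time `t` and tested with `w`, for the velocity `v` at
time `t`. -/
def MomentumAt (u : ℝ → E3 → E3) (u₀ w v : E3 → E3) (t : ℝ) : Prop :=
  ∫ x, inner ℝ (v x) (w x) ∂torusMeasure = ∫ x, inner ℝ (u₀ x) (w x) ∂torusMeasure
    + ∫ r in (0 : ℝ)..t, (∫ x, inner ℝ (u r x) (fderiv ℝ w x (u r x)) ∂torusMeasure)

/-- Smooth divergence free fields on the torus. -/
structure IsSpaceTest (w : E3 → E3) : Prop where
  smooth : ContDiff ℝ ∞ w
  periodic : IsPeriodic w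
  div_free : ∀ x, divergence w x = 0

theorem isSpaceTest_conv {κ : E3 → ℝ} (hκ : IsKernel κ) {b : E3 → E3} (hb : TorusMem 1 b)
    (hd : IsWeaklyDivFree b) : IsSpaceTest (conv κ b) :=
  ⟨contDiff_conv hκ hb, hb.periodic.conv κ, divergence_eq_zero (contDiff_conv hκ hb)
    (hb.periodic.conv κ) (isWeaklyDivFree_conv hb hd hκ)⟩

/-- On a probability space ‖v‖₁ and ‖v‖₂ are at most ‖v‖₃. This makes the product of the velocity
and stress norms integrable in time from the space-time L³ bound alone, without a bound on the
energy uniform in time. -/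
theorem lintegral_mul_le_cube {v : E3 → E3} (hv : Measurable v) :
    (∫⁻ x, ‖v x‖ₑ ∂torusMeasure) * (∫⁻ x, ‖v x‖ₑ ^ (2 : ℝ) ∂torusMeasure)
      ≤ ∫⁻ x, ‖v x‖ₑ ^ (3 : ℝ) ∂torusMeasure := by
  set N := ∫⁻ x, ‖v x‖ₑ ^ (3 : ℝ) ∂torusMeasure
  have h₁ : (∫⁻ x, ‖v x‖ₑ ∂torusMeasure) ≤ N ^ (1 / 3 : ℝ) := by
    have := lintegral_rpow_le torusMeasure hv.enorm.aemeasurable (p := 3) (by norm_num)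
    rw [one_div, ENNReal.le_rpow_inv_iff (by norm_num)]
    exact this
  have h₂ : (∫⁻ x, ‖v x‖ₑ ^ (2 : ℝ) ∂torusMeasure) ≤ N ^ (2 / 3 : ℝ) := by
    have := lintegral_rpow_le torusMeasure (hv.enorm.pow_const (2 : ℝ)).aemeasurable
      (p := 3 / 2) (by norm_num)
    have h2 : (2 : ℝ) * (3 / 2) = 3 := by norm_num
    simp only [← ENNReal.rpow_mul, h2] at this
    have h3 : (2 / 3 : ℝ) = (3 / 2)⁻¹ := by norm_num
    rw [h3, ENNReal.le_rpow_inv_iff (by norm_num)]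
    exact this
  calc _ ≤ N ^ (1 / 3 : ℝ) * N ^ (2 / 3 : ℝ) := mul_le_mul' h₁ h₂
    _ = N := by
      rw [← ENNReal.rpow_add_of_nonneg _ _ (by norm_num) (by norm_num)]
      norm_num

/-! ### Measurability and time integrability of the slices of a regular field -/

namespace RegularField

variable {T : ℝ} {u : ℝ → E3 → E3}

theorem measurable_slice_lintegral (hu : RegularField T u) (p : ℝ) :
    Measurable fun t => ∫⁻ x, ‖u t x‖ₑ ^ p ∂torusMeasure :=
  Measurable.lintegral_prod_right' (f := fun q : ℝ × E3 => ‖u q.1 q.2‖ₑ ^ p)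
    (hu.measurable.enorm.pow_const p)

theorem integrable_sq (hu : RegularField T u) :
    Integrable (fun t => (∫⁻ x, ‖u t x‖ₑ ^ (2 : ℝ) ∂torusMeasure).toReal)
      (volume.restrict (Ioo 0 T)) := by
  refine integrable_toReal_of_lintegral_ne_top
    (hu.measurable_slice_lintegral 2).aemeasurable (ne_of_lt ?_)
  calc ∫⁻ t in Ioo 0 T, (∫⁻ x, ‖u t x‖ₑ ^ (2 : ℝ) ∂torusMeasure)
      ≤ ∫⁻ t in Ioo 0 T, (1 + ∫⁻ x, ‖u t x‖ₑ ^ (3 : ℝ) ∂torusMeasure) := by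
        refine lintegral_mono fun t => ?_
        calc ∫⁻ x, ‖u t x‖ₑ ^ (2 : ℝ) ∂torusMeasure
            ≤ ∫⁻ x, (1 + ‖u t x‖ₑ ^ (3 : ℝ)) ∂torusMeasure := by
              -- Pointwise a² ≤ 1 + a³.
              refine lintegral_mono fun x => ?_
              rcases le_total ‖u t x‖ₑ 1 with h | h
              · exact (ENNReal.rpow_le_one h (by norm_num)).trans le_self_add
              · exact (ENNReal.rpow_le_rpow_of_exponent_le h (by norm_num)).trans le_add_self
          _ = 1 + ∫⁻ x, ‖u t x‖ₑ ^ (3 : ℝ) ∂torusMeasure := by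
              rw [lintegral_add_left measurable_const, lintegral_one, measure_univ]
    _ = volume (Ioo 0 T) + ∫⁻ t in Ioo 0 T, (∫⁻ x, ‖u t x‖ₑ ^ (3 : ℝ) ∂torusMeasure) := by
        rw [lintegral_add_left measurable_const, setLIntegral_one]
    _ < ⊤ := ENNReal.add_lt_top.2 ⟨measure_Ioo_lt_top, hu.bound⟩

theorem integral_norm_sq_eq (hu : RegularField T u) (t : ℝ) :
    ∫ x, ‖u t x‖ ^ 2 ∂torusMeasure
      = (∫⁻ x, ‖u t x‖ₑ ^ (2 : ℝ) ∂torusMeasure).toReal := by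
  rw [integral_eq_lintegral_of_nonneg_ae (ae_of_all _ fun x => sq_nonneg _)
    ((hu.torusMem t).measurable.norm.pow_const 2).aestronglyMeasurable]
  congr 2
  funext x
  rw [ENNReal.rpow_two, ← ofReal_norm, ENNReal.ofReal_pow (norm_nonneg _)]

theorem integrable_cube (hu : RegularField T u) :
    Integrable (fun t => (∫⁻ x, ‖u t x‖ₑ ^ (3 : ℝ) ∂torusMeasure).toReal)
      (volume.restrict (Ioo 0 T)) :=
  integrable_toReal_of_lintegral_ne_top (hu.measurable_slice_lintegral 3).aemeasurable hu.bound.ne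

theorem lintegral_cube_lt_top (hu : RegularField T u) (t : ℝ) :
    ∫⁻ x, ‖u t x‖ₑ ^ (3 : ℝ) ∂torusMeasure < ⊤ := by
  have := lintegral_rpow_enorm_lt_top_of_eLpNorm_lt_top three_ne_zero ENNReal.ofNat_ne_top
    (hu.torusMem t).memLp.2
  simpa using this

/-- The time dependent weight of a smooth test field is measurable. -/
theorem stronglyMeasurable_momentum (hu : RegularField T u) {w : E3 → E3}
    (hw : ContDiff ℝ ∞ w) :
    StronglyMeasurable fun r => ∫ x, inner ℝ (u r x) (fderiv ℝ w x (u r x)) ∂torusMeasure := by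
  refine StronglyMeasurable.integral_prod_right (f := fun r x =>
    inner ℝ (u r x) (fderiv ℝ w x (u r x))) (Measurable.stronglyMeasurable ?_)
  have hc : Continuous fun q : E3 × E3 => inner ℝ q.2 (fderiv ℝ w q.1 q.2) :=
    continuous_snd.inner (((hw.fderiv_right (m := ∞) (by norm_num)).continuous.comp
      continuous_fst).clm_apply continuous_snd)
  exact hc.measurable.comp (measurable_snd.prodMk hu.measurable)

end RegularField

theorem norm_toLp_le_of_bound {f : E3 → E3} (hf : MemLp f 2 torusMeasure) {C : ℝ}
    (hC0 : 0 ≤ C) (hC : ∀ x, ‖f x‖ ≤ C) : ‖hf.toLp f‖ ≤ C := by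
  have h := Lp.norm_le_of_ae_bound (f := hf.toLp f) hC0 (by
    filter_upwards [hf.coeFn_toLp] with x hx
    rw [hx]
    exact hC x)
  simpa [measureUnivNNReal] using h

/-- The energy identity for the mollified field. It holds at every time at which the momentum
equation holds for countably many test fields. -/
theorem exists_countable_mollified_energy {T : ℝ} {u : ℝ → E3 → E3} {u₀ : E3 → E3}
    (hu : RegularField T u) (hu₀ : TorusMem 2 u₀) (hd₀ : IsWeaklyDivFree u₀)
    (hmom : ∀ w, IsSpaceTest w → ∀ᵐ t ∂volume.restrict (Ioo 0 T), MomentumAt u u₀ w (u t) t)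
    {κ : E3 → ℝ} (hκ : IsKernel κ) (hev : (fun y => κ (-y)) = κ) :
    ∃ W : Set (E3 → E3), W.Countable ∧ (∀ w ∈ W, IsSpaceTest w) ∧
      ∀ t ∈ Icc 0 T, ∀ v, TorusMem 2 v → IsWeaklyDivFree v → (∀ w ∈ W, MomentumAt u u₀ w v t) →
        ∫ x, ‖conv κ v x‖ ^ 2 ∂torusMeasure = ∫ x, ‖conv κ u₀ x‖ ^ 2 ∂torusMeasure
          + 2 * ∫ r in (0 : ℝ)..t,
            (∫ x, inner ℝ (conv κ (u r) x) (stressField κ (u r) x) ∂torusMeasure) := by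
  have : Fact ((2 : ℝ≥0∞) ≠ ⊤) := ⟨ENNReal.ofNat_ne_top⟩
  have h12 : (1 : ℝ≥0∞) ≤ 2 := by norm_num
  have hu2 : ∀ t, TorusMem 2 (u t) := fun t => (hu.torusMem t).mono (by norm_num)
  have hu1 : ∀ t, TorusMem 1 (u t) := fun t => (hu2 t).mono h12
  have hcm : ∀ {v : E3 → E3}, TorusMem 2 v → MemLp (conv κ v) 2 torusMeasure := fun hv =>
    (torusMem_conv hκ (hv.mono h12) 2).memLp
  have hsol : ∀ {v : E3 → E3} (hv : TorusMem 2 v), IsWeaklyDivFree v →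
      (hcm hv).toLp (conv κ v) ∈ solenoidal := fun hv hd =>
    (toLp_mem_solenoidal _).2 (isWeaklyDivFree_conv (hv.mono h12) hd hκ)
  have : CompleteSpace solenoidal := by
    unfold solenoidal
    infer_instance
  set V : ℝ → solenoidal := fun r => ⟨_, hsol (hu2 r) (hu.div_free r)⟩ with hVdef
  set V₀ : solenoidal := ⟨_, hsol hu₀ hd₀⟩
  have hst : ∀ r, MemLp (stressField κ (u r)) 2 torusMeasure := fun r =>
    (torusMem_stressField hκ (hu2 r) 2).memLp
  -- The projection removes the gradient part of the stress, that is, the pressure; pairings with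
  -- solenoidal fields are unaffected.
  set Z : ℝ → solenoidal := fun r =>
    solenoidal.orthogonalProjectionOnto ((hst r).toLp (stressField κ (u r))) with hZdef
  choose g hg hgd hgb using exists_rep_solenoidal
  have hZb : ∀ r b, inner ℝ (Z r) b
      = ∫ x, inner ℝ (u r x) (fderiv ℝ (conv κ (g b)) x (u r x)) ∂torusMeasure := fun r b => by
    rw [hZdef, Submodule.inner_orthogonalProjectionOnto_eq_of_mem_right, ← hgb b, inner_toLp,
      integral_inner_stressField hκ hev (hu2 r) ((hg b).mono h12)]
  have hVb : ∀ {v : E3 → E3} (hv : TorusMem 2 v) (hd : IsWeaklyDivFree v) (b : solenoidal),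
      inner ℝ (⟨_, hsol hv hd⟩ : solenoidal) b
        = ∫ x, inner ℝ (v x) (conv κ (g b) x) ∂torusMeasure := fun hv hd b => by
    rw [Submodule.coe_inner, ← hgb b, inner_toLp,
      integral_inner_conv hκ hev (hv.mono h12) ((hg b).mono h12)]
  -- A basis element is merely in L². Since both the velocity and the stress are mollified, evenness
  -- of `κ` moves the mollification onto it and makes it an admissible test field.
  have htest : ∀ b, IsSpaceTest (conv κ (g b)) := fun b =>
    isSpaceTest_conv hκ ((hg b).mono h12) (hgd b)
  have hnorm : ∀ {v : E3 → E3} (hv : TorusMem 2 v) (hd : IsWeaklyDivFree v),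
      ‖(⟨_, hsol hv hd⟩ : solenoidal)‖ ^ 2 = ∫ x, ‖conv κ v x‖ ^ 2 ∂torusMeasure :=
    fun hv hd => by
      rw [← real_inner_self_eq_norm_sq, Submodule.coe_inner, inner_toLp]
      simp only [real_inner_self_eq_norm_sq]
  obtain ⟨C, hC0, hC⟩ := norm_stressField_le hκ
  obtain ⟨K, hK0, hK⟩ := hκ.exists_bound
  have hZn : ∀ r, ‖Z r‖ ≤ C * (∫⁻ x, ‖u r x‖ₑ ^ (2 : ℝ) ∂torusMeasure).toReal := fun r => by
    refine (Submodule.norm_orthogonalProjectionOnto_apply_le _ _).trans ?_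
    refine norm_toLp_le_of_bound _ (by positivity) fun x => ?_
    rw [← hu.integral_norm_sq_eq]
    exact hC _ (hu2 r) x
  have hVn : ∀ r, ‖V r‖ ≤ K * (∫⁻ x, ‖u r x‖ₑ ∂torusMeasure).toReal := fun r => by
    refine norm_toLp_le_of_bound (hcm (hu2 r)) (by positivity) fun x => ?_
    rw [← integral_norm_eq_lintegral_enorm (hu1 r).measurable.aestronglyMeasurable]
    exact norm_conv_le (hu1 r) hK hκ x
  obtain ⟨B, hB, hmain⟩ := exists_countable_norm_sq_eq (T := T) (V := V) (Z := Z) (V₀ := V₀)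
    (fun b => by
      simp only [hZb]
      exact (hu.stronglyMeasurable_momentum (htest b).smooth).aestronglyMeasurable)
    (hu.integrable_sq.const_mul C) (ae_of_all _ hZn) (hu.integrable_cube.const_mul (K * C))
    (ae_of_all _ fun r => by
      calc ‖V r‖ * ‖Z r‖ ≤ (K * (∫⁻ x, ‖u r x‖ₑ ∂torusMeasure).toReal)
            * (C * (∫⁻ x, ‖u r x‖ₑ ^ (2 : ℝ) ∂torusMeasure).toReal) :=
            mul_le_mul (hVn r) (hZn r) (norm_nonneg _) (by positivity)
        _ = K * C * ((∫⁻ x, ‖u r x‖ₑ ∂torusMeasure)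
            * (∫⁻ x, ‖u r x‖ₑ ^ (2 : ℝ) ∂torusMeasure)).toReal := by
            rw [ENNReal.toReal_mul]
            ring
        _ ≤ K * C * (∫⁻ x, ‖u r x‖ₑ ^ (3 : ℝ) ∂torusMeasure).toReal := by
            gcongr
            · exact (hu.lintegral_cube_lt_top r).ne
            · exact lintegral_mul_le_cube (hu1 r).measurable)
    (fun b => by
      filter_upwards [hmom _ (htest b)] with t ht
      simp only [hZb, V, V₀]
      rw [hVb (hu2 t) (hu.div_free t), hVb hu₀ hd₀]
      exact ht)
  refine ⟨(fun b => conv κ (g b)) '' B, hB.image _, ?_, fun t ht v hv hd hW => ?_⟩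
  · rintro _ ⟨b, -, rfl⟩
    exact htest b
  · have h := hmain t ht ⟨_, hsol hv hd⟩ fun b hb => by
      simp only [hZb, V₀]
      rw [hVb hv hd, hVb hu₀ hd₀]
      exact hW _ (mem_image_of_mem _ hb)
    rw [hnorm hv hd, hnorm hu₀ hd₀] at h
    rw [h]
    congr 2
    refine intervalIntegral.integral_congr fun r _ => ?_
    simp only [V, Z]
    -- The mollified velocity is solenoidal, so the projection can be dropped again.
    rw [Submodule.inner_orthogonalProjectionOnto_eq_of_mem_left, inner_toLp]

/-! ### The commutator estimate -/

/-- The mean cubic oscillation of `f` around `x` at scale `ε`. -/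
noncomputable def osc (ε : ℝ) (f : E3 → ℝ) (x : E3) : ℝ≥0∞ :=
  ⨍⁻ y in Metric.ball (0 : E3) ε, ‖f x - f (x - y)‖ₑ ^ (3 : ℝ) ∂volume

/-- Hölder with three exponents 3, the third factor being the constant one. -/
theorem lintegral_mul_le_cubes {X : Type*} [MeasurableSpace X] (μ : Measure X)
    [IsProbabilityMeasure μ] {F G : X → ℝ≥0∞} (hF : AEMeasurable F μ) (hG : AEMeasurable G μ) :
    ∫⁻ y, F y * G y ∂μ
      ≤ (∫⁻ y, F y ^ (3 : ℝ) ∂μ) ^ (1 / 3 : ℝ) * (∫⁻ y, G y ^ (3 : ℝ) ∂μ) ^ (1 / 3 : ℝ) := by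
  have h := ENNReal.lintegral_prod_norm_pow_le (μ := μ) (Finset.univ : Finset (Fin 3))
    (f := ![fun y => F y ^ (3 : ℝ), fun y => G y ^ (3 : ℝ), fun _ => 1])
    (fun i _ => by
      fin_cases i
      · exact hF.pow_const _
      · exact hG.pow_const _
      · exact aemeasurable_const) (p := fun _ => 1 / 3) (by simp) (fun _ _ => by norm_num)
  have h3 : ∀ z : ℝ≥0∞, (z ^ (3 : ℝ)) ^ (1 / 3 : ℝ) = z := fun z => by
    rw [← ENNReal.rpow_mul]
    norm_num
  have e0 : ∀ f : Fin 3 → X → ℝ≥0∞, ∀ y, ∏ i, f i y ^ (1 / 3 : ℝ)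
      = f 0 y ^ (1 / 3 : ℝ) * f 1 y ^ (1 / 3 : ℝ) * f 2 y ^ (1 / 3 : ℝ) := fun f y =>
    Fin.prod_univ_three _
  simp only [e0, Fin.prod_univ_three, Matrix.cons_val_zero, Matrix.cons_val_one, Matrix.cons_val,
    ENNReal.one_rpow, mul_one, lintegral_const, measure_univ, h3] at h
  exact h

section

variable {ε : ℝ} {f g : E3 → ℝ}

theorem laverage_ball_mul_le (hε : 0 < ε) {F G : E3 → ℝ≥0∞} (hF : Measurable F)
    (hG : Measurable G) :
    ⨍⁻ y in Metric.ball (0 : E3) ε, F y * G y ∂volume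
      ≤ (⨍⁻ y in Metric.ball (0 : E3) ε, F y ^ (3 : ℝ) ∂volume) ^ (1 / 3 : ℝ)
        * (⨍⁻ y in Metric.ball (0 : E3) ε, G y ^ (3 : ℝ) ∂volume) ^ (1 / 3 : ℝ) := by
  have : NeZero ((volume : Measure E3).restrict (Metric.ball 0 ε)) := ⟨by
    rw [Ne, Measure.restrict_eq_zero]
    exact (Metric.measure_ball_pos volume _ hε).ne'⟩
  have : IsFiniteMeasure ((volume : Measure E3).restrict (Metric.ball 0 ε)) :=
    ⟨by rw [Measure.restrict_apply_univ]; exact measure_ball_lt_top⟩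
  exact lintegral_mul_le_cubes _ hF.aemeasurable hG.aemeasurable

theorem laverage_ball_le (hε : 0 < ε) {F : E3 → ℝ≥0∞} (hF : Measurable F) :
    ⨍⁻ y in Metric.ball (0 : E3) ε, F y ∂volume
      ≤ (⨍⁻ y in Metric.ball (0 : E3) ε, F y ^ (3 : ℝ) ∂volume) ^ (1 / 3 : ℝ) := by
  have h := laverage_ball_mul_le hε hF (measurable_const (a := (1 : ℝ≥0∞)))
  have h1 : ⨍⁻ _ in Metric.ball (0 : E3) ε, (1 : ℝ≥0∞) ∂volume = 1 :=
    setLAverage_const (Metric.measure_ball_pos volume _ hε).ne' measure_ball_lt_top.ne 1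
  simpa only [mul_one, ENNReal.one_rpow, h1] using h

theorem enorm_integral_increment_le (hε : 0 < ε) (hf : Measurable f) {κ : E3 → ℝ} {A : ℝ}
    (hκ : BallBound κ ε A) (x : E3) :
    ‖∫ y, κ y * (f (x - y) - f x)‖ₑ ≤ ENNReal.ofReal A * osc ε f x ^ (1 / 3 : ℝ) := by
  refine (enorm_integral_le_lintegral_enorm _).trans ?_
  simp only [enorm_mul]
  refine (hκ.lintegral_le hε _).trans ?_
  gcongr
  refine (laverage_ball_le hε (by fun_prop)).trans_eq ?_
  simp only [osc, enorm_sub_rev (f x)]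

theorem enorm_integral_increment_mul_le (hε : 0 < ε) (hf : Measurable f) (hg : Measurable g)
    {κ : E3 → ℝ} {A : ℝ} (hκ : BallBound κ ε A) (x : E3) :
    ‖∫ y, κ y * ((f (x - y) - f x) * (g (x - y) - g x))‖ₑ
      ≤ ENNReal.ofReal A * (osc ε f x ^ (1 / 3 : ℝ) * osc ε g x ^ (1 / 3 : ℝ)) := by
  refine (enorm_integral_le_lintegral_enorm _).trans ?_
  simp only [enorm_mul]
  refine (hκ.lintegral_le hε _).trans ?_
  gcongr
  refine (laverage_ball_mul_le hε (by fun_prop) (by fun_prop)).trans_eq ?_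
  simp only [osc, enorm_sub_rev (f x), enorm_sub_rev (g x)]

theorem conv_sub_eq {κ : E3 → ℝ} (hκ : IsKernel κ) (hf : TorusMem 1 f) (x : E3) :
    ∫ y, κ y * (f (x - y) - f x) = conv κ f x - (∫ y, κ y) * f x := by
  have h : Integrable fun y => κ y * f (x - y) := convolutionExists hκ hf x
  simp only [mul_sub]
  rw [integral_sub h (hκ.integrable.mul_const _), integral_mul_const]
  rfl

theorem integral_partialDeriv_kernel {κ : E3 → ℝ} (hκ : IsKernel κ) (i : Fin 3) : ∫ y, partialDeriv i κ y = 0 := by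
  have h := conv_partialDeriv (φ := fun _ => 1) hκ contDiff_const i 0
  simpa [conv, partialDeriv] using h.symm

/-- The derivative kernel has mean zero, so `f x` may be subtracted under the convolution and only
increments remain. -/
theorem enorm_partialDeriv_conv_le (hε : 0 < ε) {κ : E3 → ℝ} (hκ : IsKernel κ)
    {i : Fin 3} {A : ℝ} (hA : BallBound (partialDeriv i κ) ε A)
    (hf : TorusMem 1 f) (x : E3) :
    ‖partialDeriv i (conv κ f) x‖ₑ ≤ ENNReal.ofReal A * osc ε f x ^ (1 / 3 : ℝ) := by
  have h := conv_sub_eq (hκ.partialDeriv i) hf x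
  rw [integral_partialDeriv_kernel hκ, zero_mul, sub_zero] at h
  rw [partialDeriv_conv hκ hf, ← h]
  exact enorm_integral_increment_le hε hf.measurable hA x

/-- The commutator of convolution and multiplication. -/
theorem enorm_conv_mul_sub_le (hε : 0 < ε) (hε' : ε < 1 / 2) (hf : TorusMem 1 f)
    (hg : TorusMem 1 g) (hfg : TorusMem 1 fun x => f x * g x) (x : E3) :
    ‖conv (mollifier hε) (fun x => f x * g x) x
        - conv (mollifier hε) f x * conv (mollifier hε) g x‖ₑ
      ≤ 72 * (osc ε f x ^ (1 / 3 : ℝ) * osc ε g x ^ (1 / 3 : ℝ)) := by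
  have hκ := isKernel_mollifier hε hε'
  set κ := mollifier hε
  have hB : BallBound κ ε 8 := ballBound_mollifier hε
  have hF := conv_sub_eq hκ hf x
  have hG := conv_sub_eq hκ hg x
  rw [integral_mollifier hε, one_mul] at hF hG
  have hFG : ∫ y, κ y * ((f (x - y) - f x) * (g (x - y) - g x))
      = conv κ (fun x => f x * g x) x - g x * conv κ f x - f x * conv κ g x + f x * g x := by
    have h₁ := convolutionExists hκ hfg x
    have h₂ := (convolutionExists hκ hf x).const_mul (g x)
    have h₃ := (convolutionExists hκ hg x).const_mul (f x)
    have h₄ := hκ.integrable.mul_const (f x * g x)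
    have e : ∀ y, κ y * ((f (x - y) - f x) * (g (x - y) - g x))
        = κ y • (f (x - y) * g (x - y)) - g x * (κ y • f (x - y)) - f x * (κ y • g (x - y))
          + κ y * (f x * g x) := fun y => by
      simp only [smul_eq_mul]
      ring
    have h₅ := h₁.sub h₂
    have h₆ := h₅.sub h₃
    simp only [Pi.sub_def] at h₅ h₆
    simp only [e]
    rw [integral_add h₆ h₄, integral_sub h₅ h₃, integral_sub h₁ h₂,
      integral_const_mul, integral_const_mul, integral_mul_const, integral_mollifier hε, one_mul]
    rfl
  -- The Constantin–E–Titi identity: the commutator is the average of the product of increments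
  -- minus the product of their averages. The two terms contribute 8 and 8 · 8, hence 72.
  have key : conv κ (fun x => f x * g x) x - conv κ f x * conv κ g x
      = (∫ y, κ y * ((f (x - y) - f x) * (g (x - y) - g x)))
        - (∫ y, κ y * (f (x - y) - f x)) * ∫ y, κ y * (g (x - y) - g x) := by
    rw [hFG, hF, hG]
    ring
  rw [key]
  refine enorm_sub_le.trans ?_
  rw [enorm_mul]
  have e8 : ENNReal.ofReal 8 = 8 := by simp
  have h₁ := enorm_integral_increment_mul_le hε hf.measurable hg.measurable hB x
  have h₂ := enorm_integral_increment_le hε hf.measurable hB x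
  have h₃ := enorm_integral_increment_le hε hg.measurable hB x
  rw [e8] at h₁ h₂ h₃
  refine (add_le_add h₁ (mul_le_mul' h₂ h₃)).trans_eq ?_
  ring

end

/-! ### The energy flux -/

theorem partialDeriv_sum {ι : Type*} (s : Finset ι) {f : ι → E3 → ℝ}
    (hf : ∀ i, ContDiff ℝ ∞ (f i)) (j : Fin 3) (x : E3) :
    partialDeriv j (fun x => ∑ i ∈ s, f i x) x = ∑ i ∈ s, partialDeriv j (f i) x := by
  simp only [partialDeriv]
  rw [fderiv_fun_sum fun i _ => (hf i).differentiable (by norm_num) x,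
    sum_apply]

section

variable {κ : E3 → ℝ} {v : E3 → E3}

/-- A divergence free field transports its own energy without loss. -/
theorem sum_integral_transport_eq_zero (hκ : IsKernel κ) (hv : TorusMem 1 v)
    (hd : IsWeaklyDivFree v) :
    ∑ k, ∑ j, ∫ x, (conv κ (fun y => v y j) x * conv κ (fun y => v y k) x)
      * partialDeriv j (conv κ fun y => v y k) x ∂torusMeasure = 0 := by
  set c : Fin 3 → E3 → ℝ := fun k => conv κ fun y => v y k with hc
  have hcs : ∀ k, ContDiff ℝ ∞ (c k) := fun k => contDiff_conv hκ (hv.coord k)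
  have hcp : ∀ k, IsPeriodic (c k) := fun k => (hv.coord k).periodic.conv κ
  -- The test function is |κ ⋆ v|², whose transport by κ ⋆ v is twice the sum in question.
  have h := isWeaklyDivFree_conv hv hd hκ (fun x => ∑ k, c k x * c k x)
    (ContDiff.sum fun k _ => (hcs k).mul (hcs k))
    (fun i x => by simp only [hcp _ i x])
  simp only [fderiv_apply_eq_sum, smul_eq_mul, conv_coord hκ hv,
    partialDeriv_sum _ (fun k => (hcs k).mul (hcs k)), partialDeriv_mul (hcs _) (hcs _)] at h
  have hi : ∀ k j, Integrable (fun x => (c j x * c k x) * partialDeriv j (c k) x)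
      torusMeasure := fun k j => integrable_of_periodic_continuous
    (((hcp j).comp₂ (hcp k) (· * ·)).comp₂ ((hcp k).partialDeriv j) (· * ·))
    (((hcs j).continuous.mul (hcs k).continuous).mul (contDiff_partialDeriv (hcs k) j).continuous)
  have e : ∀ x, ∑ j, conv κ (fun y => v y j) x
      * ∑ k, (c k x * partialDeriv j (c k) x + partialDeriv j (c k) x * c k x)
      = 2 * ∑ k, ∑ j, (c j x * c k x) * partialDeriv j (c k) x := fun x => by
    rw [Finset.sum_comm, Finset.mul_sum]
    refine Finset.sum_congr rfl fun j _ => ?_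
    rw [Finset.mul_sum, Finset.mul_sum]
    refine Finset.sum_congr rfl fun k _ => ?_
    change c j x * _ = _
    ring
  simp only [e] at h
  rw [integral_const_mul, integral_finsetSum _ fun k _ => integrable_finsetSum _ fun j _ => hi k j]
    at h
  simp only [integral_finsetSum _ fun j _ => hi _ j] at h
  simpa using h

/-- After an integration by parts the full stress κ⋆(v ⊗ v) stands against the gradient. Subtracting
the vanishing transport of κ ⋆ v by itself turns it into the commutator. -/
theorem flux_eq (hκ : IsKernel κ) (hv : TorusMem 2 v) (hd : IsWeaklyDivFree v) :
    ∫ x, inner ℝ (conv κ v x) (stressField κ v x) ∂torusMeasure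
      = ∑ k, ∑ j, ∫ x, (conv κ (fun y => v y j * v y k) x
          - conv κ (fun y => v y j) x * conv κ (fun y => v y k) x)
        * partialDeriv j (conv κ fun y => v y k) x ∂torusMeasure := by
  have hv1 : TorusMem 1 v := hv.mono (by norm_num)
  set c : Fin 3 → E3 → ℝ := fun k => conv κ fun y => v y k with hc
  set q : Fin 3 → Fin 3 → E3 → ℝ := fun j k => conv κ fun y => v y j * v y k with hq
  have hcs : ∀ k, ContDiff ℝ ∞ (c k) := fun k => contDiff_conv hκ (hv1.coord k)
  have hcp : ∀ k, IsPeriodic (c k) := fun k => (hv.coord k).periodic.conv κ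
  have hqs : ∀ j k, ContDiff ℝ ∞ (q j k) := fun j k => contDiff_conv hκ (hv.coord_mul j k)
  have hqp : ∀ j k, IsPeriodic (q j k) := fun j k => (hv.coord_mul j k).periodic.conv κ
  have hi : ∀ k j, Integrable (fun x => (c j x * c k x) * partialDeriv j (c k) x)
      torusMeasure := fun k j => integrable_of_periodic_continuous
    (((hcp j).comp₂ (hcp k) (· * ·)).comp₂ ((hcp k).partialDeriv j) (· * ·))
    (((hcs j).continuous.mul (hcs k).continuous).mul (contDiff_partialDeriv (hcs k) j).continuous)
  have hi₂ : ∀ k j, Integrable (fun x => q j k x * partialDeriv j (c k) x)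
      torusMeasure := fun k j => integrable_of_periodic_continuous
    ((hqp j k).comp₂ ((hcp k).partialDeriv j) (· * ·))
    ((hqs j k).continuous.mul (contDiff_partialDeriv (hcs k) j).continuous)
  have hi₃ : ∀ k j, Integrable (fun x => c k x * partialDeriv j (q j k) x)
      torusMeasure := fun k j => integrable_of_periodic_continuous
    ((hcp k).comp₂ ((hqp j k).partialDeriv j) (· * ·))
    ((hcs k).continuous.mul (contDiff_partialDeriv (hqs j k) j).continuous)
  have h₁ : ∫ x, inner ℝ (conv κ v x) (stressField κ v x) ∂torusMeasure
      = ∑ k, ∑ j, ∫ x, q j k x * partialDeriv j (c k) x ∂torusMeasure := by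
    have e : ∀ x, inner ℝ (conv κ v x) (stressField κ v x)
        = - ∑ k, ∑ j, c k x * partialDeriv j (q j k) x := fun x => by
      simp only [inner_eq_sum, conv_coord hκ hv1, stressField_coord hκ hv, mul_neg,
        Finset.sum_neg_distrib, Finset.mul_sum, hq, partialDeriv_conv hκ (hv.coord_mul _ _)]
      rfl
    simp only [e]
    rw [integral_neg, integral_finsetSum _ fun k _ => integrable_finsetSum _ fun j _ => hi₃ k j,
      ← Finset.sum_neg_distrib]
    refine Finset.sum_congr rfl fun k _ => ?_
    rw [integral_finsetSum _ fun j _ => hi₃ k j, ← Finset.sum_neg_distrib]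
    refine Finset.sum_congr rfl fun j _ => ?_
    rw [integral_mul_partialDeriv (hcp k) (hcs k) (hqp j k) (hqs j k), neg_neg]
    simp only [mul_comm]
  rw [h₁, ← sub_zero (∑ k, _), ← sum_integral_transport_eq_zero hκ hv1 hd,
    ← Finset.sum_sub_distrib]
  refine Finset.sum_congr rfl fun k _ => ?_
  rw [← Finset.sum_sub_distrib]
  refine Finset.sum_congr rfl fun j _ => ?_
  rw [← integral_sub (hi₂ k j) (hi k j)]
  simp only [sub_mul]
  rfl

theorem sum_partialDeriv_conv_eq_zero (hκ : IsKernel κ) (hv : TorusMem 1 v)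
    (hd : IsWeaklyDivFree v) (x : E3) :
    ∑ k, partialDeriv k (conv κ fun y => v y k) x = 0 := by
  have h := (isSpaceTest_conv hκ hv hd).div_free x
  rw [divergence_eq (contDiff_conv hκ hv)] at h
  have e : ∀ k, (fun x => conv κ v x k) = conv κ fun y => v y k := fun k =>
    funext fun x => conv_coord hκ hv k x
  simpa only [e] using h

end

/-- The triples of components other than `(2, 2, 2)`. -/
def mixedTriples : Finset (Fin 3 × Fin 3 × Fin 3) := Finset.univ.filter (· ≠ (2, 2, 2))

/-- The sum of the products of three oscillations over all triples of components that involve a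
horizontal one. -/
noncomputable def mixedOsc (ε : ℝ) (v : E3 → E3) (x : E3) : ℝ≥0∞ :=
  ∑ p ∈ mixedTriples, osc ε (fun y => v y p.1) x ^ (1 / 3 : ℝ)
    * osc ε (fun y => v y p.2.1) x ^ (1 / 3 : ℝ) * osc ε (fun y => v y p.2.2) x ^ (1 / 3 : ℝ)

theorem le_mixedOsc (ε : ℝ) (v : E3 → E3) (x : E3) {a b c : Fin 3}
    (h : (a, b, c) ∈ mixedTriples) :
    osc ε (fun y => v y a) x ^ (1 / 3 : ℝ) * osc ε (fun y => v y b) x ^ (1 / 3 : ℝ)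
      * osc ε (fun y => v y c) x ^ (1 / 3 : ℝ) ≤ mixedOsc ε v x := by
  unfold mixedOsc
  have := Finset.single_le_sum (s := mixedTriples) (f := fun p : Fin 3 × Fin 3 × Fin 3 =>
    osc ε (fun y => v y p.1) x ^ (1 / 3 : ℝ) * osc ε (fun y => v y p.2.1) x ^ (1 / 3 : ℝ)
      * osc ε (fun y => v y p.2.2) x ^ (1 / 3 : ℝ)) (fun _ _ => bot_le) h
  exact this

/-- Commutator and gradient supply three oscillations and the factor 1/ε. The only purely vertical
triple is avoided by incompressibility, at the cost of a sum of two terms. The constant is 9 index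
pairs times 72 from the commutator times these 2. -/
theorem exists_enorm_flux_le : ∃ C : ℝ, 0 ≤ C ∧ ∀ (ε : ℝ) (hε : 0 < ε), ε < 1 / 2 →
    ∀ v : E3 → E3, TorusMem 2 v → IsWeaklyDivFree v →
    ‖∫ x, inner ℝ (conv (mollifier hε) v x) (stressField (mollifier hε) v x) ∂torusMeasure‖ₑ
      ≤ ENNReal.ofReal (C / ε) * ∫⁻ x, mixedOsc ε v x ∂torusMeasure := by
  obtain ⟨C, hC0, hC⟩ := exists_ballBound_partialDeriv_mollifier
  refine ⟨1296 * C, by positivity, fun ε hε hε' v hv hd => ?_⟩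
  have hκ := isKernel_mollifier hε hε'
  have hv1 : TorusMem 1 v := hv.mono (by norm_num)
  rw [flux_eq hκ hv hd]
  have hder : ∀ i k x, ‖partialDeriv i (conv (mollifier hε) fun y => v y k) x‖ₑ
      ≤ ENNReal.ofReal (C / ε) * osc ε (fun y => v y k) x ^ (1 / 3 : ℝ) := fun i k x =>
    enorm_partialDeriv_conv_le hε hκ (hC ε hε i) (hv1.coord k) x
  have hterm : ∀ j k x, osc ε (fun y => v y j) x ^ (1 / 3 : ℝ)
      * osc ε (fun y => v y k) x ^ (1 / 3 : ℝ)
      * ‖partialDeriv j (conv (mollifier hε) fun y => v y k) x‖ₑ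
      ≤ 2 * (ENNReal.ofReal (C / ε) * mixedOsc ε v x) := by
    intro j k x
    by_cases hjk : j = 2 ∧ k = 2
    -- Here the vertical derivative of the vertical component is traded for the two horizontal ones.
    · obtain ⟨rfl, rfl⟩ := hjk
      have h := sum_partialDeriv_conv_eq_zero hκ hv1 hd x
      rw [Fin.sum_univ_three] at h
      have h₂ : partialDeriv 2 (conv (mollifier hε) fun y => v y 2) x
          = -(partialDeriv 0 (conv (mollifier hε) fun y => v y 0) x
            + partialDeriv 1 (conv (mollifier hε) fun y => v y 1) x) := by linarith
      rw [h₂, enorm_neg, two_mul]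
      refine (mul_le_mul_right (enorm_add_le _ _) _).trans ?_
      rw [mul_add]
      refine add_le_add ?_ ?_
      · refine (mul_le_mul_right (hder 0 0 x) _).trans ?_
        rw [mul_left_comm]
        exact mul_le_mul_right (le_mixedOsc ε v x (by decide)) _
      · refine (mul_le_mul_right (hder 1 1 x) _).trans ?_
        rw [mul_left_comm]
        exact mul_le_mul_right (le_mixedOsc ε v x (by decide)) _
    · refine (mul_le_mul_right (hder j k x) _).trans ?_
      rw [mul_left_comm]
      refine (mul_le_mul_right (le_mixedOsc ε v x ?_) _).trans ?_
      · simp only [mixedTriples, Finset.mem_filter, Finset.mem_univ, true_and, ne_eq,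
          Prod.mk.injEq]
        tauto
      · rw [two_mul]
        exact le_self_add
  have hint : ∀ k j, ‖∫ x, (conv (mollifier hε) (fun y => v y j * v y k) x
          - conv (mollifier hε) (fun y => v y j) x * conv (mollifier hε) (fun y => v y k) x)
        * partialDeriv j (conv (mollifier hε) fun y => v y k) x ∂torusMeasure‖ₑ
      ≤ 144 * (ENNReal.ofReal (C / ε) * ∫⁻ x, mixedOsc ε v x ∂torusMeasure) := by
    intro k j
    refine (enorm_integral_le_lintegral_enorm _).trans ?_
    rw [← lintegral_const_mul' _ _ ENNReal.ofReal_ne_top,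
      ← lintegral_const_mul' _ _ ENNReal.ofNat_ne_top]
    refine lintegral_mono fun x => ?_
    rw [enorm_mul]
    refine (mul_le_mul_left (enorm_conv_mul_sub_le hε hε' (hv1.coord j) (hv1.coord k)
      (hv.coord_mul j k) x) _).trans ?_
    rw [mul_assoc]
    refine (mul_le_mul_right (hterm j k x) _).trans_eq ?_
    rw [← mul_assoc]
    norm_num
  have hC' : ENNReal.ofReal (1296 * C / ε) = 1296 * ENNReal.ofReal (C / ε) := by
    rw [mul_div_assoc, ENNReal.ofReal_mul (by norm_num)]
    norm_num
  rw [hC']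
  refine (enorm_sum_le _ _).trans ?_
  refine (Finset.sum_le_sum fun k _ => (enorm_sum_le _ _).trans
    (Finset.sum_le_sum fun j _ => hint k j)).trans_eq ?_
  simp only [Finset.sum_const, Finset.card_univ, Fintype.card_fin, nsmul_eq_mul]
  rw [← mul_assoc, ← mul_assoc, ← mul_assoc]
  norm_num

/-! ### Decay of the flux -/

theorem meanOscillation_eq (T : ℝ) (f : ℝ → E3 → ℝ) (ε : ℝ) :
    meanOscillation T 3 3 f ε
      = (∫⁻ t in Ioo 0 T, ∫⁻ x, osc ε (f t) x ∂torusMeasure) ^ (1 / 3 : ℝ) := by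
  simp only [meanOscillation, osc, NNReal.coe_ofNat]
  norm_num

theorem measurable_osc {f : ℝ → E3 → ℝ} (hf : Measurable (Function.uncurry f)) (ε : ℝ) :
    Measurable fun q : ℝ × E3 => osc ε (f q.1) q.2 := by
  simp only [osc, setLAverage_eq]
  refine Measurable.div_const ?_ _
  refine Measurable.lintegral_prod_right'
    (f := fun r : (ℝ × E3) × E3 => ‖f r.1.1 r.1.2 - f r.1.1 (r.1.2 - r.2)‖ₑ ^ (3 : ℝ)) ?_
  have h₁ : Measurable fun r : (ℝ × E3) × E3 => f r.1.1 r.1.2 := hf.comp measurable_fst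
  have h₂ : Measurable fun r : (ℝ × E3) × E3 => f r.1.1 (r.1.2 - r.2) :=
    hf.comp (g := Function.uncurry f) (f := fun r : (ℝ × E3) × E3 => (r.1.1, r.1.2 - r.2))
      (by fun_prop)
  exact (h₁.sub h₂).enorm.pow_const _

/-- Hölder in space-time with three exponents 3, applied to each triple. -/
theorem lintegral_mixedOsc_le {u : ℝ → E3 → E3} (hu : Measurable (Function.uncurry u)) (T ε : ℝ) :
    ∫⁻ t in Ioo 0 T, ∫⁻ x, mixedOsc ε (u t) x ∂torusMeasure
      ≤ ∑ p ∈ mixedTriples, meanOscillation T 3 3 (fun t x => u t x p.1) ε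
        * meanOscillation T 3 3 (fun t x => u t x p.2.1) ε
        * meanOscillation T 3 3 (fun t x => u t x p.2.2) ε := by
  have hm : ∀ i : Fin 3, Measurable fun q : ℝ × E3 => osc ε (fun x => u q.1 x i) q.2 := fun i =>
    measurable_osc (f := fun t x => u t x i) ((by fun_prop : Measurable fun y : E3 => y i).comp hu) ε
  have hO : ∀ i : Fin 3, meanOscillation T 3 3 (fun t x => u t x i) ε
      = (∫⁻ q, osc ε (fun x => u q.1 x i) q.2 ∂spaceTimeMeasure T) ^ (1 / 3 : ℝ) := fun i => by
    rw [meanOscillation_eq, spaceTimeMeasure, lintegral_prod _ (hm i).aemeasurable]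
  have hprod : ∀ p : Fin 3 × Fin 3 × Fin 3, Measurable fun q : ℝ × E3 =>
      osc ε (fun x => u q.1 x p.1) q.2 ^ (1 / 3 : ℝ)
        * osc ε (fun x => u q.1 x p.2.1) q.2 ^ (1 / 3 : ℝ)
        * osc ε (fun x => u q.1 x p.2.2) q.2 ^ (1 / 3 : ℝ) := fun p =>
    (((hm p.1).pow_const _).mul ((hm p.2.1).pow_const _)).mul ((hm p.2.2).pow_const _)
  have h₁ : ∫⁻ t in Ioo 0 T, ∫⁻ x, mixedOsc ε (u t) x ∂torusMeasure
      = ∫⁻ q, mixedOsc ε (u q.1) q.2 ∂spaceTimeMeasure T := by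
    have : Measurable fun q : ℝ × E3 => mixedOsc ε (u q.1) q.2 :=
      Finset.measurable_fun_sum _ fun p _ => hprod p
    rw [spaceTimeMeasure, lintegral_prod _ this.aemeasurable]
  rw [h₁]
  simp only [mixedOsc]
  rw [lintegral_finsetSum _ fun p _ => hprod p]
  refine Finset.sum_le_sum fun p _ => ?_
  have h := ENNReal.lintegral_prod_norm_pow_le (μ := spaceTimeMeasure T)
    (Finset.univ : Finset (Fin 3))
    (f := fun i (q : ℝ × E3) => osc ε (fun x => u q.1 x (![p.1, p.2.1, p.2.2] i)) q.2)
    (fun i _ => (hm _).aemeasurable) (p := fun _ => 1 / 3) (by simp) (fun _ _ => by norm_num)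
  simp only [Fin.prod_univ_three, Matrix.cons_val_zero, Matrix.cons_val_one, Matrix.cons_val] at h
  rw [hO, hO, hO]
  exact h

/-- The bound of the flux tends to zero if the horizontal oscillations are `o(ε^α)`, the vertical
ones are `O(ε^β)`, and `α`, `β` are in the Onsager range. -/
theorem tendsto_mixed_flux {α β : ℝ} (hα : 1 / 3 ≤ α) (hαβ : 1 ≤ 2 * α + β) (hβ : 1 ≤ α + 2 * β)
    {O : Fin 3 → ℝ → ℝ≥0∞}
    (h₀ : Tendsto (fun ε : ℝ => ENNReal.ofReal (ε ^ (-α)) * O 0 ε) (𝓝[>] 0) (𝓝 0))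
    (h₁ : Tendsto (fun ε : ℝ => ENNReal.ofReal (ε ^ (-α)) * O 1 ε) (𝓝[>] 0) (𝓝 0))
    {B : ℝ≥0∞} (hB : B ≠ ⊤)
    (h₂ : ∀ᶠ ε in 𝓝[>] (0 : ℝ), ENNReal.ofReal (ε ^ (-β)) * O 2 ε ≤ B) (C : ℝ) (hC : 0 ≤ C) :
    Tendsto (fun ε : ℝ => ENNReal.ofReal (C / ε)
      * ∑ p ∈ mixedTriples, O p.1 ε * O p.2.1 ε * O p.2.2 ε) (𝓝[>] 0) (𝓝 0) := by
  set e : Fin 3 → ℝ := ![α, α, β] with he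
  set a : Fin 3 → ℝ → ℝ≥0∞ := fun i ε => ENNReal.ofReal (ε ^ (-e i)) * O i ε with ha
  have ha0 : Tendsto (a 0) (𝓝[>] 0) (𝓝 0) := h₀
  have ha1 : Tendsto (a 1) (𝓝[>] 0) (𝓝 0) := h₁
  have ha2 : ∀ᶠ ε in 𝓝[>] (0 : ℝ), a 2 ε ≤ B := h₂
  have hM : Tendsto (fun ε => a 0 ε + a 1 ε) (𝓝[>] 0) (𝓝 0) := by simpa using ha0.add ha1
  set D : ℝ≥0∞ := ENNReal.ofReal C * (mixedTriples.card * (1 + B) ^ 2) with hD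
  have hDtop : D ≠ ⊤ := by
    refine ENNReal.mul_ne_top ENNReal.ofReal_ne_top (ENNReal.mul_ne_top (by simp) ?_)
    exact ENNReal.pow_ne_top (ENNReal.add_ne_top.2 ⟨ENNReal.one_ne_top, hB⟩)
  have hlim : Tendsto (fun ε => D * (a 0 ε + a 1 ε)) (𝓝[>] 0) (𝓝 0) := by
    simpa using ENNReal.Tendsto.const_mul hM (Or.inr hDtop)
  refine tendsto_of_tendsto_of_tendsto_of_le_of_le' tendsto_const_nhds hlim
    (Eventually.of_forall fun _ => bot_le) ?_
  filter_upwards [ha2, hM.eventually (gt_mem_nhds one_pos), self_mem_nhdsWithin,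
    Ioo_mem_nhdsGT (zero_lt_one (α := ℝ))] with ε hε2 hε1 hε0 hεI
  have hεpos : 0 < ε := hε0
  have hle : ∀ i, a i ε ≤ 1 + B := by
    intro i
    fin_cases i
    · exact (le_self_add.trans hε1.le).trans le_self_add
    · exact (le_add_self.trans hε1.le).trans le_self_add
    · exact hε2.trans le_add_self
  have hprod : ∀ p ∈ mixedTriples, ENNReal.ofReal (1 / ε) * (O p.1 ε * O p.2.1 ε * O p.2.2 ε)
      ≤ (a 0 ε + a 1 ε) * (1 + B) ^ 2 := by
    rintro ⟨i, j, k⟩ hp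
    -- A mixed triple has exponent sum 3α, 2α + β or α + 2β; with ε < 1 this lets the three powers
    -- absorb 1/ε.
    have hsum : 1 ≤ e i + e j + e k := by
      have : (i, j, k) ≠ (2, 2, 2) := by simpa [mixedTriples] using hp
      fin_cases i <;> fin_cases j <;> fin_cases k <;> simp [he] at this ⊢ <;> linarith
    have hpow : ENNReal.ofReal (1 / ε) ≤ ENNReal.ofReal (ε ^ (-e i)) * ENNReal.ofReal (ε ^ (-e j))
        * ENNReal.ofReal (ε ^ (-e k)) := by
      rw [← ENNReal.ofReal_mul (by positivity), ← ENNReal.ofReal_mul (by positivity),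
        ← Real.rpow_add hεpos, ← Real.rpow_add hεpos, one_div, ← Real.rpow_neg_one]
      exact ENNReal.ofReal_le_ofReal
        (Real.rpow_le_rpow_of_exponent_ge hεpos hεI.2.le (by linarith))
    -- One horizontal factor is small and the other two are merely bounded.
    have h3 : a i ε * a j ε * a k ε ≤ (a 0 ε + a 1 ε) * (1 + B) ^ 2 := by
      have hsmall : ∀ l : Fin 3, l ≠ 2 → a l ε ≤ a 0 ε + a 1 ε := by
        intro l hl
        fin_cases l
        · exact le_self_add
        · exact le_add_self
        · exact absurd rfl hl
      by_cases hi : i = 2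
      · by_cases hj : j = 2
        · have hk : k ≠ 2 := by
            rintro rfl
            simp [mixedTriples, hi, hj] at hp
          calc a i ε * a j ε * a k ε ≤ (1 + B) * (1 + B) * (a 0 ε + a 1 ε) :=
                mul_le_mul' (mul_le_mul' (hle i) (hle j)) (hsmall k hk)
            _ = _ := by ring
        · calc a i ε * a j ε * a k ε ≤ (1 + B) * (a 0 ε + a 1 ε) * (1 + B) :=
                mul_le_mul' (mul_le_mul' (hle i) (hsmall j hj)) (hle k)
            _ = _ := by ring
      · calc a i ε * a j ε * a k ε ≤ (a 0 ε + a 1 ε) * (1 + B) * (1 + B) :=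
              mul_le_mul' (mul_le_mul' (hsmall i hi) (hle j)) (hle k)
          _ = _ := by ring
    refine le_trans ?_ h3
    refine (mul_le_mul_left hpow _).trans_eq ?_
    simp only [ha]
    ring
  have hsplit : ENNReal.ofReal (C / ε) = ENNReal.ofReal C * ENNReal.ofReal (1 / ε) := by
    rw [← ENNReal.ofReal_mul hC, mul_one_div]
  rw [hsplit, mul_assoc, Finset.mul_sum]
  refine (mul_le_mul_right (Finset.sum_le_sum hprod) _).trans_eq ?_
  rw [Finset.sum_const, nsmul_eq_mul, hD]
  ring

/-! ### Higher order differences control first order differences -/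

/-- The translation operator. -/
def shiftOp (h : E3) : Module.End ℝ (E3 → ℝ) := LinearMap.funLeft ℝ ℝ (· + h)

theorem shiftOp_apply (h : E3) (f : E3 → ℝ) (x : E3) : shiftOp h f x = f (x + h) := rfl

/-- Differences are polynomials in the translation operator, so polynomial identities become
identities between differences. -/
theorem iterate_fwdDiff_eq (h : E3) (k : ℕ) (f : E3 → ℝ) :
    (fwdDiff h)^[k] f = ((shiftOp h - 1) ^ k) f := by
  have : (fwdDiff h : (E3 → ℝ) → E3 → ℝ) = (shiftOp h - 1 : Module.End ℝ (E3 → ℝ)) := by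
    funext f x
    simp [fwdDiff, shiftOp_apply]
  rw [this, Module.End.pow_apply]

theorem shiftOp_two (h : E3) : shiftOp ((2 : ℝ) • h) = shiftOp h ^ 2 := by
  ext f x
  simp only [sq, Module.End.mul_apply, shiftOp_apply, two_smul, add_assoc]

/-- The `L³` norm on the torus as a real number. -/
noncomputable def normL3 (f : E3 → ℝ) : ℝ := (eLpNorm f 3 torusMeasure).toReal

theorem normL3_nonneg (f : E3 → ℝ) : 0 ≤ normL3 f := ENNReal.toReal_nonneg

theorem TorusMem.add {f g : E3 → ℝ} {p : ℝ≥0∞} (hf : TorusMem p f) (hg : TorusMem p g) :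
    TorusMem p (f + g) :=
  ⟨hf.measurable.add hg.measurable, hf.periodic.comp₂ hg.periodic (· + ·), hf.memLp.add hg.memLp⟩

theorem TorusMem.smul {f : E3 → ℝ} {p : ℝ≥0∞} (hf : TorusMem p f) (c : ℝ) :
    TorusMem p (c • f) :=
  ⟨hf.measurable.const_smul c, hf.periodic.comp_left (c • ·), hf.memLp.const_smul c⟩

theorem normL3_add_le {f g : E3 → ℝ} (hf : TorusMem 3 f) (hg : TorusMem 3 g) :
    normL3 (f + g) ≤ normL3 f + normL3 g := by
  rw [normL3, normL3, normL3, ← ENNReal.toReal_add hf.memLp.2.ne hg.memLp.2.ne]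
  exact ENNReal.toReal_mono (ENNReal.add_ne_top.2 ⟨hf.memLp.2.ne, hg.memLp.2.ne⟩)
    (eLpNorm_add_le hf.memLp.1 hg.memLp.1 (by norm_num))

theorem normL3_smul (c : ℝ) (f : E3 → ℝ) : normL3 (c • f) = |c| * normL3 f := by
  rw [normL3, eLpNorm_const_smul, ENNReal.toReal_mul, toReal_enorm, Real.norm_eq_abs]
  rfl

theorem shiftOp_pow (h : E3) {f : E3 → ℝ} (hf : TorusMem 3 f) (k : ℕ) :
    TorusMem 3 ((shiftOp h ^ k) f) ∧ normL3 ((shiftOp h ^ k) f) = normL3 f := by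
  induction k with
  | zero => exact ⟨hf, rfl⟩
  | succ k ih =>
    obtain ⟨h₁, h₂⟩ := ih
    rw [pow_succ', Module.End.mul_apply]
    set g := (shiftOp h ^ k) f
    have e : shiftOp h g = fun x => g (x + h) := rfl
    have hn := eLpNorm_shift (p := 3) h₁.periodic (by norm_num) (by norm_num) h
    rw [e]
    refine ⟨⟨h₁.measurable.comp (measurable_add_const h), h₁.periodic.shift h,
      ((h₁.measurable.comp (measurable_add_const h)).aestronglyMeasurable), ?_⟩, ?_⟩
    · rw [hn]
      exact h₁.memLp.2
    · rw [normL3, hn]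
      exact h₂

/-- Translations are isometries of L³, so a polynomial in one of them is bounded uniformly in the
step `h`. -/
theorem aeval_shiftOp (Q : Polynomial ℝ) : ∃ D : ℝ, 0 ≤ D ∧ ∀ (h : E3) (f : E3 → ℝ),
    TorusMem 3 f → TorusMem 3 (Polynomial.aeval (shiftOp h) Q f)
      ∧ normL3 (Polynomial.aeval (shiftOp h) Q f) ≤ D * normL3 f := by
  induction Q using Polynomial.induction_on' with
  | add p q hp hq =>
    obtain ⟨D₁, hD₁, h₁⟩ := hp
    obtain ⟨D₂, hD₂, h₂⟩ := hq
    refine ⟨D₁ + D₂, by positivity, fun h f hf => ?_⟩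
    rw [map_add, LinearMap.add_apply]
    refine ⟨(h₁ h f hf).1.add (h₂ h f hf).1, ?_⟩
    rw [add_mul]
    exact (normL3_add_le (h₁ h f hf).1 (h₂ h f hf).1).trans
      (add_le_add (h₁ h f hf).2 (h₂ h f hf).2)
  | monomial n c =>
    refine ⟨|c|, abs_nonneg c, fun h f hf => ?_⟩
    obtain ⟨h₁, h₂⟩ := shiftOp_pow h hf n
    rw [Polynomial.aeval_monomial, Module.algebraMap_end_eq_smul_id, Module.End.mul_apply,
      LinearMap.smul_apply, LinearMap.id_apply, normL3_smul, h₂]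
    exact ⟨h₁.smul c, le_rfl⟩

open Polynomial in
-- X² - 1 = (X - 1)(X + 1) and X + 1 ≡ 2 modulo X - 1. For X the shift by h, this compares the k-th
-- differences with steps h and 2h up to a difference of order k + 1, as in Marchaud's inequality.
theorem exists_doubling_polynomial (k : ℕ) : ∃ Q : ℝ[X],
    (2 : ℝ[X]) ^ k * (X - 1) ^ k = (X ^ 2 - 1) ^ k + Q * (X - 1) ^ (k + 1) := by
  obtain ⟨R, hR⟩ := sub_dvd_pow_sub_pow (2 : ℝ[X]) (X + 1) k
  refine ⟨-R, ?_⟩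
  have h : (X ^ 2 - 1 : ℝ[X]) = (X - 1) * (X + 1) := by ring
  rw [h, mul_pow]
  linear_combination (X - 1 : ℝ[X]) ^ k * hR

/-- The bound is trivial for ‖h‖ ≥ 1 and is passed from 2h to h. With M = A + 2DC one needs ½ (2^γ M
+ DC) ≤ M; this holds because 2^γ ≤ 3/2, which is where γ ≤ 1/3 enters. -/
theorem doubling_real {a b : E3 → ℝ} {A D C γ : ℝ} (hγ : 0 ≤ γ) (hγ' : γ ≤ 1 / 3) (hA : 0 ≤ A)
    (hD : 0 ≤ D) (hC : 0 ≤ C) (haA : ∀ h, a h ≤ A)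
    (hab : ∀ h, 2 * a h ≤ a ((2 : ℝ) • h) + D * b h) (hb : ∀ h ≠ 0, b h ≤ C * ‖h‖ ^ γ) :
    ∀ h ≠ 0, a h ≤ (A + 2 * (D * C)) * ‖h‖ ^ γ := by
  have h2 : (2 : ℝ) ^ γ ≤ 3 / 2 := by
    calc (2 : ℝ) ^ γ ≤ 2 ^ (1 / 3 : ℝ) := Real.rpow_le_rpow_of_exponent_le (by norm_num) hγ'
      _ ≤ ((3 / 2 : ℝ) ^ (3 : ℝ)) ^ (1 / 3 : ℝ) :=
          Real.rpow_le_rpow (by norm_num) (by norm_num) (by norm_num)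
      _ = 3 / 2 := by rw [← Real.rpow_mul (by norm_num)]; norm_num
  -- Induction on the number of doublings that bring `h` to length at least one.
  have key : ∀ n : ℕ, ∀ h : E3, h ≠ 0 → 1 ≤ 2 ^ n * ‖h‖ →
      a h ≤ (A + 2 * (D * C)) * ‖h‖ ^ γ := by
    intro n
    induction n with
    | zero =>
      intro h _ hn
      rw [pow_zero, one_mul] at hn
      have h₁ : 1 ≤ ‖h‖ ^ γ := Real.one_le_rpow hn hγ
      calc a h ≤ A := haA h
        _ ≤ A * ‖h‖ ^ γ := le_mul_of_one_le_right hA h₁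
        _ ≤ _ := by gcongr; linarith [mul_nonneg hD hC]
    | succ n ih =>
      intro h h0 hn
      have h₁ := ih ((2 : ℝ) • h) (smul_ne_zero two_ne_zero h0) (by
        rw [norm_smul, Real.norm_ofNat, ← mul_assoc, ← pow_succ]
        exact hn)
      rw [norm_smul, Real.norm_ofNat, Real.mul_rpow (by norm_num) (norm_nonneg _)] at h₁
      have h₂ := hab h
      have h₃ := mul_le_mul_of_nonneg_left (hb h h0) hD
      have hp : 0 ≤ ‖h‖ ^ γ := Real.rpow_nonneg (norm_nonneg _) _
      have h₄ : (A + 2 * (D * C)) * (2 ^ γ * ‖h‖ ^ γ)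
          ≤ (A + 2 * (D * C)) * (3 / 2 * ‖h‖ ^ γ) := by gcongr
      nlinarith [mul_nonneg hA hp]
  intro h h0
  obtain ⟨n, hn⟩ := pow_unbounded_of_one_lt (‖h‖⁻¹) (one_lt_two (α := ℝ))
  refine key n h h0 ?_
  have hpos : 0 < ‖h‖ := norm_pos_iff.2 h0
  calc (1 : ℝ) = ‖h‖⁻¹ * ‖h‖ := (inv_mul_cancel₀ hpos.ne').symm
    _ ≤ _ := by gcongr

/-- A function of finite Besov norm of order `β` has first differences of order `γ` for every
`γ ≤ min β (1/3)`. -/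
theorem exists_normL3_fwdDiff_le {β γ : ℝ} (hγ : 0 ≤ γ) (hγ' : γ ≤ 1 / 3) (hγβ : γ ≤ β) :
    ∃ C : ℝ, 0 ≤ C ∧ ∀ f : E3 → ℝ, TorusMem 3 f → besovNorm β 3 f ≠ ⊤ → ∀ h : E3, h ≠ 0 →
      normL3 (fwdDiff h f) ≤ C * (besovNorm β 3 f).toReal * ‖h‖ ^ γ := by
  have hbase : ∀ k : ℕ, ∃ D : ℝ, 0 ≤ D ∧ ∀ (h : E3) (f : E3 → ℝ), TorusMem 3 f →
      TorusMem 3 (((shiftOp h - 1) ^ k) f) ∧ normL3 (((shiftOp h - 1) ^ k) f) ≤ D * normL3 f := by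
    intro k
    have h := aeval_shiftOp ((Polynomial.X - 1) ^ k)
    simp only [map_pow, map_sub, Polynomial.aeval_X, map_one] at h
    exact h
  have hfB : ∀ f : E3 → ℝ, besovNorm β 3 f ≠ ⊤ → normL3 f ≤ (besovNorm β 3 f).toReal := fun f hB =>
    ENNReal.toReal_mono hB le_self_add
  set P : ℕ → Prop := fun k => ∃ C : ℝ, 0 ≤ C ∧ ∀ f : E3 → ℝ, TorusMem 3 f →
    besovNorm β 3 f ≠ ⊤ → ∀ h : E3, h ≠ 0 →
      normL3 (((shiftOp h - 1) ^ k) f) ≤ C * (besovNorm β 3 f).toReal * ‖h‖ ^ γ with hP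
  have hstart : P (⌊β⌋₊ + 1) := by
    obtain ⟨D, hD0, hD⟩ := hbase (⌊β⌋₊ + 1)
    refine ⟨1 + D, by positivity, fun f hf hB h h0 => ?_⟩
    have hpos : 0 < ‖h‖ := norm_pos_iff.2 h0
    have hB0 : 0 ≤ (besovNorm β 3 f).toReal := ENNReal.toReal_nonneg
    -- Short steps use the Besov seminorm and γ ≤ β; long steps use only the L³ norm.
    rcases le_total ‖h‖ 1 with h1 | h1
    · have hsup : ENNReal.ofReal (‖h‖ ^ (-β)) * eLpNorm ((fwdDiff h)^[⌊β⌋₊ + 1] f) 3 torusMeasure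
          ≤ besovNorm β 3 f := by
        refine le_trans ?_ le_add_self
        exact le_iSup₂ (f := fun (h : E3) (_ : h ≠ 0) => ENNReal.ofReal (‖h‖ ^ (-β))
          * eLpNorm ((fwdDiff h)^[⌊β⌋₊ + 1] f) 3 torusMeasure) h h0
      have h₁ := ENNReal.toReal_mono hB hsup
      rw [ENNReal.toReal_mul, ENNReal.toReal_ofReal (by positivity), iterate_fwdDiff_eq] at h₁
      change ‖h‖ ^ (-β) * normL3 _ ≤ _ at h₁
      rw [Real.rpow_neg hpos.le, inv_mul_le_iff₀ (by positivity)] at h₁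
      refine h₁.trans ?_
      have h₂ : ‖h‖ ^ β ≤ ‖h‖ ^ γ := Real.rpow_le_rpow_of_exponent_ge hpos h1 hγβ
      calc ‖h‖ ^ β * (besovNorm β 3 f).toReal ≤ ‖h‖ ^ γ * (besovNorm β 3 f).toReal := by gcongr
        _ = 1 * (besovNorm β 3 f).toReal * ‖h‖ ^ γ := by ring
        _ ≤ _ := by gcongr; linarith
    · have h₁ : 1 ≤ ‖h‖ ^ γ := Real.one_le_rpow h1 hγ
      calc _ ≤ D * normL3 f := (hD h f hf).2
        _ ≤ D * (besovNorm β 3 f).toReal := by gcongr; exact hfB f hB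
        _ ≤ (1 + D) * (besovNorm β 3 f).toReal := by gcongr; linarith
        _ ≤ _ := le_mul_of_one_le_right (by positivity) h₁
  -- Marchaud's descent by one order; it stops at order one, where the doubling factor 2^(k+1) is
  -- still at least 2.
  have hstep : ∀ k : ℕ, P (k + 2) → P (k + 1) := by
    rintro k ⟨C, hC0, hC⟩
    obtain ⟨A, hA0, hA⟩ := hbase (k + 1)
    obtain ⟨Q, hQ⟩ := exists_doubling_polynomial (k + 1)
    obtain ⟨D, hD0, hD⟩ := aeval_shiftOp Q
    refine ⟨A + 2 * (D * C), by positivity, fun f hf hB => ?_⟩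
    set B := (besovNorm β 3 f).toReal
    have hB0 : 0 ≤ B := ENNReal.toReal_nonneg
    have h := doubling_real (a := fun h => normL3 (((shiftOp h - 1) ^ (k + 1)) f))
      (b := fun h => normL3 (((shiftOp h - 1) ^ (k + 2)) f)) (A := A * B) (D := D) (C := C * B)
      hγ hγ' (by positivity) hD0 (by positivity)
      (fun h => (hA h f hf).2.trans (by gcongr; exact hfB f hB))
      (fun h => by
        have e := congrArg (fun R => Polynomial.aeval (shiftOp h) R f) hQ
        simp only [map_mul, map_add, map_sub, map_pow, Polynomial.aeval_X, map_one, map_ofNat,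
          ← shiftOp_two, LinearMap.add_apply, Module.End.mul_apply] at e
        have e2 : ∀ g : E3 → ℝ, ((2 : Module.End ℝ (E3 → ℝ)) ^ (k + 1)) g
            = ((2 : ℝ) ^ (k + 1)) • g := fun g => by
          have : (2 : Module.End ℝ (E3 → ℝ)) = algebraMap ℝ _ 2 :=
            (map_ofNat (algebraMap ℝ (Module.End ℝ (E3 → ℝ))) 2).symm
          rw [this, ← map_pow, Module.algebraMap_end_apply]
        rw [e2] at e
        have hb := (hbase (k + 2)).choose_spec.2 h f hf
        have h₁ : (2 : ℝ) ^ (k + 1) * normL3 (((shiftOp h - 1) ^ (k + 1)) f)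
            ≤ normL3 (((shiftOp ((2 : ℝ) • h) - 1) ^ (k + 1)) f)
              + D * normL3 (((shiftOp h - 1) ^ (k + 2)) f) := by
          have h₂ := normL3_smul ((2 : ℝ) ^ (k + 1)) (((shiftOp h - 1) ^ (k + 1)) f)
          rw [abs_of_pos (by positivity)] at h₂
          rw [← h₂, e]
          exact (normL3_add_le (hA _ f hf).1 (hD h _ hb.1).1).trans
            (add_le_add le_rfl (hD h _ hb.1).2)
        have h₂ : (2 : ℝ) ≤ 2 ^ (k + 1) := by
          rw [pow_succ]
          linarith [one_le_pow₀ (M₀ := ℝ) (one_le_two) (n := k)]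
        exact (mul_le_mul_of_nonneg_right h₂ (normL3_nonneg _)).trans h₁)
      (fun h h0 => hC f hf hB h h0)
    intro h' h0
    refine (h h' h0).trans_eq ?_
    ring
  have hall : ∀ k : ℕ, P (k + 1) → P 1 := by
    intro k
    induction k with
    | zero => exact id
    | succ k ih => exact fun h => ih (hstep k h)
  obtain ⟨C, hC0, hC⟩ := hall _ hstart
  refine ⟨C, hC0, fun f hf hB h h0 => ?_⟩
  have e : fwdDiff h f = ((shiftOp h - 1 : Module.End ℝ (E3 → ℝ)) ^ 1) f := iterate_fwdDiff_eq h 1 f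
  rw [e]
  exact hC f hf hB h h0

/-! ### The averaged oscillation of functions with bounded Besov norm -/

theorem lintegral_enorm_sub_cube (f : E3 → ℝ) (y : E3) :
    ∫⁻ x, ‖f x - f (x - y)‖ₑ ^ (3 : ℝ) ∂torusMeasure
      = eLpNorm (fwdDiff (-y) f) 3 torusMeasure ^ (3 : ℝ) := by
  rw [eLpNorm_eq_lintegral_rpow_enorm_toReal three_ne_zero ENNReal.ofNat_ne_top,
    ENNReal.toReal_ofNat, ← ENNReal.rpow_mul]
  norm_num
  refine lintegral_congr fun x => ?_
  rw [fwdDiff, ← enorm_neg, neg_sub, sub_eq_add_neg x y]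

/-- Exchanging the average in `y` with the integral in `x` leaves an average of cubed L³ norms of
first differences. -/
theorem lintegral_osc_le {f : E3 → ℝ} (hf : Measurable f) {ε : ℝ} (hε : 0 < ε) {K : ℝ≥0∞}
    (hK : ∀ y ∈ Metric.ball (0 : E3) ε, eLpNorm (fwdDiff (-y) f) 3 torusMeasure ≤ K) :
    ∫⁻ x, osc ε f x ∂torusMeasure ≤ K ^ (3 : ℝ) := by
  have hm : Measurable fun q : E3 × E3 => ‖f q.1 - f (q.1 - q.2)‖ₑ ^ (3 : ℝ) :=
    ((hf.comp measurable_fst).sub (hf.comp (measurable_fst.sub measurable_snd))).enorm.pow_const _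
  have hpos : volume (Metric.ball (0 : E3) ε) ≠ 0 := (Metric.measure_ball_pos _ _ hε).ne'
  have hfin : volume (Metric.ball (0 : E3) ε) ≠ ⊤ := measure_ball_lt_top.ne
  simp only [osc, setLAverage_eq, div_eq_mul_inv]
  rw [lintegral_mul_const _ hm.lintegral_prod_right', lintegral_lintegral_swap hm.aemeasurable,
    ← div_eq_mul_inv]
  refine ENNReal.div_le_of_le_mul ?_
  rw [← setLIntegral_const]
  refine setLIntegral_mono measurable_const fun y hy => ?_
  rw [lintegral_enorm_sub_cube]
  gcongr
  exact hK y hy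

/-- Functions in `L³(0,T; B^β_{3,∞})` have averaged oscillation `O(ε^γ)` for `γ ≤ min β (1/3)`. -/
theorem exists_meanOscillation_le {β γ : ℝ} (hγ : 0 ≤ γ) (hγ' : γ ≤ 1 / 3) (hγβ : γ ≤ β) {T : ℝ}
    {f : ℝ → E3 → ℝ} (hf : ∀ t, TorusMem 3 (f t))
    (hB : ∫⁻ t in Ioo 0 T, besovNorm β 3 (f t) ^ (3 : ℝ) < ⊤) :
    ∃ B : ℝ≥0∞, B ≠ ⊤ ∧
      ∀ ε : ℝ, 0 < ε → ENNReal.ofReal (ε ^ (-γ)) * meanOscillation T 3 3 f ε ≤ B := by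
  obtain ⟨C, hC0, hC⟩ := exists_normL3_fwdDiff_le hγ hγ' hγβ
  set J := ∫⁻ t in Ioo 0 T, besovNorm β 3 (f t) ^ (3 : ℝ)
  refine ⟨ENNReal.ofReal (C + 1) * J ^ (1 / 3 : ℝ), ENNReal.mul_ne_top ENNReal.ofReal_ne_top
    (ENNReal.rpow_ne_top_of_nonneg (by norm_num) hB.ne), fun ε hε => ?_⟩
  -- `C + 1` instead of `C` keeps `D` positive, so that the slice bound is trivially true at times
  -- of infinite Besov norm.
  set D : ℝ≥0∞ := ENNReal.ofReal ((C + 1) * ε ^ γ) with hD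
  have hslice : ∀ t, ∫⁻ x, osc ε (f t) x ∂torusMeasure ≤ (D * besovNorm β 3 (f t)) ^ (3 : ℝ) := by
    intro t
    refine lintegral_osc_le (hf t).measurable hε fun y hy => ?_
    rcases eq_or_ne y 0 with rfl | hy0
    · have : fwdDiff (-0) (f t) = 0 := by
        funext x
        simp [fwdDiff]
      rw [this, eLpNorm_zero]
      exact bot_le
    by_cases htop : besovNorm β 3 (f t) = ⊤
    · rw [htop, ENNReal.mul_top (ENNReal.ofReal_pos.2 (by positivity)).ne']
      exact le_top
    have h := hC (f t) (hf t) htop (-y) (neg_ne_zero.2 hy0)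
    have hy' : ‖y‖ ≤ ε := (mem_ball_zero_iff.1 hy).le
    have hmem : eLpNorm (fwdDiff (-y) (f t)) 3 torusMeasure ≠ ⊤ := by
      have h₁ : MemLp (fun x => f t (x + -y)) 3 torusMeasure :=
        ⟨((hf t).measurable.comp (measurable_add_const _)).aestronglyMeasurable, by
          rw [eLpNorm_shift (hf t).periodic three_ne_zero ENNReal.ofNat_ne_top]
          exact (hf t).memLp.2⟩
      exact (h₁.sub (hf t).memLp).2.ne
    rw [← ENNReal.ofReal_toReal hmem, ← ENNReal.ofReal_toReal htop, hD,
      ← ENNReal.ofReal_mul (by positivity)]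
    refine ENNReal.ofReal_le_ofReal (h.trans ?_)
    rw [norm_neg, mul_right_comm]
    gcongr
    linarith
  have hm : meanOscillation T 3 3 f ε ≤ D * J ^ (1 / 3 : ℝ) := by
    rw [meanOscillation_eq]
    calc _ ≤ (∫⁻ t in Ioo 0 T, D ^ (3 : ℝ) * besovNorm β 3 (f t) ^ (3 : ℝ)) ^ (1 / 3 : ℝ) := by
          gcongr with t
          exact (hslice t).trans_eq (ENNReal.mul_rpow_of_nonneg _ _ (by norm_num))
      _ = (D ^ (3 : ℝ) * J) ^ (1 / 3 : ℝ) := by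
          rw [lintegral_const_mul' _ _ (ENNReal.rpow_ne_top_of_nonneg (by norm_num)
            ENNReal.ofReal_ne_top)]
      _ = D * J ^ (1 / 3 : ℝ) := by
          rw [ENNReal.mul_rpow_of_nonneg _ _ (by norm_num), ← ENNReal.rpow_mul]
          norm_num
  calc _ ≤ ENNReal.ofReal (ε ^ (-γ)) * (D * J ^ (1 / 3 : ℝ)) := by gcongr
    _ = _ := by
      rw [hD, ← mul_assoc, ← ENNReal.ofReal_mul (by positivity)]
      congr 2
      rw [mul_comm, mul_assoc, ← Real.rpow_add hε, add_neg_cancel, Real.rpow_zero, mul_one]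

/-! ### The momentum equation integrated in time -/

/-- The du Bois-Reymond lemma with initial value. For χ compactly supported in (0,T), the primitive
that vanishes at T is an admissible θ with θ(0) = -∫ χ, so testing with it recovers `g₀` as well. -/
theorem ae_eq_integral_of_weak_deriv {T : ℝ} (hT : 0 < T) {G H : ℝ → ℝ} {g₀ : ℝ}
    (hG : IntegrableOn G (Ioo 0 T)) (hH : IntegrableOn H (Ioo 0 T))
    (h : ∀ θ : ℝ → ℝ, ContDiff ℝ ∞ θ → (∃ T' < T, ∀ t, T' ≤ t → θ t = 0) →
      (∫ t in Ioo 0 T, (deriv θ t * G t + θ t * H t)) + θ 0 * g₀ = 0) :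
    ∀ᵐ t ∂volume.restrict (Ioo 0 T), G t = g₀ + ∫ s in (0 : ℝ)..t, H s := by
  have hHi : IntervalIntegrable H volume 0 T :=
    (intervalIntegrable_iff_integrableOn_Ioo_of_le hT.le).2 hH
  set F : ℝ → ℝ := fun r => ∫ s in (0 : ℝ)..r, H s with hF
  have hFac : AbsolutelyContinuousOnInterval F 0 T :=
    hHi.absolutelyContinuousOnInterval_intervalIntegral left_mem_uIcc
  have hFd : ∀ᵐ x ∂volume.restrict (uIoc 0 T), deriv F x = H x := by
    rw [ae_restrict_iff' measurableSet_uIoc]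
    filter_upwards [hHi.ae_hasDerivAt_integral] with x hx hx'
    exact (hx (uIoc_subset_uIcc hx') 0 left_mem_uIcc).deriv
  have hFi : IntegrableOn F (Ioo 0 T) := by
    have : IntervalIntegrable F volume 0 T := hFac.continuousOn.intervalIntegrable
    exact (intervalIntegrable_iff_integrableOn_Ioo_of_le hT.le).1 this
  have hci : IntegrableOn (fun _ : ℝ => g₀) (Ioo 0 T) := integrableOn_const measure_Ioo_lt_top.ne
  have hint : IntegrableOn (fun t => G t - (g₀ + F t)) (Ioo 0 T) := hG.sub (hci.add hFi)
  have key := isOpen_Ioo.ae_eq_zero_of_integral_contDiff_smul_eq_zero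
    hint.locallyIntegrableOn (fun χ hχ hcs hsub => by
      -- `T'` is the last point of the support; the point 0 is adjoined to cover an empty support.
      obtain ⟨T', hT'mem, hT'⟩ := (hcs.isCompact.insert 0).exists_isGreatest ⟨0, by simp⟩
      have hT'T : T' < T := by
        rcases hT'mem with rfl | hm
        · exact hT
        · exact (hsub hm).2
      have hχ0 : ∀ t, T' < t → χ t = 0 := fun t ht => by
        by_contra hne
        exact absurd (hT' (mem_insert_of_mem _ (subset_tsupport _ hne))) (not_le.2 ht)
      have hχc := hχ.continuous
      have hχi : ∀ a b, IntervalIntegrable χ volume a b := fun a b => hχc.intervalIntegrable a b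
      set θ : ℝ → ℝ := fun t => ∫ s in T..t, χ s with hθ
      have hd : ∀ t, HasDerivAt θ (χ t) t := fun t =>
        intervalIntegral.integral_hasDerivAt_right (hχi T t)
          (hχc.stronglyMeasurableAtFilter _ _) hχc.continuousAt
      have hdθ : deriv θ = χ := funext fun t => (hd t).deriv
      have hθs : ContDiff ℝ ∞ θ :=
        contDiff_infty_iff_deriv.2 ⟨fun t => (hd t).differentiableAt, hdθ ▸ hχ⟩
      have hθ0 : ∀ t, T' ≤ t → θ t = 0 := fun t ht => by
        refine intervalIntegral.integral_zero_ae (ae_of_all _ fun s hs => hχ0 s ?_)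
        exact lt_of_le_of_lt (le_min hT'T.le ht) hs.1
      have h₁ := h θ hθs ⟨T', hT'T, hθ0⟩
      have hθac : AbsolutelyContinuousOnInterval θ 0 T :=
        (hχi 0 T).absolutelyContinuousOnInterval_intervalIntegral right_mem_uIcc
      have h₂ := hθac.integral_mul_deriv_eq_deriv_mul hFac
      have hθT : θ T = 0 := hθ0 T hT'T.le
      have hF0 : F 0 = 0 := intervalIntegral.integral_same
      have h₃ : ∫ x in (0 : ℝ)..T, θ x * deriv F x = ∫ x in (0 : ℝ)..T, θ x * H x :=
        intervalIntegral.integral_congr_ae_restrict (hFd.mono fun x hx => by simp only [hx])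
      rw [hθT, hF0, h₃, hdθ, intervalIntegral.integral_of_le hT.le,
        intervalIntegral.integral_of_le hT.le, integral_Ioc_eq_integral_Ioo,
        integral_Ioc_eq_integral_Ioo] at h₂
      obtain ⟨M, hM⟩ := hcs.exists_bound_of_continuous hχc
      have hχm : ∀ {k : ℝ → ℝ}, IntegrableOn k (Ioo 0 T) →
          IntegrableOn (fun t => χ t * k t) (Ioo 0 T) := fun hk =>
        hk.bdd_mul hχc.aestronglyMeasurable (ae_of_all _ hM)
      have hθH : IntegrableOn (fun t => θ t * H t) (Ioo 0 T) :=
        (intervalIntegrable_iff_integrableOn_Ioo_of_le hT.le).1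
          (hHi.continuousOn_mul hθac.continuousOn)
      have hθ00 : θ 0 = -∫ t in Ioo 0 T, χ t := by
        rw [hθ]
        simp only
        rw [intervalIntegral.integral_symm, intervalIntegral.integral_of_le hT.le,
          integral_Ioc_eq_integral_Ioo]
      rw [hdθ, integral_add (hχm hG) hθH, h₂, hθ00] at h₁
      have hsupp : ∫ t, χ t • (G t - (g₀ + F t)) = ∫ t in Ioo 0 T, χ t * (G t - (g₀ + F t)) := by
        rw [← setIntegral_eq_integral_of_forall_compl_eq_zero (s := Ioo 0 T)]
        · rfl
        · intro t ht
          rw [image_eq_zero_of_notMem_tsupport fun h' => ht (hsub h'), zero_smul]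
      rw [hsupp]
      have hexp : ∫ t in Ioo 0 T, χ t * (G t - (g₀ + F t)) = (∫ t in Ioo 0 T, χ t * G t)
          - ((∫ t in Ioo 0 T, χ t * g₀) + ∫ t in Ioo 0 T, χ t * F t) := by
        have hs : IntegrableOn (fun t => χ t * g₀ + χ t * F t) (Ioo 0 T) :=
          (hχm hci).add (hχm hFi)
        rw [← integral_add (hχm hci) (hχm hFi), ← integral_sub (hχm hG) hs]
        exact integral_congr_ae (ae_of_all _ fun t => by ring)
      rw [hexp, integral_mul_const]
      linarith)
  rw [ae_restrict_iff' measurableSet_Ioo]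
  filter_upwards [key] with t ht hmem
  linarith [ht hmem]

theorem IsSpaceTest.isTestField {w : E3 → E3} (hw : IsSpaceTest w) {T : ℝ} {θ : ℝ → ℝ}
    (hθ : ContDiff ℝ ∞ θ) (h0 : ∃ T' < T, ∀ t, T' ≤ t → θ t = 0) :
    IsTestField T fun t x => θ t • w x := by
  have hd := hw.smooth.differentiable (by norm_num)
  refine ⟨(hθ.comp contDiff_fst).smul (hw.smooth.comp contDiff_snd),
    fun t => hw.periodic.comp_left fun y => θ t • y, fun t x => ?_, ?_⟩
  · have h := hw.div_free x
    simp only [divergence] at h ⊢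
    rw [fderiv_fun_const_smul (hd x)]
    simp only [_root_.smul_apply, PiLp.smul_apply, smul_eq_mul]
    rw [← Finset.mul_sum, h, mul_zero]
  · obtain ⟨T', hT', h⟩ := h0
    exact ⟨T', hT', fun t ht x => by rw [h t ht, zero_smul]⟩

/-! ### From the weak formulation to the momentum equation at almost every time -/

namespace RegularField

variable {T : ℝ} {u : ℝ → E3 → E3}

theorem integrable_slice_cubic (hu : RegularField T u) {w : E3 → E3} (hw : IsSpaceTest w) :
    ∃ C : ℝ, 0 ≤ C ∧ ∀ t, Integrable (fun x => inner ℝ (u t x) (fderiv ℝ w x (u t x))) torusMeasure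
      ∧ ‖∫ x, inner ℝ (u t x) (fderiv ℝ w x (u t x)) ∂torusMeasure‖
        ≤ C * (∫⁻ x, ‖u t x‖ₑ ^ (2 : ℝ) ∂torusMeasure).toReal := by
  have hc : Continuous fun x => fderiv ℝ w x :=
    (hw.smooth.fderiv_right (m := ∞) (by norm_num)).continuous
  obtain ⟨C, hC⟩ := exists_bound_of_periodic hw.periodic.fderiv hc
  have hC0 : 0 ≤ C := (norm_nonneg _).trans (hC 0)
  refine ⟨C, hC0, fun t => ?_⟩
  have h2 := (hu.torusMem t).mono (q := 2) (by norm_num)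
  have hle : ∀ x, ‖inner ℝ (u t x) (fderiv ℝ w x (u t x))‖ ≤ C * ‖u t x‖ ^ 2 := fun x => by
    calc _ ≤ ‖u t x‖ * ‖fderiv ℝ w x (u t x)‖ := norm_inner_le_norm _ _
      _ ≤ ‖u t x‖ * (C * ‖u t x‖) := by
        gcongr
        exact (ContinuousLinearMap.le_opNorm _ _).trans (by gcongr; exact hC x)
      _ = _ := by ring
  have hsq : Integrable (fun x => C * ‖u t x‖ ^ 2) torusMeasure :=
    (h2.memLp.integrable_norm_pow two_ne_zero).const_mul C
  have hm : AEStronglyMeasurable (fun x => inner ℝ (u t x) (fderiv ℝ w x (u t x))) torusMeasure := by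
    refine Measurable.aestronglyMeasurable ?_
    have hcc : Continuous fun q : E3 × E3 => inner ℝ q.2 (fderiv ℝ w q.1 q.2) :=
      continuous_snd.inner ((hc.comp continuous_fst).clm_apply continuous_snd)
    exact hcc.measurable.comp (measurable_id.prodMk h2.measurable)
  refine ⟨hsq.mono' hm (ae_of_all _ hle), ?_⟩
  rw [← hu.integral_norm_sq_eq, ← integral_const_mul]
  exact norm_integral_le_of_norm_le hsq (ae_of_all _ hle)

theorem integrable_slice_inner (hu : RegularField T u) {w : E3 → E3} (hw : IsSpaceTest w) :
    ∃ C : ℝ, 0 ≤ C ∧ ∀ t, Integrable (fun x => inner ℝ (u t x) (w x)) torusMeasure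
      ∧ ‖∫ x, inner ℝ (u t x) (w x) ∂torusMeasure‖
        ≤ C * (1 + (∫⁻ x, ‖u t x‖ₑ ^ (2 : ℝ) ∂torusMeasure).toReal) := by
  obtain ⟨C, hC⟩ := exists_bound_of_periodic hw.periodic hw.smooth.continuous
  have hC0 : 0 ≤ C := (norm_nonneg _).trans (hC 0)
  refine ⟨C, hC0, fun t => ?_⟩
  have h2 := (hu.torusMem t).mono (q := 2) (by norm_num)
  have hle : ∀ x, ‖inner ℝ (u t x) (w x)‖ ≤ C * (1 + ‖u t x‖ ^ 2) := fun x => by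
    calc _ ≤ ‖u t x‖ * ‖w x‖ := norm_inner_le_norm _ _
      _ ≤ (1 + ‖u t x‖ ^ 2) * C := by
        gcongr
        · nlinarith [sq_nonneg (‖u t x‖ - 1)]
        · exact hC x
      _ = _ := mul_comm _ _
  have hsq₀ := h2.memLp.integrable_norm_pow two_ne_zero
  have hsq : Integrable (fun x => C * (1 + ‖u t x‖ ^ 2)) torusMeasure :=
    ((integrable_const 1).add hsq₀).const_mul C
  have hm : AEStronglyMeasurable (fun x => inner ℝ (u t x) (w x)) torusMeasure :=
    (h2.measurable.inner hw.smooth.continuous.measurable).aestronglyMeasurable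
  refine ⟨hsq.mono' hm (ae_of_all _ hle), ?_⟩
  rw [← hu.integral_norm_sq_eq]
  refine (norm_integral_le_of_norm_le hsq (ae_of_all _ hle)).trans_eq ?_
  rw [integral_const_mul, integral_add (integrable_const 1) hsq₀]
  simp

theorem integrableOn_cubic (hu : RegularField T u) {w : E3 → E3} (hw : IsSpaceTest w) :
    IntegrableOn (fun t => ∫ x, inner ℝ (u t x) (fderiv ℝ w x (u t x)) ∂torusMeasure)
      (Ioo 0 T) := by
  obtain ⟨C, -, hC⟩ := hu.integrable_slice_cubic hw
  exact (hu.integrable_sq.const_mul C).mono'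
    (hu.stronglyMeasurable_momentum hw.smooth).aestronglyMeasurable (ae_of_all _ fun t => (hC t).2)

theorem integrableOn_inner (hu : RegularField T u) {w : E3 → E3} (hw : IsSpaceTest w) :
    IntegrableOn (fun t => ∫ x, inner ℝ (u t x) (w x) ∂torusMeasure) (Ioo 0 T) := by
  obtain ⟨C, -, hC⟩ := hu.integrable_slice_inner hw
  have hm : StronglyMeasurable fun t => ∫ x, inner ℝ (u t x) (w x) ∂torusMeasure :=
    StronglyMeasurable.integral_prod_right (f := fun t x => inner ℝ (u t x) (w x))
      (hu.measurable.inner (hw.smooth.continuous.measurable.comp measurable_snd)).stronglyMeasurable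
  have hone : Integrable (fun _ : ℝ => (1 : ℝ)) (volume.restrict (Ioo 0 T)) := integrable_const 1
  exact ((hone.add hu.integrable_sq).const_mul C).mono' hm.aestronglyMeasurable
    (ae_of_all _ fun t => (hC t).2)

/-- A regular field that satisfies the weak momentum equation satisfies the equation integrated in
time, at almost every time. -/
theorem ae_momentumAt (hT : 0 < T) (hu : RegularField T u) {u₀ : E3 → E3}
    (hmom : ∀ ψ : ℝ → E3 → E3, IsTestField T ψ →
      (∫ t in Ioo 0 T, ∫ x, (inner ℝ (u t x) (deriv (fun s => ψ s x) t)
          + inner ℝ (u t x) (fderiv ℝ (ψ t) x (u t x))) ∂torusMeasure)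
        + ∫ x, inner ℝ (u₀ x) (ψ 0 x) ∂torusMeasure = 0) {w : E3 → E3} (hw : IsSpaceTest w) :
    ∀ᵐ t ∂volume.restrict (Ioo 0 T), MomentumAt u u₀ w (u t) t := by
  refine ae_eq_integral_of_weak_deriv hT (hu.integrableOn_inner hw) (hu.integrableOn_cubic hw)
    fun θ hθ h0 => ?_
  have h := hmom _ (hw.isTestField hθ h0)
  obtain ⟨C₁, -, hI₁⟩ := hu.integrable_slice_inner hw
  obtain ⟨C₂, -, hI₂⟩ := hu.integrable_slice_cubic hw
  have hd : Differentiable ℝ w := hw.smooth.differentiable (by norm_num)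
  have hθd : Differentiable ℝ θ := hθ.differentiable (by norm_num)
  refine Eq.trans ?_ h
  congr 1
  · refine integral_congr_ae (ae_of_all _ fun t => ?_)
    have e₁ : ∀ x, deriv (fun s => θ s • w x) t = deriv θ t • w x := fun x =>
      deriv_smul_const (hθd t) (w x)
    have e₂ : ∀ x, fderiv ℝ (fun x => θ t • w x) x = θ t • fderiv ℝ w x := fun x =>
      fderiv_fun_const_smul (hd x) _
    simp only [e₁, e₂, _root_.smul_apply, inner_smul_right]
    rw [integral_add ((hI₁ t).1.const_mul _) ((hI₂ t).1.const_mul _), integral_const_mul,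
      integral_const_mul]
  · simp only [inner_smul_right, integral_const_mul]

end RegularField

/-! ### Regular representatives -/

theorem IsWeaklyDivFree.congr_ae {v w : E3 → E3} (hv : IsWeaklyDivFree v)
    (h : v =ᵐ[torusMeasure] w) : IsWeaklyDivFree w := fun φ hφ hp => by
  rw [← hv φ hφ hp]
  exact integral_congr_ae (h.mono fun x hx => by simp only [hx])

theorem kineticEnergy_congr_ae {v w : E3 → E3} (h : v =ᵐ[torusMeasure] w) :
    kineticEnergy v = kineticEnergy w := by
  rw [kineticEnergy, kineticEnergy]
  congr 1
  exact lintegral_congr_ae (h.mono fun x hx => by simp only [hx])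

/-- Equality almost everywhere is taken on all of ℝ³, since differences reach outside the cell;
translations preserve null sets. -/
theorem fwdDiff_iterate_congr_ae {f g : E3 → ℝ} (h : f =ᵐ[volume] g) (a : E3) (k : ℕ) :
    (fwdDiff a)^[k] f =ᵐ[volume] (fwdDiff a)^[k] g := by
  induction k with
  | zero => exact h
  | succ k ih =>
    rw [Function.iterate_succ_apply', Function.iterate_succ_apply']
    filter_upwards [ih, (measurePreserving_add_right volume a).quasiMeasurePreserving.ae ih]
      with x h₁ h₂
    rw [fwdDiff, fwdDiff, h₁, h₂]

theorem besovNorm_congr_ae {f g : E3 → ℝ} (h : f =ᵐ[volume] g) (β : ℝ) (q : ℝ≥0) :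
    besovNorm β q f = besovNorm β q g := by
  have hk : ∀ a k, eLpNorm ((fwdDiff a)^[k] f) q torusMeasure
      = eLpNorm ((fwdDiff a)^[k] g) q torusMeasure := fun a k =>
    eLpNorm_congr_ae (ae_torus_of_ae_volume (fwdDiff_iterate_congr_ae h a k))
  simp only [besovNorm, hk, eLpNorm_congr_ae (ae_torus_of_ae_volume h)]

theorem lintegral_osc_congr_ae {f g : E3 → ℝ} (h : f =ᵐ[volume] g) (ε : ℝ) :
    ∫⁻ x, osc ε f x ∂torusMeasure = ∫⁻ x, osc ε g x ∂torusMeasure := by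
  refine lintegral_congr_ae ?_
  filter_upwards [ae_torus_of_ae_volume h] with x hx
  refine laverage_congr (ae_restrict_of_ae ?_)
  filter_upwards [(Measure.measurePreserving_sub_left volume x).quasiMeasurePreserving.ae h]
    with y hy
  simp only [hx, hy]

theorem meanOscillation_congr_ae {T : ℝ} {f g : ℝ → E3 → ℝ}
    (h : ∀ᵐ t ∂volume.restrict (Ioo 0 T), f t =ᵐ[volume] g t) (ε : ℝ) :
    meanOscillation T 3 3 f ε = meanOscillation T 3 3 g ε := by
  rw [meanOscillation_eq, meanOscillation_eq]
  congr 1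
  exact lintegral_congr_ae (h.mono fun t ht => lintegral_osc_congr_ae ht ε)

/-- The norm is at most the sum of the three components, and the power mean inequality costs 3² = 9.
-/
theorem enorm_cube_le (v : E3) : ‖v‖ₑ ^ (3 : ℝ) ≤ 9 * ∑ i, ‖v i‖ₑ ^ (3 : ℝ) := by
  have h₁ : ‖v‖ ≤ ∑ i, ‖v i‖ := by
    have : v = ∑ i, (v i) • EuclideanSpace.single i (1 : ℝ) := by
      ext j
      simp [Finset.sum_apply, Pi.single_apply]
    calc ‖v‖ = ‖∑ i, (v i) • EuclideanSpace.single i (1 : ℝ)‖ := by rw [← this]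
      _ ≤ ∑ i, ‖(v i) • EuclideanSpace.single i (1 : ℝ)‖ := norm_sum_le _ _
      _ = _ := by simp [norm_smul]
  have h₂ : ‖v‖ₑ ≤ ∑ i, ‖v i‖ₑ := by
    simp only [← ofReal_norm]
    rw [← ENNReal.ofReal_sum_of_nonneg fun i _ => norm_nonneg _]
    exact ENNReal.ofReal_le_ofReal h₁
  calc ‖v‖ₑ ^ (3 : ℝ) ≤ (∑ i, ‖v i‖ₑ) ^ (3 : ℝ) := by gcongr
    _ ≤ _ := by
      have h := ENNReal.rpow_sum_le_const_mul_sum_rpow (s := Finset.univ)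
        (fun i => ‖v i‖ₑ) (p := 3) (by norm_num)
      norm_num at h ⊢
      exact h

/-- A field with components in `L³` that is weakly divergence free at almost every time agrees
with a regular field at almost every time. -/
theorem exists_regularField {T : ℝ} {u : ℝ → E3 → E3} (hp : ∀ t ∈ Icc 0 T, IsPeriodic (u t))
    (hm : AEStronglyMeasurable (Function.uncurry u) (spaceTimeMeasure T))
    (hd : ∀ᵐ t ∂volume.restrict (Ioo 0 T), IsWeaklyDivFree (u t))
    (h3 : ∀ i, ∫⁻ t in Ioo 0 T, eLpNorm (fun x => u t x i) 3 torusMeasure ^ (3 : ℝ) < ⊤) :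
    ∃ U : ℝ → E3 → E3, RegularField T U ∧
      ∀ᵐ t ∂volume.restrict (Ioo 0 T), U t =ᵐ[volume] u t := by
  -- A measurable representative is read on the cell and extended periodically.
  set g : ℝ → E3 → E3 := fun t x => hm.mk _ (t, ZSpan.fract stdBasis x) with hg
  have hgm : Measurable (Function.uncurry g) :=
    hm.stronglyMeasurable_mk.measurable.comp
      (measurable_fst.prodMk (measurable_fract.comp measurable_snd))
  have hgp : ∀ t, IsPeriodic (g t) := fun t =>
    isPeriodic_comp_fract fun x => hm.mk _ (t, x)
  have hgu : ∀ᵐ t ∂volume.restrict (Ioo 0 T), g t =ᵐ[torusMeasure] u t := by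
    filter_upwards [Measure.ae_ae_of_ae_prod hm.ae_eq_mk] with t ht
    filter_upwards [ht, ae_restrict_mem measurableSet_cell] with x hx hx'
    rw [hg]
    simp only
    rw [fract_of_mem_cell hx', ← hx]
    rfl
  set N : ℝ → ℝ≥0∞ := fun t => ∫⁻ x, ‖g t x‖ₑ ^ (3 : ℝ) ∂torusMeasure with hN
  have hNm : Measurable N := Measurable.lintegral_prod_right'
    (f := fun q : ℝ × E3 => ‖g q.1 q.2‖ₑ ^ (3 : ℝ)) (hgm.enorm.pow_const 3)
  have hcoord : ∀ t i, Measurable fun x => ‖g t x i‖ₑ ^ (3 : ℝ) := fun t i =>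
    ((by fun_prop : Measurable fun y : E3 => y i).comp
      (hgm.comp (measurable_const.prodMk measurable_id))).enorm.pow_const 3
  have hcoord' : ∀ i, Measurable fun t => ∫⁻ x, ‖g t x i‖ₑ ^ (3 : ℝ) ∂torusMeasure := fun i =>
    Measurable.lintegral_prod_right' (f := fun q : ℝ × E3 => ‖g q.1 q.2 i‖ₑ ^ (3 : ℝ))
      (((by fun_prop : Measurable fun y : E3 => y i).comp hgm).enorm.pow_const 3)
  have hNfin : ∫⁻ t in Ioo 0 T, N t < ⊤ := by
    calc ∫⁻ t in Ioo 0 T, N t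
        ≤ ∫⁻ t in Ioo 0 T, 9 * ∑ i, ∫⁻ x, ‖g t x i‖ₑ ^ (3 : ℝ) ∂torusMeasure := by
          refine lintegral_mono fun t => ?_
          rw [← lintegral_finsetSum _ fun i _ => hcoord t i,
            ← lintegral_const_mul _ (Finset.measurable_fun_sum _ fun i _ => hcoord t i)]
          exact lintegral_mono fun x => enorm_cube_le _
      _ = 9 * ∑ i, ∫⁻ t in Ioo 0 T, ∫⁻ x, ‖g t x i‖ₑ ^ (3 : ℝ) ∂torusMeasure := by
          rw [lintegral_const_mul _ (Finset.measurable_fun_sum _ fun i _ => hcoord' i),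
            lintegral_finsetSum _ fun i _ => hcoord' i]
      _ < ⊤ := by
          refine ENNReal.mul_lt_top (by norm_num) (ENNReal.sum_lt_top.2 fun i _ => ?_)
          refine lt_of_le_of_lt (le_of_eq ?_) (h3 i)
          refine lintegral_congr_ae (hgu.mono fun t ht => ?_)
          simp only
          rw [eLpNorm_eq_lintegral_rpow_enorm_toReal three_ne_zero ENNReal.ofNat_ne_top,
            ENNReal.toReal_ofNat, ← ENNReal.rpow_mul, one_div_mul_cancel three_ne_zero,
            ENNReal.rpow_one]
          exact lintegral_congr_ae (ht.mono fun x hx => by simp only [hx])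
  -- A measurable set of good times of full measure; off it the field is set to zero, so that every
  -- slice is regular.
  obtain ⟨S, hS, hSm, hSp⟩ := ((hgu.and hd).and
    ((ae_lt_top hNm hNfin.ne).and (ae_restrict_mem measurableSet_Ioo))).exists_measurable_mem
  classical
  refine ⟨fun t x => if t ∈ S then g t x else 0, ⟨?_, fun t => ?_, fun t => ?_, ?_⟩, ?_⟩
  · exact Measurable.ite (measurable_fst hSm) hgm measurable_const
  · by_cases ht : t ∈ S
    · simp only [ht, if_true]
      have hgt : Measurable (g t) := hgm.comp (measurable_const.prodMk measurable_id)
      refine ⟨hgt, hgp t, hgt.aestronglyMeasurable, ?_⟩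
      rw [eLpNorm_lt_top_iff_lintegral_rpow_enorm_lt_top three_ne_zero ENNReal.ofNat_ne_top,
        ENNReal.toReal_ofNat]
      exact (hSp t ht).2.1
    · simp only [ht, if_false]
      exact .of_continuous (fun _ _ => rfl) continuous_const
  · by_cases ht : t ∈ S
    · simp only [ht, if_true]
      exact (hSp t ht).1.2.congr_ae (hSp t ht).1.1.symm
    · simp only [ht, if_false]
      intro φ _ _
      simp
  · refine lt_of_le_of_lt (lintegral_mono fun t => lintegral_mono fun x => ?_) hNfin
    split_ifs
    · exact le_rfl
    · simp
  · filter_upwards [hS] with t ht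
    have ht' : t ∈ Icc 0 T := Ioo_subset_Icc_self (hSp t ht).2.2
    simp only [ht, if_true]
    -- Both fields are periodic, so equality on the cell spreads to the whole space.
    exact ae_volume_of_ae_torus ((hgp t).comp₂ (hp t ht') Eq) (hSp t ht).1.1

/-! ### Conservation of energy -/

theorem MomentumAt.congr_ae {u : ℝ → E3 → E3} {u₀ w v v' : E3 → E3} {t : ℝ}
    (hm : MomentumAt u u₀ w v t) (h : v =ᵐ[torusMeasure] v') : MomentumAt u u₀ w v' t := by
  refine Eq.trans ?_ hm
  exact integral_congr_ae (h.mono fun x hx => by simp only [hx])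

theorem enorm_intervalIntegral_le {k : ℝ → ℝ} {t T : ℝ} (ht : t ∈ Icc 0 T) :
    ‖∫ r in (0 : ℝ)..t, k r‖ₑ ≤ ∫⁻ r in Ioo 0 T, ‖k r‖ₑ := by
  rw [intervalIntegral.integral_of_le ht.1]
  exact (enorm_integral_le_lintegral_enorm _).trans
    (lintegral_mono' (restrict_Ioc_le_restrict_Ioo ht.2) le_rfl)

theorem integral_norm_sq_eq_toReal {v : E3 → E3} (hv : TorusMem 2 v) :
    ∫ x, ‖v x‖ ^ 2 ∂torusMeasure = (∫⁻ x, ‖v x‖ₑ ^ 2 ∂torusMeasure).toReal := by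
  rw [integral_eq_lintegral_of_nonneg_ae (ae_of_all _ fun x => sq_nonneg _)
    (hv.measurable.norm.pow_const 2).aestronglyMeasurable]
  congr 2
  funext x
  rw [← ofReal_norm, ENNReal.ofReal_pow (norm_nonneg _)]

theorem lintegral_enorm_sq_ne_top {v : E3 → E3} (hv : TorusMem 2 v) :
    ∫⁻ x, ‖v x‖ₑ ^ 2 ∂torusMeasure ≠ ⊤ := by
  have := lintegral_rpow_enorm_lt_top_of_eLpNorm_lt_top two_ne_zero ENNReal.ofNat_ne_top hv.memLp.2
  simpa using this.ne

/-- If the mixed oscillations of a regular solution are `o(ε)`, then its energy is the initial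
energy at every time at which the momentum equation holds for countably many test fields. -/
theorem exists_countable_energy_eq {T : ℝ} {u : ℝ → E3 → E3} {u₀ : E3 → E3}
    (hu : RegularField T u) (hu₀ : TorusMem 2 u₀) (hd₀ : IsWeaklyDivFree u₀)
    (hmom : ∀ w, IsSpaceTest w → ∀ᵐ t ∂volume.restrict (Ioo 0 T), MomentumAt u u₀ w (u t) t)
    (hosc : ∀ C : ℝ, 0 ≤ C → Tendsto (fun ε : ℝ => ENNReal.ofReal (C / ε)
      * ∫⁻ t in Ioo 0 T, ∫⁻ x, mixedOsc ε (u t) x ∂torusMeasure) (𝓝[>] 0) (𝓝 0)) :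
    ∃ W : Set (E3 → E3), W.Countable ∧ (∀ w ∈ W, IsSpaceTest w) ∧
      ∀ t ∈ Icc 0 T, ∀ v, TorusMem 2 v → IsWeaklyDivFree v → (∀ w ∈ W, MomentumAt u u₀ w v t) →
        kineticEnergy v = kineticEnergy u₀ := by
  -- The shift by 3 keeps every radius below 1/2.
  set ε : ℕ → ℝ := fun n => 1 / ((n : ℝ) + 3) with hεdef
  have hε : ∀ n, 0 < ε n := fun n => by positivity
  have hε' : ∀ n, ε n < 1 / 2 := fun n =>
    one_div_lt_one_div_of_lt two_pos (by linarith [(Nat.cast_nonneg n : (0 : ℝ) ≤ n)])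
  have hlim : Tendsto ε atTop (𝓝 0) := by
    have h : Tendsto (fun n : ℕ => (n : ℝ) + 3) atTop atTop :=
      tendsto_atTop_add_const_right _ _ tendsto_natCast_atTop_atTop
    exact h.inv_tendsto_atTop.congr fun n => (one_div _).symm
  have hlim' : Tendsto ε atTop (𝓝[>] 0) :=
    tendsto_nhdsWithin_iff.2 ⟨hlim, Eventually.of_forall hε⟩
  choose W hWc hWt hW using fun n => exists_countable_mollified_energy hu hu₀ hd₀ hmom
    (isKernel_mollifier (hε n) (hε' n)) (mollifier_comp_neg (hε n))
  obtain ⟨C, hC0, hC⟩ := exists_enorm_flux_le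
  refine ⟨⋃ n, W n, countable_iUnion hWc, fun w hw => ?_, fun t ht v hv hd hvW => ?_⟩
  · obtain ⟨n, hn⟩ := mem_iUnion.1 hw
    exact hWt n w hn
  set c : ℕ → ℝ := fun n => ∫ r in (0 : ℝ)..t, (∫ x, inner ℝ (conv (mollifier (hε n)) (u r) x)
    (stressField (mollifier (hε n)) (u r) x) ∂torusMeasure) with hc
  have hc0 : Tendsto c atTop (𝓝 0) := by
    rw [tendsto_zero_iff_enorm_tendsto_zero]
    refine tendsto_of_tendsto_of_tendsto_of_le_of_le tendsto_const_nhds ((hosc C hC0).comp hlim')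
      (fun _ => bot_le) fun n => (enorm_intervalIntegral_le ht).trans ?_
    simp only [Function.comp]
    rw [← lintegral_const_mul' _ _ ENNReal.ofReal_ne_top]
    exact lintegral_mono fun r => hC _ (hε n) (hε' n) _ ((hu.torusMem r).mono (by norm_num))
      (hu.div_free r)
  have hconv : ∀ {v : E3 → E3}, TorusMem 2 v →
      Tendsto (fun n => ∫ x, ‖conv (mollifier (hε n)) v x‖ ^ 2 ∂torusMeasure) atTop
        (𝓝 (∫⁻ x, ‖v x‖ₑ ^ 2 ∂torusMeasure).toReal) := fun {v} hv => by
    have hv1 : TorusMem 1 v := hv.mono (by norm_num)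
    have h := (ENNReal.tendsto_toReal (lintegral_enorm_sq_ne_top hv)).comp
      (tendsto_lintegral_conv_sq hv1 hε hε' hlim)
    refine h.congr fun n => ?_
    exact (integral_norm_sq_eq_toReal
      (torusMem_conv (isKernel_mollifier (hε n) (hε' n)) hv1 2)).symm
  have h₁ := hconv hv
  have h₂ := (hconv hu₀).add (hc0.const_mul 2)
  rw [mul_zero, add_zero] at h₂
  -- Both sides of the mollified balance converge, and the flux contributes nothing in the limit.
  have h₃ := tendsto_nhds_unique h₁ (h₂.congr fun n =>
    (hW n t ht v hv hd fun w hw => hvW w (mem_iUnion.2 ⟨n, hw⟩)).symm)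
  rw [kineticEnergy, kineticEnergy, (ENNReal.toReal_eq_toReal_iff'
    (lintegral_enorm_sq_ne_top hv) (lintegral_enorm_sq_ne_top hu₀)).1 h₃]

/-- A weakly continuous field that agrees at almost every time with a regular field satisfying the
momentum equation satisfies the latter at every time. -/
theorem WeaklyContinuousL2.momentumAt {T : ℝ} (hT : 0 < T) {u U : ℝ → E3 → E3} {u₀ w : E3 → E3}
    (hc : WeaklyContinuousL2 T u) (hU : RegularField T U) (hw : IsSpaceTest w)
    (hUu : ∀ᵐ t ∂volume.restrict (Ioo 0 T), U t =ᵐ[torusMeasure] u t)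
    (hmom : ∀ᵐ t ∂volume.restrict (Ioo 0 T), MomentumAt U u₀ w (U t) t) :
    ∀ t ∈ Icc 0 T, MomentumAt U u₀ w (u t) t := by
  have hint : IntegrableOn (fun t => ∫ x, inner ℝ (U t x) (fderiv ℝ w x (U t x)) ∂torusMeasure)
      (uIcc 0 T) := by
    rw [uIcc_of_le hT.le, integrableOn_Icc_iff_integrableOn_Ioo]
    exact hU.integrableOn_cubic hw
  -- Both sides are continuous on the closed interval and agree almost everywhere, hence everywhere,
  -- endpoints included.
  refine Measure.eqOn_Icc_of_ae_eq volume hT.ne ?_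
    (hc.2 w (memLp_of_periodic_continuous hw.periodic hw.smooth.continuous 2)) ?_
  · rw [← restrict_Ioo_eq_restrict_Icc]
    filter_upwards [hUu, hmom] with t h₁ h₂ using h₂.congr_ae h₁
  · have h := intervalIntegral.continuousOn_primitive_interval hint
    rw [uIcc_of_le hT.le] at h
    exact continuousOn_const.add h

/-- The pairing with a gradient is continuous in time and vanishes almost everywhere. -/
theorem WeaklyContinuousL2.isWeaklyDivFree {T : ℝ} (hT : 0 < T) {u : ℝ → E3 → E3}
    (hc : WeaklyContinuousL2 T u)
    (hd : ∀ᵐ t ∂volume.restrict (Ioo 0 T), IsWeaklyDivFree (u t)) :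
    ∀ t ∈ Icc 0 T, IsWeaklyDivFree (u t) := by
  intro t ht φ hφ hp
  have h := Measure.eqOn_Icc_of_ae_eq volume hT.ne (g := fun _ => 0) ?_
    (hc.2 _ (memLp_gradField hφ hp)) continuousOn_const ht
  · simp only at h
    rw [← h]
    refine integral_congr_ae (ae_of_all _ fun x => ?_)
    simp only [gradField]
    rw [real_inner_comm, InnerProductSpace.toDual_symm_apply]
  · rw [← restrict_Ioo_eq_restrict_Icc]
    filter_upwards [hd] with s hs
    rw [← hs φ hφ hp]
    refine integral_congr_ae (ae_of_all _ fun x => ?_)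
    simp only [gradField]
    rw [real_inner_comm, InnerProductSpace.toDual_symm_apply]

theorem lintegral_eLpNorm_lt_top {T β : ℝ} {f : ℝ → E3 → ℝ} (h : MemLpBesov T 3 β 3 f) :
    ∫⁻ t in Ioo 0 T, eLpNorm (f t) 3 torusMeasure ^ (3 : ℝ) < ⊤ := by
  refine lt_of_le_of_lt (lintegral_mono fun t => ?_) h.2
  simp only [NNReal.coe_ofNat]
  gcongr
  exact le_self_add

/-- The mixed oscillations in the Onsager range are `o(ε)`. -/
theorem tendsto_mixedOsc {T α β : ℝ} (hα : 1 / 3 ≤ α) (hα' : α < 1) (hβ : (1 - α) / 2 ≤ β)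
    {u U : ℝ → E3 → E3} (hU : RegularField T U)
    (hUu : ∀ᵐ t ∂volume.restrict (Ioo 0 T), U t =ᵐ[volume] u t)
    (h₁ : MemLpBesovVMO T 3 α 3 fun t x => u t x 0)
    (h₂ : MemLpBesovVMO T 3 α 3 fun t x => u t x 1)
    (h₃ : MemLpBesov T 3 β 3 fun t x => u t x 2) (C : ℝ) (hC : 0 ≤ C) :
    Tendsto (fun ε : ℝ => ENNReal.ofReal (C / ε)
      * ∫⁻ t in Ioo 0 T, ∫⁻ x, mixedOsc ε (U t) x ∂torusMeasure) (𝓝[>] 0) (𝓝 0) := by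
  have hi : ∀ i : Fin 3, ∀ᵐ t ∂volume.restrict (Ioo 0 T),
      (fun x => U t x i) =ᵐ[volume] fun x => u t x i := fun i =>
    hUu.mono fun t ht => ht.mono fun x hx => by simp only [hx]
  -- Only the order γ = (1-α)/2 of the vertical regularity is used: it satisfies α + 2γ = 1, and 0 ≤
  -- γ ≤ 1/3 by the bounds on α.
  obtain ⟨B, hB, hB'⟩ := exists_meanOscillation_le (β := β) (γ := (1 - α) / 2) (T := T)
    (f := fun t x => U t x 2) (by linarith) (by linarith) hβ (fun t => (hU.torusMem t).coord 2) (by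
      refine lt_of_le_of_lt (le_of_eq (lintegral_congr_ae ((hi 2).mono fun t ht => ?_))) h₃.2
      simp only [NNReal.coe_ofNat]
      rw [besovNorm_congr_ae ht])
  have h := tendsto_mixed_flux (α := α) (β := (1 - α) / 2) hα (by linarith) (by linarith)
    (O := fun i => meanOscillation T 3 3 fun t x => U t x i)
    (by simpa only [meanOscillation_congr_ae (hi 0)] using h₁.2.2)
    (by simpa only [meanOscillation_congr_ae (hi 1)] using h₂.2.2) hB
    (by filter_upwards [self_mem_nhdsWithin] with ε hε using hB' ε hε) C hC
  refine tendsto_of_tendsto_of_tendsto_of_le_of_le tendsto_const_nhds h (fun _ => bot_le)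
    fun ε => ?_
  exact mul_le_mul_right (lintegral_mixedOsc_le hU.measurable T ε) _

end TorusEuler

theorem theorem1p2 (T : ℝ) (hT : 0 < T)
    (u : ℝ → TorusEuler.E3 → TorusEuler.E3) (u₀ : TorusEuler.E3 → TorusEuler.E3)
    (hu : TorusEuler.IsWeakSolution T u u₀)
    (α β : ℝ) (hα : 1 / 3 ≤ α) (hα' : α < 1) (hβ : (1 - α) / 2 ≤ β)
    (h₁ : TorusEuler.MemLpBesovVMO T 3 α 3 (fun t x => u t x 0))
    (h₂ : TorusEuler.MemLpBesovVMO T 3 α 3 (fun t x => u t x 1))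
    (h₃ : TorusEuler.MemLpBesov T 3 β 3 (fun t x => u t x 2)) :
    (∀ᵐ t ∂(volume.restrict (Ioo 0 T)),
      TorusEuler.kineticEnergy (u t) = TorusEuler.kineticEnergy u₀) ∧
    (TorusEuler.WeaklyContinuousL2 T u →
      ∀ t ∈ Icc 0 T, TorusEuler.kineticEnergy (u t) = TorusEuler.kineticEnergy u₀) := by
  open TorusEuler in
  obtain ⟨U, hU, hUu⟩ := exists_regularField hu.periodic hu.memLp.1 hu.div_free (fun i => by
    fin_cases i
    · exact h₁.2.1
    · exact h₂.2.1
    · exact lintegral_eLpNorm_lt_top h₃)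
  have hUu' : ∀ᵐ t ∂volume.restrict (Ioo 0 T), U t =ᵐ[torusMeasure] u t :=
    hUu.mono fun t ht => ae_torus_of_ae_volume ht
  obtain ⟨U₀, hU₀, hUu₀⟩ := exists_torusMem_ae_eq hu.init_memLp
  have hmom : ∀ w, IsSpaceTest w → ∀ᵐ t ∂volume.restrict (Ioo 0 T), MomentumAt U U₀ w (U t) t := by
    intro w hw
    refine hU.ae_momentumAt hT (fun ψ hψ => ?_) hw
    refine Eq.trans ?_ (hu.momentum ψ hψ)
    congr 1
    · refine integral_congr_ae (hUu'.mono fun t ht => ?_)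
      exact integral_congr_ae (ht.mono fun x hx => by simp only [hx])
    · exact integral_congr_ae (hUu₀.mono fun x hx => by simp only [hx])
  obtain ⟨W, hWc, hWt, hW⟩ := exists_countable_energy_eq hU hU₀
    (hu.init_div_free.congr_ae hUu₀.symm) hmom (tendsto_mixedOsc hα hα' hβ hU hUu h₁ h₂ h₃)
  rw [← kineticEnergy_congr_ae hUu₀]
  refine ⟨?_, fun hc t ht => ?_⟩
  -- The exceptional sets of the countably many test fields form a null set together.
  · filter_upwards [(ae_ball_iff hWc).2 fun w hw => hmom w (hWt w hw), hUu',
      ae_restrict_mem measurableSet_Ioo] with t h h' ht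
    rw [← kineticEnergy_congr_ae h']
    exact hW t (Ioo_subset_Icc_self ht) _ ((hU.torusMem t).mono (by norm_num)) (hU.div_free t) h
  -- At an exceptional time `U t` may be unrelated to `u t`, so the representative is chosen for `u
  -- t` itself; weak continuity supplies the momentum equation and the divergence condition there.
  · obtain ⟨v, hv, hvu⟩ := exists_torusMem_ae_eq (hc.1 t ht)
    rw [← kineticEnergy_congr_ae hvu]
    exact hW t ht v hv ((hc.isWeaklyDivFree hT hu.div_free t ht).congr_ae hvu.symm) fun w hw =>
      (hc.momentumAt hT hU (hWt w hw) hUu' (hmom w (hWt w hw)) t ht).congr_ae hvu.symm
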